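/- Let $n\ge 1$, $F=\{1,\dots,l\}$ with $n+l\ge 2$, and let $\phi:F\to\{1,\dots,n\}$ be non-decreasing. A popsicle of type $(n,\phi)$ is a disc with cyclically ordered boundary points $z_0,\dots,z_n$ and $l$ distinct interior points (sprinkles) $z_f^+$ on the geodesics from $z_{\phi(f)}$ to $z_0$; equivalently (with $z_0=\infty$ in the upper half plane) reals $x_1<\dots<x_n$ and heights $y_f>0$, with $z_f^+=x_{\phi(f)}+\sqrt{-1}\,y_f$ pairwise distinct, up to $z\mapsto sz+b$, $s>0$, $b\in\mathbb R$. A combinatorial type $\star=(\widetilde T,\widetilde F,\widetilde\psi,\Phi,\Psi)$ consists of the following. $\widetilde T$ is a stable rooted tree (each vertex has at least two outgoing edges) with leaves labelled by $\{1,\dots,n\}\sqcup F$. The edges below at least one boundary leaf and their end vertices form a rooted ribbon tree $T$ of discs, with leaves $1,\dots,n$ in this order, and $C(e)\subset\{1,\dots,n\}$ denotes the set of boundary leaves beyond $e\in\mathrm{Edge}(T)$; the other vertices form trees of spheres attached to discs. $\mathrm{Edge}(T)$ includes the root and the leaves, and $\mathrm{Vertex}(T)\sqcup\mathrm{Edge}(T)$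 is ordered away from the root. The colors of an edge of a tree of spheres (or of a sprinkle) are the $\phi(f)$ for the leaves $f$ beyond it; the colors of each sprinkle and of each tree of spheres attached to a disc $v$ lie in $C(d)$ for a single outgoing edge $d$ of $v$ in $T$. $\Phi$ is an order-preserving map from the sphere vertices to $\mathrm{Vertex}(T)\sqcup\mathrm{Edge}(T)$, strictly order-preserving on $\Phi^{-1}(\mathrm{Vertex}(T))$, with $\Phi(w)>v$ if $w$ lies in a tree attached to $v$, such that $w$ and $\Phi(w)$ are alignable: if $\Phi(w)=v$ is a vertex, the colors of each outgoing edge of $w$ lie in $C(d)$ for one outgoing edge $d$ of $v$ in $T$; if $\Phi(w)=e$ is an edge, all the colors of $w$ lie in $C(e)$. Finally, for each $e\in\mathrm{Edge}(T)$ there is a strictly order-preserving surjection $\Psi_e:\Phi^{-1}(e)\to\{1,\dots,m_e\}$ (with $m_e=0$ if $\Phi^{-1}(e)=\emptyset$). A stable popsicle of type $\star$ assigns to each $v\in\mathrm{Vertex}(T)$ a popsicle disc in the upper half plane, with its incoming boundary points, sprinkles and interior nodal points, and to each sphere vertex $w$ a plane with vertical lines carrying its incoming points; the points on each component are distinct and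 sit on the lines of their colors. A sphere with $\Phi(w)=v$ has its lines at the same horizontal coordinates as the lines of the disc $v$; a sphere with $\Phi(w)$ an edge has one line. Isomorphisms are $z\mapsto sz+b$ on discs and $z\mapsto sz+b+\sqrt{-1}\,t$ on spheres, where $s,b$ are common to a disc and all the spheres aligned with it, and $s$ is common to all the spheres with the same $\Phi(w)=e$ and the same value of $\Psi_e$. Let $P_\star$ be the set of isomorphism classes and $$\overline P_{n,F,\phi}=\bigsqcup_\star P_\star ,$$ with the topology of Gromov convergence compatible with the alignment: a sequence of popsicles converges to a stable popsicle of type $\star$ if the marked points, after translations and rescaling at each component, converge to the special points of this component, where the rescaling factors are common to a disc and the spheres aligned with it, and to the spheres with the same $\Phi(w)=e$ and the same value of $\Psi_e$, and where the factor of each later disc or level $(e,k)$, $1\le k\le m_e$, divided by the factor of an earlier one on a path from the root, tends to $0$. The closed sets are generated by the sets of all limits of sequences in $V$, where $V$ ranges over the sets of popsicles. **Theorem.** $\overline P_{n,F,\phi}$ is a compact smooth manifold with corners (Hausdorff and second countable) of dimension $n-2+|F|$. For each type $\star$, the stratum $P_\star$ has codimension $$\operatorname{codim} P_\star=|\mathrm{Vertex}(T)|-1+\sum_{e\in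 \mathrm{Edge}(T)}m_e .$$ More precisely, with $c$ this number, near each point of $P_\star$ there is a corner chart in which $P_\star$ is given by the vanishing of exactly $c$ of the non-negative coordinates while the other coordinates are positive at the point; and the map from the open set of coordinates $(x,y)$ of stable popsicles of type $\star$ to $\overline P_{n,F,\phi}$ is smooth of constant rank $n-2+|F|-c$. -/

import Mathlib

open Filter Topology
open scoped Manifold ContDiff

/-! ## Labels, popsicles -/

/-- The marked points of a popsicle besides the outgoing point `z₀`: `Sum.inl i` is the boundary
point `zᵢ` (the boundary points are numbered by `Fin n`), and `Sum.inr f` is the sprinkle `z_f⁺`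
(the flavors `F` are numbered by `Fin l`). -/
abbrev Mark (n l : ℕ) := Fin n ⊕ Fin l

/-- Planar models of the popsicles of type `(n, φ)`. The disc without `z₀` is the upper half plane,
`zᵢ` is the real number `u.1 i`, the popsicle line from `zᵢ` to `z₀ = ∞` is the vertical ray over
`u.1 i`, and the sprinkle `z_f⁺` is `u.1 (φ f) + √-1 * u.2 f`. The boundary points are ordered and
the sprinkles are pairwise distinct. -/
def planarPopsicles {n l : ℕ} (φ : Fin l → Fin n) : Set ((Fin n → ℝ) × (Fin l → ℝ)) :=
  {u | StrictMono u.1 ∧ (∀ f, 0 < u.2 f) ∧ ∀ f g, f ≠ g → φ f = φ g → u.2 f ≠ u.2 g}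

/-! ## Stable trees -/

/-- A stable rooted tree with leaves labelled by the marks, up to isomorphism: an edge `e` is
recorded as the set of leaves contained in the subtree `T_e`. The root edge is `Finset.univ`, the
leaves (semi-infinite edges) are the singletons. An edge with at least two leaves ends in a vertex,
and this vertex is denoted by the same set; so a vertex `v` has the incoming edge `e_{v,0} = v` and
the outgoing edges `out v` below, of which there are at least two. This is stability for disc
components (which have two boundary nodal/marked points and then one more special point) and for
sphere components (at least three special points) alike. -/
structure StableTree (n l : ℕ) where
  edges : Finset (Finset (Mark n l))
  univ_mem : Finset.univ ∈ edges
  singleton_mem : ∀ a : Mark n l, {a} ∈ edges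
  nonempty_of_mem : ∀ Q ∈ edges, Q.Nonempty
  laminar : ∀ P ∈ edges, ∀ Q ∈ edges, P ⊆ Q ∨ Q ⊆ P ∨ Disjoint P Q

/-- An edge (vertex) belongs to the tree `T` of discs iff some boundary leaf lies above it;
otherwise it belongs to one of the trees of spheres (or is a sprinkle). -/
abbrev IsDisc {n l : ℕ} (Q : Finset (Mark n l)) : Prop := ∃ i : Fin n, Sum.inl i ∈ Q

/-- The canonical color set `C(e)` of an edge of the tree of discs. -/
def canonicalColor {n l : ℕ} (Q : Finset (Mark n l)) : Finset (Fin n) :=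
  Finset.univ.filter fun i => Sum.inl i ∈ Q

/-- The induced color set of an edge of a tree of spheres: the flavors of its leaves. -/
def inducedColor {n l : ℕ} (φ : Fin l → Fin n) (Q : Finset (Mark n l)) : Finset (Fin n) :=
  (Finset.univ.filter fun f => Sum.inr f ∈ Q).image φ

namespace StableTree

variable {n l : ℕ} (T : StableTree n l)

/-- The outgoing edges of the vertex `v`. -/
def out (v : Finset (Mark n l)) : Finset (Finset (Mark n l)) :=
  T.edges.filter fun e => e ⊂ v ∧ ∀ d ∈ T.edges, e ⊂ d → ¬ d ⊂ v

/-- `Vertex(T)`, the disc components. -/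
abbrev DiscVertex := {v : Finset (Mark n l) // v ∈ T.edges ∧ 2 ≤ v.card ∧ IsDisc v}

/-- `Edge(T)`, the edges of the tree of discs, including the root and the `n` leaves. -/
abbrev DiscEdge := {e : Finset (Mark n l) // e ∈ T.edges ∧ IsDisc e}

/-- The vertices of all the trees of spheres, that is, the sphere components. -/
abbrev SphereVertex := {w : Finset (Mark n l) // w ∈ T.edges ∧ 2 ≤ w.card ∧ ¬ IsDisc w}

/-- The edges of `T` other than the root: each is an incoming boundary point (marked or nodal) on
the disc component it comes from. -/
abbrev BoundaryPoint := {e : Finset (Mark n l) // e ∈ T.edges ∧ e ≠ Finset.univ ∧ IsDisc e}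

/-- The remaining edges: the sprinkles, and the nodal points at which a sphere component is
attached to a disc or sphere component. Each is an incoming interior point on the component it
comes from. -/
abbrev InteriorPoint := {e : Finset (Mark n l) // e ∈ T.edges ∧ ¬ IsDisc e}

/-- `Vertex(T) ⊔ Edge(T)`. -/
abbrev Cell := T.DiscVertex ⊕ T.DiscEdge

/-- The strict partial order on `Vertex(T) ⊔ Edge(T)`: `a < b` iff `a ≠ b` lies on the path from
the root to `b`. -/
def CellLt : T.Cell → T.Cell → Prop
  | .inl u, .inl v => v.1 ⊂ u.1
  | .inl u, .inr e => e.1 ⊂ u.1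
  | .inr e, .inl v => v.1 ⊆ e.1
  | .inr e, .inr e' => e'.1 ⊂ e.1

/-- The colors of `e` (a sprinkle or an edge of a tree of spheres) lie in the color set of the
outgoing edge `d` of the disc vertex `v`: `e` lives on the popsicle line of `Σ_v` through `d`. -/
def OnLine (φ : Fin l → Fin n) (v e d : Finset (Mark n l)) : Prop :=
  d ∈ T.out v ∧ IsDisc d ∧ inducedColor φ e ⊆ canonicalColor d

/-- Alignability of a sphere vertex `w` with a vertex or edge of `T`. With a disc vertex `v`: each
outgoing edge of `w` has its colors in the color set of an outgoing edge of `v`. (The layers of `w`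
are then forced: two outgoing edges of `w` are in the same layer iff they belong to the same
outgoing edge of `v`, and the layers are ordered as the outgoing edges of `v`.) With an edge: `w`
has a single layer, whose colors are colors of that edge. -/
def Alignable (φ : Fin l → Fin n) (w : T.SphereVertex) : T.Cell → Prop
  | .inl v => ∀ e ∈ T.out w.1, ∃ d, T.OnLine φ v.1 e d
  | .inr e => inducedColor φ w.1 ⊆ canonicalColor e.1

end StableTree

/-! ## Combinatorial types of stable popsicles -/

/-- A stable tree model `⋆ = (T̃, F̃, ψ̃, Φ, Ψ)` with alignment data. The decompositions of `T̃`, `F̃`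
and `φ` and the `F`-labels are determined by the labelled tree. -/
structure PopsicleType {n l : ℕ} (φ : Fin l → Fin n) extends StableTree n l where
  /-- the tree of discs is a ribbon tree, with leaves in the given order -/
  planar : ∀ e ∈ edges, {i : Fin n | Sum.inl i ∈ e}.OrdConnected
  /-- each sprinkle and each tree of spheres attached to a disc lies on a popsicle line of it -/
  flavored : ∀ v : toStableTree.DiscVertex, ∀ e ∈ toStableTree.out v.1, ¬ IsDisc e →
    ∃ d, toStableTree.OnLine φ v.1 e d
  /-- alignment data I -/
  Φ : toStableTree.SphereVertex → toStableTree.Cell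
  alignable : ∀ w, toStableTree.Alignable φ w (Φ w)
  /-- spheres in a tree attached to the disc `v` (or to a disc above `v`) are aligned beyond `v` -/
  beyond : ∀ (w : toStableTree.SphereVertex) (v : toStableTree.DiscVertex), w.1 ⊂ v.1 →
    toStableTree.CellLt (.inl v) (Φ w)
  /-- `Φ` is order-preserving -/
  monotone : ∀ w w' : toStableTree.SphereVertex, w'.1 ⊂ w.1 →
    Φ w = Φ w' ∨ toStableTree.CellLt (Φ w) (Φ w')
  /-- `Φ` is strictly order-preserving on the spheres that are aligned with discs -/
  strict : ∀ (w w' : toStableTree.SphereVertex) (v v' : toStableTree.DiscVertex), w'.1 ⊂ w.1 →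
    Φ w = .inl v → Φ w' = .inl v' → toStableTree.CellLt (.inl v) (.inl v')
  /-- `mₑ`, which is `0` when no sphere is aligned with `e` -/
  m : toStableTree.DiscEdge → ℕ
  /-- alignment data II, with `Fin mₑ` for `{1, …, mₑ}` -/
  Ψ : ∀ e : toStableTree.DiscEdge,
    {w : toStableTree.SphereVertex // Φ w = .inr e} → Fin (m e)
  Ψ_surjective : ∀ e, Function.Surjective (Ψ e)
  Ψ_strict : ∀ e, ∀ w w' : {w : toStableTree.SphereVertex // Φ w = .inr e},
    w'.1.1 ⊂ w.1.1 → Ψ e w < Ψ e w'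

namespace PopsicleType

variable {n l : ℕ} {φ : Fin l → Fin n} (τ : PopsicleType φ)

/-- `|Vertex(T)| - 1 + ∑ₑ mₑ`. -/
def codim : ℕ := Fintype.card τ.DiscVertex - 1 + ∑ e : τ.DiscEdge, τ.m e

/-- The disc components of the auxiliary model: the discs `v ∈ Vertex(T)`, and for each edge `e` of
`T` a string of `mₑ` semistable discs with one popsicle line. -/
abbrev Level := τ.DiscVertex ⊕ (Σ e : τ.DiscEdge, Fin (τ.m e))

/-- The disc of the auxiliary model with which the sphere `w` is aligned. -/
def level (w : τ.SphereVertex) : τ.Level :=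
  match h : τ.Φ w with
  | .inl v => .inl v
  | .inr e => .inr ⟨e, τ.Ψ e ⟨w, h⟩⟩

/-- The vertex or edge of `T` to which a disc of the auxiliary model belongs. -/
def levelCell : τ.Level → τ.Cell
  | .inl v => .inl v
  | .inr a => .inr a.1

/-- The disc `a` comes before the disc `b` on a path from the root in the auxiliary model. -/
def LevelLt (a b : τ.Level) : Prop :=
  τ.CellLt (τ.levelCell a) (τ.levelCell b) ∨
    ∃ (e : τ.DiscEdge) (k k' : Fin (τ.m e)), k < k' ∧ a = .inr ⟨e, k⟩ ∧ b = .inr ⟨e, k'⟩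

/-- Two outgoing edges of the sphere vertex `w` are in the same layer. -/
def SameLayer (w : τ.SphereVertex) (e e' : Finset (Mark n l)) : Prop :=
  match τ.Φ w with
  | .inl v => ∃ d, τ.OnLine φ v.1 e d ∧ τ.OnLine φ v.1 e' d
  | .inr _ => True

/-! ## Stable popsicles of a given type -/

/-- Coordinates of the special points in planar models of all the components: the horizontal
coordinate of each incoming boundary point and the vertical coordinate of each incoming interior
point, on the component on which it lies. -/
abbrev Coord := (τ.BoundaryPoint → ℝ) × (τ.InteriorPoint → ℝ)

/-- The coordinates of broken popsicles of type `τ`. A disc `Σ_v` is a popsicle in the upper half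
plane. A sphere `Σ_w⁺` is a popsicle sphere in the plane `ℂ`. If it is aligned with a disc `Σ_v`, the
planar models are chosen such that its lines have the same horizontal coordinates as those of
`Σ_v`, hence an incoming point `e` of `Σ_w⁺` lies on the vertical line through the boundary point `d` of
`Σ_v` with `OnLine φ v e d`. If it is aligned with an edge, all incoming points are on one line. -/
def confSet : Set τ.Coord :=
  {c |
    (∀ v : τ.DiscVertex, ∀ d d' : τ.BoundaryPoint, d.1 ∈ τ.out v.1 → d'.1 ∈ τ.out v.1 →
      (∀ i j, Sum.inl i ∈ d.1 → Sum.inl j ∈ d'.1 → i < j) → c.1 d < c.1 d') ∧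
    (∀ v : τ.DiscVertex, ∀ e : τ.InteriorPoint, e.1 ∈ τ.out v.1 → 0 < c.2 e) ∧
    (∀ v : τ.DiscVertex, ∀ e e' : τ.InteriorPoint, e.1 ∈ τ.out v.1 → e'.1 ∈ τ.out v.1 → e ≠ e' →
      (∃ d, τ.OnLine φ v.1 e.1 d ∧ τ.OnLine φ v.1 e'.1 d) → c.2 e ≠ c.2 e') ∧
    (∀ w : τ.SphereVertex, ∀ e e' : τ.InteriorPoint, e.1 ∈ τ.out w.1 → e'.1 ∈ τ.out w.1 → e ≠ e' →
      τ.SameLayer w e.1 e'.1 → c.2 e ≠ c.2 e')}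

theorem isOpen_confSet : IsOpen τ.confSet := by
  have hx : ∀ d, Continuous fun c : τ.Coord => c.1 d := fun d => by fun_prop
  have hy : ∀ e, Continuous fun c : τ.Coord => c.2 e := fun e => by fun_prop
  simp only [confSet, Set.ofPred_and, Set.ofPred_forall]
  refine IsOpen.inter ?_ (IsOpen.inter ?_ (IsOpen.inter ?_ ?_))
  · exact isOpen_iInter_of_finite fun _ => isOpen_iInter_of_finite fun d =>
      isOpen_iInter_of_finite fun d' => isOpen_iInter_of_finite fun _ =>
      isOpen_iInter_of_finite fun _ => isOpen_iInter_of_finite fun _ =>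
      isOpen_lt (hx d) (hx d')
  · exact isOpen_iInter_of_finite fun _ => isOpen_iInter_of_finite fun e =>
      isOpen_iInter_of_finite fun _ => isOpen_lt continuous_const (hy e)
  · exact isOpen_iInter_of_finite fun _ => isOpen_iInter_of_finite fun e =>
      isOpen_iInter_of_finite fun e' => isOpen_iInter_of_finite fun _ =>
      isOpen_iInter_of_finite fun _ => isOpen_iInter_of_finite fun _ =>
      isOpen_iInter_of_finite fun _ => isOpen_ne_fun (hy e) (hy e')
  · exact isOpen_iInter_of_finite fun _ => isOpen_iInter_of_finite fun e =>
      isOpen_iInter_of_finite fun e' => isOpen_iInter_of_finite fun _ =>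
      isOpen_iInter_of_finite fun _ => isOpen_iInter_of_finite fun _ =>
      isOpen_iInter_of_finite fun _ => isOpen_ne_fun (hy e) (hy e')

/-- The open set of coordinates of broken popsicles of type `τ`. -/
def Conf : TopologicalSpace.Opens τ.Coord := ⟨τ.confSet, τ.isOpen_confSet⟩

/-- Isomorphism of broken popsicles of the same type. Discs are identified by the automorphisms
`z ↦ s z + b` of the half plane that fix `∞`; spheres by `z ↦ s z + b + √-1 * t`, with the same
`s` and `b` for components that are aligned with each other. -/
def Iso (c c' : τ.Conf) : Prop :=
  ∃ (s : τ.Level → ℝ) (b : τ.DiscVertex → ℝ) (t : τ.SphereVertex → ℝ), (∀ a, 0 < s a) ∧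
    (∀ v : τ.DiscVertex, ∀ d : τ.BoundaryPoint, d.1 ∈ τ.out v.1 →
      c'.1.1 d = s (.inl v) * c.1.1 d + b v) ∧
    (∀ v : τ.DiscVertex, ∀ e : τ.InteriorPoint, e.1 ∈ τ.out v.1 →
      c'.1.2 e = s (.inl v) * c.1.2 e) ∧
    (∀ w : τ.SphereVertex, ∀ e : τ.InteriorPoint, e.1 ∈ τ.out w.1 →
      c'.1.2 e = s (τ.level w) * c.1.2 e + t w)

theorem iso_equivalence : Equivalence τ.Iso where
  refl c := ⟨1, 0, 0, by simp, by simp, by simp, by simp⟩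
  symm := by
    rintro c c' ⟨s, b, t, hs, h1, h2, h3⟩
    refine ⟨fun a => (s a)⁻¹, fun v => - (s (.inl v))⁻¹ * b v, fun w => - (s (τ.level w))⁻¹ * t w,
      fun a => inv_pos.2 (hs a), fun v d hd => ?_, fun v e he => ?_, fun w e he => ?_⟩
    · have := (hs (.inl v)).ne'
      rw [h1 v d hd]; field_simp; ring
    · have := (hs (.inl v)).ne'
      rw [h2 v e he]; field_simp
    · have := (hs (τ.level w)).ne'
      rw [h3 w e he]; field_simp; ring
  trans := by
    rintro c c' c'' ⟨s, b, t, hs, h1, h2, h3⟩ ⟨s', b', t', hs', h1', h2', h3'⟩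
    refine ⟨fun a => s' a * s a, fun v => s' (.inl v) * b v + b' v,
      fun w => s' (τ.level w) * t w + t' w, fun a => mul_pos (hs' a) (hs a),
      fun v d hd => ?_, fun v e he => ?_, fun w e he => ?_⟩
    · rw [h1' v d hd, h1 v d hd]; ring
    · rw [h2' v e he, h2 v e he]; ring
    · rw [h3' w e he, h3 w e he]; ring

/-- Isomorphism as a setoid. -/
def isoSetoid : Setoid τ.Conf := ⟨τ.Iso, τ.iso_equivalence⟩

/-- Gromov convergence, compatible with the alignment, of a sequence of popsicles (in planar models)
to a broken popsicle of type `τ`: for each disc of the auxiliary model there are scales `s`, and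
there are translations `b` for each disc and `t` for each sphere, such that the marked points,
rescaled at a component, converge to the special points of that component, with the same scale for
all the components that are aligned with each other, and the scales of successive discs of the
auxiliary model become infinitely small compared with each other. -/
def GromovConverges (u : ℕ → (Fin n → ℝ) × (Fin l → ℝ)) (c : τ.Conf) : Prop :=
  ∃ (s : τ.Level → ℕ → ℝ) (b : τ.DiscVertex → ℕ → ℝ) (t : τ.SphereVertex → ℕ → ℝ),
    (∀ a k, 0 < s a k) ∧
    (∀ a a', τ.LevelLt a a' → Tendsto (fun k => s a' k / s a k) atTop (𝓝 0)) ∧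
    (∀ v : τ.DiscVertex, ∀ d : τ.BoundaryPoint, d.1 ∈ τ.out v.1 → ∀ i, Sum.inl i ∈ d.1 →
      Tendsto (fun k => ((u k).1 i - b v k) / s (.inl v) k) atTop (𝓝 (c.1.1 d))) ∧
    (∀ v : τ.DiscVertex, ∀ e : τ.InteriorPoint, e.1 ∈ τ.out v.1 → ∀ f, Sum.inr f ∈ e.1 →
      Tendsto (fun k => (u k).2 f / s (.inl v) k) atTop (𝓝 (c.1.2 e))) ∧
    (∀ w : τ.SphereVertex, ∀ e : τ.InteriorPoint, e.1 ∈ τ.out w.1 → ∀ f, Sum.inr f ∈ e.1 →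
      Tendsto (fun k => ((u k).2 f - t w k) / s (τ.level w) k) atTop (𝓝 (c.1.2 e)))

end PopsicleType

/-! ## The compactified moduli space -/

/-- The compactified moduli space of popsicles of type `(n, φ)`: the disjoint union, over all the
stable combinatorial types `⋆` with alignment data, of the moduli spaces `P_⋆` of isomorphism
classes of stable popsicles of type `⋆`. -/
structure StablePopsicle {n l : ℕ} (φ : Fin l → Fin n) where
  type : PopsicleType φ
  cls : Quotient type.isoSetoid

/-- The isomorphism class of a stable popsicle of type `τ`. -/
def PopsicleType.toStablePopsicle {n l : ℕ} {φ : Fin l → Fin n} (τ : PopsicleType φ)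
    (c : τ.Conf) : StablePopsicle φ :=
  ⟨τ, Quotient.mk τ.isoSetoid c⟩

/-- The stratum `P_⋆` of type `⋆ = τ`. -/
def PopsicleType.stratum {n l : ℕ} {φ : Fin l → Fin n} (τ : PopsicleType φ) :
    Set (StablePopsicle φ) :=
  {p | p.type = τ}

namespace StablePopsicle

variable {n l : ℕ} {φ : Fin l → Fin n}

/-- The sequence `u` of popsicles Gromov converges to the stable popsicle `p`. -/
def IsLimit (u : ℕ → (Fin n → ℝ) × (Fin l → ℝ)) (p : StablePopsicle φ) : Prop :=
  ∃ c : p.type.Conf, Quotient.mk p.type.isoSetoid c = p.cls ∧ p.type.GromovConverges u c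

/-- For a set `U` of popsicles, the set of those stable popsicles `p` such that each sequence of
popsicles that Gromov converges to `p` is eventually in `U`; in other words, the complement of the
set of Gromov limits of sequences of popsicles outside `U`. -/
def hull (φ : Fin l → Fin n) (U : Set ((Fin n → ℝ) × (Fin l → ℝ))) : Set (StablePopsicle φ) :=
  {p | ∀ u, (∀ k, u k ∈ planarPopsicles φ) → IsLimit u p → ∀ᶠ k in atTop, u k ∈ U}

/-- The Gromov topology. Its closed sets are generated by the sets of the Gromov limits of
sequences in `V`, where `V` is any set of popsicles. -/
instance : TopologicalSpace (StablePopsicle φ) :=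
  TopologicalSpace.generateFrom (Set.range (hull φ))

end StablePopsicle

/-! The moduli space is realized as a compact subset of a finite-dimensional real vector space. For
a planar popsicle `u`, the entries of `ratioFun φ u` are differences of horizontal or vertical
positions of two marks, divided by the square root of a sum of two `radicand`s. They are invariant
under translation and rescaling and bounded by `2`. Their extension `limitVal` to stable popsicles
is an embedding (`isEmbedding_limitVal`), and its image is the closure of the set of values on
popsicles (`range_limitVal`). Hence the space is Hausdorff, second countable and compact.

Extension. Near a stable popsicle of type `τ`, a popsicle is given by coordinates `c` on the
components and by scales of the levels, which are products of ratios `r` of successive scales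
(`Represents`). A difference of two positions is a sum over the edges that lie on only one of two
paths from the root, so it is divisible by the scale of the level where the paths separate, and the
quotient `quot` is polynomial in `c` and `r`. Both radicands in a denominator involve the same
boundary point `i`. Therefore their levels lie on the path to `i` and are comparable, and the sum is
governed by the earlier one, without a maximum that would spoil smoothness. Divided by the square of
that scale, the sum stays positive when the ratios vanish (`quotRadicand_pos`), because the special
points of a component are distinct (`quot_ne_zero`). Thus `ratioExt` is smooth up to ratio `0`.

Limits. After passing to a subsequence, any two mutual distances of marks are comparable or one is
negligible against the other (`exists_adapted`). The resulting orders of magnitude form an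
ultrametric. Its balls are the edges of a tree, and a sphere is aligned with the disc, or the place
on an edge, where the distances around its colors have the same order as its diameter. This yields a
type (`Magnitude.type`), and the rescaled coordinates converge along a further subsequence
(`exists_isLimit_subseq`). Conversely, whenever a sequence converges to a stable popsicle, the
levels of its type carry the observed orders of magnitude, and these determine the type
(`IsOrd.type_eq`); so limits are unique (`IsLimit.unique`).

Charts. With the first mark of every component moved to `0`, there remain `n + l - 1` coordinates,
indexed by the free edges. One of them is lost to the overall scale. On every level except the root,
the coordinate of one reference edge is traded for the ratio `r ≥ 0` of that level. Two values of
`ratioFun` with the same denominator have a quotient of gaps as their quotient, so the corner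
coordinates are smooth functions of the ambient coordinates (`cornerCoord`). Parametrization and
coordinates are both smooth between open sets of vector spaces, and transition maps are their
composites. A stratum is the locus where all the ratios vanish, one for each level other than the
root, while the remaining coordinates move freely on it. -/

/-! ## Marks -/

/-- The position of a mark in the order in which the boundary points come first. -/
def markRank {n l : ℕ} : Mark n l → ℕ := Sum.elim (fun i => i.1) (fun f => n + f.1)

theorem markRank_injective {n l : ℕ} : Function.Injective (markRank (n := n) (l := l)) := by
  rintro (⟨a, ha⟩ | ⟨a, ha⟩) (⟨b, hb⟩ | ⟨b, hb⟩) h <;>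
    simp only [markRank, Sum.elim_inl, Sum.elim_inr] at h
  · subst h; rfl
  · omega
  · omega
  · have : a = b := by omega
    subst this; rfl

theorem exists_minMark {n l : ℕ} [NeZero n] (Q : Finset (Mark n l)) :
    ∃ a, (Q.Nonempty → a ∈ Q) ∧ ∀ b ∈ Q, markRank a ≤ markRank b := by
  rcases Q.eq_empty_or_nonempty with rfl | h
  · exact ⟨.inl 0, by simp, by simp⟩
  · obtain ⟨a, ha, hb⟩ := Q.exists_min_image markRank h
    exact ⟨a, fun _ => ha, hb⟩

/-- The first mark of a set. -/
noncomputable def minMark {n l : ℕ} [NeZero n] (Q : Finset (Mark n l)) : Mark n l :=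
  (exists_minMark Q).choose

theorem IsDisc.mono {n l : ℕ} {P Q : Finset (Mark n l)} (h : IsDisc P) (hPQ : P ⊆ Q) : IsDisc Q :=
  h.imp fun _ hi => hPQ hi

section Mark

variable {n l : ℕ} [NeZero n] {P Q : Finset (Mark n l)}

theorem minMark_mem (h : Q.Nonempty) : minMark Q ∈ Q := (exists_minMark Q).choose_spec.1 h

theorem minMark_le {b : Mark n l} (h : b ∈ Q) : markRank (minMark Q) ≤ markRank b :=
  (exists_minMark Q).choose_spec.2 b h

theorem minMark_eq_of_subset (h : P ⊆ Q) (hm : minMark Q ∈ P) : minMark P = minMark Q :=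
  markRank_injective (le_antisymm (minMark_le hm) (minMark_le (h (minMark_mem ⟨_, hm⟩))))

theorem minMark_singleton (a : Mark n l) : minMark {a} = a := by
  simpa using minMark_mem (Finset.singleton_nonempty a)

theorem IsDisc.exists_minMark (h : IsDisc Q) : ∃ i, minMark Q = .inl i := by
  obtain ⟨i, hi⟩ := h
  have := minMark_le hi
  rcases hQ : minMark Q with j | f
  · exact ⟨j, rfl⟩
  · rw [hQ] at this
    have := i.2
    simp only [markRank, Sum.elim_inl, Sum.elim_inr] at *
    omega

theorem isDisc_of_minMark {i : Fin n} (hQ : Q.Nonempty) (h : minMark Q = .inl i) : IsDisc Q :=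
  ⟨i, h ▸ minMark_mem hQ⟩

theorem isDisc_univ : IsDisc (Finset.univ : Finset (Mark n l)) := ⟨0, Finset.mem_univ _⟩

end Mark

/-! ## Laminar families -/

namespace StableTree

variable {n l : ℕ} (T : StableTree n l)

theorem le_or_le {P Q : Finset (Mark n l)} (hP : P ∈ T.edges) (hQ : Q ∈ T.edges) {a : Mark n l}
    (haP : a ∈ P) (haQ : a ∈ Q) : P ⊆ Q ∨ Q ⊆ P := by
  rcases T.laminar P hP Q hQ with h | h | h
  · exact .inl h
  · exact .inr h
  · exact absurd haQ (Finset.disjoint_left.1 h haP)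

/-- The edges that contain `S` share an element, so laminarity makes them a chain. An edge of
smallest cardinality in a chain is its least element. -/
theorem exists_least {S : Finset (Mark n l)} (hS : S.Nonempty) :
    ∃ v ∈ T.edges, S ⊆ v ∧ ∀ e ∈ T.edges, S ⊆ e → v ⊆ e := by
  obtain ⟨v, hv, hmin⟩ := (T.edges.filter (S ⊆ ·)).exists_min_image Finset.card
    ⟨_, Finset.mem_filter.2 ⟨T.univ_mem, Finset.subset_univ _⟩⟩
  rw [Finset.mem_filter] at hv
  refine ⟨v, hv.1, hv.2, fun e he hSe => ?_⟩
  obtain ⟨a, ha⟩ := hS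
  rcases T.le_or_le hv.1 he (hv.2 ha) (hSe ha) with h | h
  · exact h
  · exact (Finset.eq_of_subset_of_card_le h (hmin e (Finset.mem_filter.2 ⟨he, hSe⟩))).ge

theorem exists_parent {e : Finset (Mark n l)} (he : e ∈ T.edges) (hne : e ≠ Finset.univ) :
    ∃ v ∈ T.edges, e ⊂ v ∧ ∀ d ∈ T.edges, e ⊂ d → v ⊆ d := by
  obtain ⟨v, hv, hmin⟩ := (T.edges.filter (e ⊂ ·)).exists_min_image Finset.card
    ⟨_, Finset.mem_filter.2 ⟨T.univ_mem, Finset.ssubset_univ_iff.2 hne⟩⟩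
  rw [Finset.mem_filter] at hv
  refine ⟨v, hv.1, hv.2, fun d hd hed => ?_⟩
  obtain ⟨a, ha⟩ := T.nonempty_of_mem e he
  rcases T.le_or_le hv.1 hd (hv.2.1 ha) (hed.1 ha) with h | h
  · exact h
  · exact (Finset.eq_of_subset_of_card_le h (hmin d (Finset.mem_filter.2 ⟨hd, hed⟩))).ge

theorem mem_out {v e : Finset (Mark n l)} :
    e ∈ T.out v ↔ e ∈ T.edges ∧ e ⊂ v ∧ ∀ d ∈ T.edges, e ⊂ d → ¬ d ⊂ v := by
  simp [out]

theorem exists_child {v : Finset (Mark n l)} (hc : 2 ≤ v.card) {a : Mark n l}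
    (ha : a ∈ v) : ∃ e ∈ T.out v, a ∈ e := by
  have hs : ({a} : Finset (Mark n l)) ⊂ v := by
    refine Finset.ssubset_iff_subset_ne.2 ⟨by simpa using ha, ?_⟩
    rintro rfl
    simp at hc
  obtain ⟨e, he, hmax⟩ := (T.edges.filter (fun e => e ⊂ v ∧ a ∈ e)).exists_max_image Finset.card
    ⟨_, Finset.mem_filter.2 ⟨T.singleton_mem a, hs, by simp⟩⟩
  rw [Finset.mem_filter] at he
  refine ⟨e, T.mem_out.2 ⟨he.1, he.2.1, fun d hd hed hdv => ?_⟩, he.2.2⟩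
  have := hmax d (Finset.mem_filter.2 ⟨hd, hdv, hed.1 he.2.2⟩)
  exact absurd (Finset.card_lt_card hed) (by omega)

theorem child_unique {v e e' : Finset (Mark n l)} (he : e ∈ T.out v) (he' : e' ∈ T.out v)
    {a : Mark n l} (ha : a ∈ e) (ha' : a ∈ e') : e = e' := by
  rw [mem_out] at he he'
  rcases T.le_or_le he.1 he'.1 ha ha' with h | h
  · by_contra hne
    exact he.2.2 e' he'.1 (Finset.ssubset_iff_subset_ne.2 ⟨h, hne⟩) he'.2.1
  · by_contra hne
    exact he'.2.2 e he.1 (Finset.ssubset_iff_subset_ne.2 ⟨h, Ne.symm hne⟩) he.2.1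

/-- An edge below `v` is contained in an outgoing edge of `v`. -/
theorem subset_child {v e d : Finset (Mark n l)} (he : e ∈ T.edges) (hev : e ⊂ v)
    (hd : d ∈ T.out v) {a : Mark n l} (ha : a ∈ e) (had : a ∈ d) : e ⊆ d := by
  rw [mem_out] at hd
  rcases T.le_or_le he hd.1 ha had with h | h
  · exact h
  · by_contra hne
    exact hd.2.2 e he (Finset.ssubset_iff_subset_ne.2 ⟨h, fun h' => hne h'.ge⟩) hev

/-- The vertices, those of the tree of discs and the sphere vertices. -/
abbrev Vertex := {v : Finset (Mark n l) // v ∈ T.edges ∧ 2 ≤ v.card}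

/-- The edges other than the root. -/
abbrev Edge' := {e : Finset (Mark n l) // e ∈ T.edges ∧ e ≠ Finset.univ}

/-- The vertex from which an edge comes. -/
noncomputable def parent (e : T.Edge') : T.Vertex :=
  ⟨(T.exists_parent e.2.1 e.2.2).choose, (T.exists_parent e.2.1 e.2.2).choose_spec.1, by
    have h1 := Finset.card_lt_card (T.exists_parent e.2.1 e.2.2).choose_spec.2.1
    have h2 := (T.nonempty_of_mem _ e.2.1).card_pos
    omega⟩

theorem ssubset_parent (e : T.Edge') : e.1 ⊂ (T.parent e).1 :=
  (T.exists_parent e.2.1 e.2.2).choose_spec.2.1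

theorem parent_subset (e : T.Edge') {d : Finset (Mark n l)} (hd : d ∈ T.edges) (h : e.1 ⊂ d) :
    (T.parent e).1 ⊆ d :=
  (T.exists_parent e.2.1 e.2.2).choose_spec.2.2 d hd h

/-- Translates between the sets `out` used for the types and the function `parent`, over which sums
are easier to index. -/
theorem mem_out_iff {v : Finset (Mark n l)} (hv : v ∈ T.edges) (e : T.Edge') :
    e.1 ∈ T.out v ↔ (T.parent e).1 = v := by
  rw [mem_out]
  refine ⟨fun h => ?_, fun h => ⟨e.2.1, h ▸ T.ssubset_parent e, fun d hd hed hdv => ?_⟩⟩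
  · by_contra hne
    exact h.2.2 _ (T.parent e).2.1 (T.ssubset_parent e)
      (Finset.ssubset_iff_subset_ne.2 ⟨T.parent_subset e hv h.2.1, hne⟩)
  · exact (h ▸ hdv).2 (T.parent_subset e hd hed)

theorem ne_univ_of_mem_out {v e : Finset (Mark n l)} (h : e ∈ T.out v) : e ≠ Finset.univ := by
  rintro rfl
  exact (T.mem_out.1 h).2.1.2 (Finset.subset_univ _)

/-- The outgoing edge of `v` that contains the mark `a`. -/
noncomputable def child (v : T.Vertex) (a : {a // a ∈ v.1}) : T.Edge' :=
  ⟨(T.exists_child v.2.2 a.2).choose,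
    (T.mem_out.1 (T.exists_child v.2.2 a.2).choose_spec.1).1,
    T.ne_univ_of_mem_out (T.exists_child v.2.2 a.2).choose_spec.1⟩

theorem mem_child (v : T.Vertex) (a : {a // a ∈ v.1}) : a.1 ∈ (T.child v a).1 :=
  (T.exists_child v.2.2 a.2).choose_spec.2

theorem child_mem_out (v : T.Vertex) (a : {a // a ∈ v.1}) : (T.child v a).1 ∈ T.out v.1 :=
  (T.exists_child v.2.2 a.2).choose_spec.1

theorem parent_child (v : T.Vertex) (a : {a // a ∈ v.1}) : T.parent (T.child v a) = v :=
  Subtype.ext ((T.mem_out_iff v.2.1 _).1 (T.child_mem_out v a))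

/-- Distinct outgoing edges of a vertex are disjoint, so an edge is determined by its parent and any
one of its marks. -/
theorem eq_child {v : T.Vertex} {e : T.Edge'} (he : T.parent e = v) {a : Mark n l} (ha : a ∈ e.1) :
    e = T.child v ⟨a, he ▸ (T.ssubset_parent e).1 ha⟩ :=
  Subtype.ext (T.child_unique ((T.mem_out_iff v.2.1 e).2 (congrArg _ he)) (T.child_mem_out _ _) ha
    (T.mem_child v ⟨a, _⟩))

/-- The vertex at which the paths to two marks separate. -/
theorem exists_join {a b : Mark n l} (h : a ≠ b) :
    ∃ v : T.Vertex, a ∈ v.1 ∧ b ∈ v.1 ∧ ∀ e ∈ T.edges, a ∈ e → b ∈ e → v.1 ⊆ e := by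
  obtain ⟨v, hv, hS, hmin⟩ := T.exists_least (S := {a, b}) ⟨a, by simp⟩
  have ha : a ∈ v := hS (by simp)
  have hb : b ∈ v := hS (by simp)
  refine ⟨⟨v, hv, ?_⟩, ha, hb, fun e he hae hbe => hmin e he ?_⟩
  · exact Finset.one_lt_card.2 ⟨a, ha, b, hb, h⟩
  · intro c hc
    simp only [Finset.mem_insert, Finset.mem_singleton] at hc
    rcases hc with rfl | rfl <;> assumption

noncomputable def join {a b : Mark n l} (h : a ≠ b) : T.Vertex := (T.exists_join h).choose

theorem left_mem_join {a b : Mark n l} (h : a ≠ b) : a ∈ (T.join h).1 :=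
  (T.exists_join h).choose_spec.1

theorem right_mem_join {a b : Mark n l} (h : a ≠ b) : b ∈ (T.join h).1 :=
  (T.exists_join h).choose_spec.2.1

theorem join_subset {a b : Mark n l} (h : a ≠ b) {e : Finset (Mark n l)} (he : e ∈ T.edges)
    (ha : a ∈ e) (hb : b ∈ e) : (T.join h).1 ⊆ e :=
  (T.exists_join h).choose_spec.2.2 e he ha hb

theorem join_eq {a b : Mark n l} (h : a ≠ b) {v : T.Vertex} {e : Finset (Mark n l)}
    (he : e ∈ T.out v.1) (ha : a ∈ e) (hb : b ∈ v.1) (hbe : b ∉ e) : T.join h = v := by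
  have he' := T.mem_out.1 he
  refine Subtype.ext (Finset.Subset.antisymm (T.join_subset h v.2.1 (he'.2.1.1 ha) hb) ?_)
  by_contra hne
  have hs : (T.join h).1 ⊂ v.1 :=
    ⟨T.join_subset h v.2.1 (he'.2.1.1 ha) hb, hne⟩
  exact hbe (T.subset_child (T.join h).2.1 hs he (T.left_mem_join h) ha (T.right_mem_join h))

theorem child_join_ne {a b : Mark n l} (h : a ≠ b) :
    T.child (T.join h) ⟨a, T.left_mem_join h⟩ ≠ T.child (T.join h) ⟨b, T.right_mem_join h⟩ := by
  intro heq
  have hb := T.mem_child (T.join h) ⟨b, T.right_mem_join h⟩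
  rw [← heq] at hb
  have := T.child_mem_out (T.join h) ⟨a, T.left_mem_join h⟩
  exact (T.mem_out.1 this).2.1.2
    (T.join_subset h (T.child _ _).2.1 (T.mem_child _ ⟨a, _⟩) hb)

/-- A sum along the path from the root to a leaf telescopes. -/
theorem sum_path (g : Finset (Mark n l) → ℝ) (a : Mark n l) :
    ∑ e : T.Edge', (if a ∈ e.1 then g e.1 - g (T.parent e).1 else 0) = g {a} - g Finset.univ := by
  classical
  rw [← Finset.sum_filter, Finset.sum_sub_distrib]
  -- The edges containing `a` form a chain from the root to `{a}`. The edges `e` run through this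
  -- chain without the root, and their parents run through it without `{a}`.
  have h1 : ∑ e : T.Edge' with a ∈ e.1, g e.1 =
      ∑ e ∈ (T.edges.filter (a ∈ ·)).erase Finset.univ, g e := by
    refine Finset.sum_bij (fun e _ => e.1) ?_ ?_ ?_ ?_
    · intro e he
      simp only [Finset.mem_filter, Finset.mem_univ, true_and] at he
      simp [e.2.1, e.2.2, he]
    · exact fun e _ e' _ h => Subtype.ext h
    · intro e he
      simp only [Finset.mem_erase, Finset.mem_filter] at he
      exact ⟨⟨e, he.2.1, he.1⟩, by simp [he.2.2], rfl⟩
    · exact fun _ _ => rfl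
  have h2 : ∑ e : T.Edge' with a ∈ e.1, g (T.parent e).1 =
      ∑ e ∈ (T.edges.filter (a ∈ ·)).erase {a}, g e := by
    refine Finset.sum_bij (fun e _ => (T.parent e).1) ?_ ?_ ?_ ?_
    · intro e he
      simp only [Finset.mem_filter, Finset.mem_univ, true_and] at he
      have hs := T.ssubset_parent e
      simp only [Finset.mem_erase, Finset.mem_filter, (T.parent e).2.1, hs.1 he, and_self, and_true]
      intro h
      have := (T.parent e).2.2
      rw [h] at this
      simp at this
    · intro e he e' he' h
      simp only [Finset.mem_filter, Finset.mem_univ, true_and] at he he'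
      have h := Subtype.ext h
      rw [T.eq_child rfl he, T.eq_child h.symm he']
    · intro v hv
      simp only [Finset.mem_erase, Finset.mem_filter] at hv
      have hc : 2 ≤ v.card := by
        by_contra hlt
        apply hv.1
        have : v.card ≤ 1 := by omega
        refine Finset.eq_singleton_iff_unique_mem.2 ⟨hv.2.2, fun b hb => ?_⟩
        exact Finset.card_le_one.1 this b hb a hv.2.2
      refine ⟨T.child ⟨v, hv.2.1, hc⟩ ⟨a, hv.2.2⟩, ?_, ?_⟩
      · simp [T.mem_child ⟨v, hv.2.1, hc⟩ ⟨a, hv.2.2⟩]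
      · rw [T.parent_child]
    · exact fun _ _ => rfl
  have h3 := Finset.add_sum_erase (T.edges.filter (a ∈ ·)) g (a := Finset.univ)
    (by simp [T.univ_mem])
  have h4 := Finset.add_sum_erase (T.edges.filter (a ∈ ·)) g (a := {a})
    (by simp [T.singleton_mem])
  rw [h1, h2]
  linarith

end StableTree

/-! ### First marks and free edges -/

namespace StableTree

variable {n l : ℕ} [NeZero n] (T : StableTree n l)

theorem minMark_mem_vertex (v : T.Vertex) : minMark v.1 ∈ v.1 :=
  minMark_mem (T.nonempty_of_mem _ v.2.1)

theorem minMark_mem_edge (e : T.Edge') : minMark e.1 ∈ e.1 :=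
  minMark_mem (T.nonempty_of_mem _ e.2.1)

/-- The outgoing edge of `v` that contains the first mark. -/
noncomputable def base (v : T.Vertex) : T.Edge' := T.child v ⟨minMark v.1, T.minMark_mem_vertex v⟩

theorem parent_base (v : T.Vertex) : T.parent (T.base v) = v := T.parent_child _ _

theorem minMark_base (v : T.Vertex) : minMark (T.base v).1 = minMark v.1 := by
  have h := T.ssubset_parent (T.base v)
  rw [T.parent_base] at h
  exact minMark_eq_of_subset h.1 (T.mem_child _ _)

theorem eq_base_iff (e : T.Edge') : e = T.base (T.parent e) ↔
    minMark e.1 = minMark (T.parent e).1 := by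
  constructor
  · intro h
    have := T.minMark_base (T.parent e)
    rwa [← h] at this
  · intro h
    exact T.eq_child rfl (h ▸ T.minMark_mem_edge e)

/-- The edges below the root that do not contain the first mark of their parent. -/
abbrev FreeEdge := {e : T.Edge' // minMark e.1 ≠ minMark (T.parent e).1}

/-- An edge strictly below `v` with the same first mark as `v` is the base of its parent. -/
theorem minMark_parent_eq {e : T.Edge'} {v : Finset (Mark n l)} (hv : v ∈ T.edges)
    (hev : e.1 ⊂ v) {a : Mark n l} (ha : a ∈ e.1) (hav : a = minMark v) :
    minMark e.1 = minMark (T.parent e).1 := by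
  have hp := T.parent_subset e hv hev
  have ha' := (T.ssubset_parent e).1 ha
  subst hav
  rw [minMark_eq_of_subset hev.1 ha, minMark_eq_of_subset hp ha']

/-- Two edges with the same first mark are nested. If they were different, the smaller one would
share its first mark with its parent, which lies between them, and would not be free. -/
theorem minMark_freeEdge_injective : Function.Injective fun e : T.FreeEdge => minMark e.1.1 := by
  intro e e' h
  have h : minMark e.1.1 = minMark e'.1.1 := h
  have he := T.minMark_mem_edge e.1
  have he' := T.minMark_mem_edge e'.1
  by_contra hne
  have hne' : e.1.1 ≠ e'.1.1 := fun h => hne (Subtype.ext (Subtype.ext h))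
  rcases T.le_or_le e.1.2.1 e'.1.2.1 he (h ▸ he') with hs | hs
  · exact e.2 (T.minMark_parent_eq e'.1.2.1 (Finset.ssubset_iff_subset_ne.2 ⟨hs, hne'⟩) he h)
  · exact e'.2 (T.minMark_parent_eq e.1.2.1 (Finset.ssubset_iff_subset_ne.2 ⟨hs, hne'.symm⟩) he'
      h.symm)

theorem exists_freeEdge {a : Mark n l} (ha : a ≠ minMark Finset.univ) :
    ∃ e : T.FreeEdge, minMark e.1.1 = a := by
  -- The largest edge with first mark `a` is free, since its parent is larger and so has another
  -- first mark.
  obtain ⟨e, he, hmax⟩ := (T.edges.filter fun e => a ∈ e ∧ minMark e = a).exists_max_image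
    Finset.card ⟨{a}, by simp [T.singleton_mem, minMark_singleton]⟩
  rw [Finset.mem_filter] at he
  have hne : e ≠ Finset.univ := by rintro rfl; exact ha he.2.2.symm
  refine ⟨⟨⟨e, he.1, hne⟩, fun h => ?_⟩, he.2.2⟩
  have hs := T.ssubset_parent ⟨e, he.1, hne⟩
  have := hmax _ (Finset.mem_filter.2 ⟨(T.parent ⟨e, he.1, hne⟩).2.1, hs.1 he.2.1, by
    rw [← h]; exact he.2.2⟩)
  exact absurd (Finset.card_lt_card hs) (not_lt.2 this)

/-- Taking first marks is a bijection from the free edges to the marks other than the first one.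
This count is independent of the type, which is why all charts have the same dimension. -/
theorem card_freeEdge : Fintype.card T.FreeEdge = n + l - 1 := by
  rw [← Fintype.card_congr (α := {a : Mark n l // a ≠ minMark Finset.univ}) ?_]
  · simp
  · refine (Equiv.ofBijective (fun e : T.FreeEdge => (⟨minMark e.1.1, ?_⟩ :
      {a : Mark n l // a ≠ minMark Finset.univ})) ⟨?_, ?_⟩).symm
    · intro h
      exact e.2 (T.minMark_parent_eq T.univ_mem (Finset.ssubset_univ_iff.2 e.1.2.2)
        (T.minMark_mem_edge e.1) h)
    · intro e e' h
      exact T.minMark_freeEdge_injective (congrArg Subtype.val h)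
    · rintro ⟨a, ha⟩
      obtain ⟨e, he⟩ := T.exists_freeEdge ha
      exact ⟨e, Subtype.ext he⟩

end StableTree

/-- The color of a mark. -/
def markColor {n l : ℕ} (φ : Fin l → Fin n) : Mark n l → Fin n := Sum.elim id φ

namespace PopsicleType

variable {n l : ℕ} {φ : Fin l → Fin n} (τ : PopsicleType φ)

/-! ## The order on the levels -/

/-- The set of marks beyond a level. -/
def levelSet : τ.Level → Finset (Mark n l)
  | .inl v => v.1
  | .inr a => a.1.1

/-- A disc vertex and the string on the edge that ends in it have the same set of marks. The string
comes first on the path from the root, so the vertex gets the key `⊤`. -/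
def levelKey : τ.Level → WithTop ℕ
  | .inl _ => ⊤
  | .inr a => (a.2 : ℕ)

/-- A lexicographic form of the order: reverse inclusion, refined by `levelKey`. Transitivity,
irreflexivity and comparability along a path are read off from it. -/
theorem levelLt_iff {a b : τ.Level} : τ.LevelLt a b ↔
    τ.levelSet b ⊂ τ.levelSet a ∨ τ.levelSet b = τ.levelSet a ∧ τ.levelKey a < τ.levelKey b := by
  rcases a with u | ⟨e, k⟩ <;> rcases b with v | ⟨e', k'⟩
  · simp [LevelLt, levelCell, StableTree.CellLt, levelSet, levelKey]
  · simp [LevelLt, levelCell, StableTree.CellLt, levelSet, levelKey]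
  · simp [LevelLt, levelCell, StableTree.CellLt, levelSet, levelKey, subset_iff_ssubset_or_eq]
  · simp only [LevelLt, levelCell, StableTree.CellLt, levelSet, levelKey, Sum.inr.injEq]
    refine or_congr Iff.rfl ⟨?_, ?_⟩
    · rintro ⟨e₁, k₁, k₂, hk, h1, h2⟩
      cases h1; cases h2
      exact ⟨rfl, by exact_mod_cast hk⟩
    · rintro ⟨h1, h2⟩
      obtain rfl : e' = e := Subtype.ext h1
      exact ⟨e', k, k', by exact_mod_cast h2, rfl, rfl⟩

theorem level_ext {a b : τ.Level} (h : τ.levelSet a = τ.levelSet b)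
    (h' : τ.levelKey a = τ.levelKey b) : a = b := by
  rcases a with u | ⟨e, k⟩ <;> rcases b with v | ⟨e', k'⟩
  · exact congrArg _ (Subtype.ext h)
  · simp [levelKey] at h'
  · simp [levelKey] at h'
  · obtain rfl : e = e' := Subtype.ext h
    simp only [levelKey, Nat.cast_inj] at h'
    obtain rfl : k = k' := Fin.ext h'
    rfl

theorem levelSet_mem (a : τ.Level) : τ.levelSet a ∈ τ.edges := by
  rcases a with u | a
  · exact u.2.1
  · exact a.1.2.1

theorem levelSet_disc (a : τ.Level) : IsDisc (τ.levelSet a) := by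
  rcases a with u | a
  · exact u.2.2.2
  · exact a.1.2.2

variable {τ}

theorem LevelLt.subset {a b : τ.Level} (h : τ.LevelLt a b) : τ.levelSet b ⊆ τ.levelSet a := by
  rcases τ.levelLt_iff.1 h with h | h
  · exact h.1
  · exact h.1.le

theorem LevelLt.trans {a b c : τ.Level} (h : τ.LevelLt a b) (h' : τ.LevelLt b c) :
    τ.LevelLt a c := by
  rw [levelLt_iff] at *
  rcases h with h | h <;> rcases h' with h' | h'
  · exact .inl (h'.trans h)
  · exact .inl (h'.1 ▸ h)
  · exact .inl (h.1 ▸ h')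
  · exact .inr ⟨h'.1.trans h.1, h.2.trans h'.2⟩

theorem LevelLt.irrefl (a : τ.Level) : ¬ τ.LevelLt a a := by
  rw [levelLt_iff]
  rintro (h | h)
  · exact h.2 h.1
  · exact lt_irrefl _ h.2

theorem LevelLt.asymm {a b : τ.Level} (h : τ.LevelLt a b) : ¬ τ.LevelLt b a :=
  fun h' => LevelLt.irrefl _ (h.trans h')

/-- Levels with a common mark lie on one path from the root, because their sets are nested by
laminarity. -/
theorem levelLt_trichotomy {a b : τ.Level} {x : Mark n l} (ha : x ∈ τ.levelSet a)
    (hb : x ∈ τ.levelSet b) : τ.LevelLt a b ∨ a = b ∨ τ.LevelLt b a := by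
  simp only [levelLt_iff]
  by_cases he : τ.levelSet a = τ.levelSet b
  · rcases lt_trichotomy (τ.levelKey a) (τ.levelKey b) with h | h | h
    · exact .inl (.inr ⟨he.symm, h⟩)
    · exact .inr (.inl (level_ext τ he h))
    · exact .inr (.inr (.inr ⟨he, h⟩))
  · rcases τ.le_or_le (τ.levelSet_mem a) (τ.levelSet_mem b) ha hb with h | h
    · exact .inr (.inr (.inl (Finset.ssubset_iff_subset_ne.2 ⟨h, he⟩)))
    · exact .inl (.inl (Finset.ssubset_iff_subset_ne.2 ⟨h, Ne.symm he⟩))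

variable (τ)

def LevelLe (a b : τ.Level) : Prop := a = b ∨ τ.LevelLt a b

variable {τ}

theorem LevelLe.refl (a : τ.Level) : τ.LevelLe a a := .inl rfl

theorem LevelLe.trans {a b c : τ.Level} (h : τ.LevelLe a b) (h' : τ.LevelLe b c) :
    τ.LevelLe a c := by
  rcases h with rfl | h
  · exact h'
  · rcases h' with rfl | h'
    · exact .inr h
    · exact .inr (h.trans h')

theorem LevelLe.antisymm {a b : τ.Level} (h : τ.LevelLe a b) (h' : τ.LevelLe b a) : a = b := by
  rcases h with rfl | h
  · rfl
  · rcases h' with rfl | h'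
    · rfl
    · exact absurd h' h.asymm

theorem LevelLe.subset {a b : τ.Level} (h : τ.LevelLe a b) : τ.levelSet b ⊆ τ.levelSet a := by
  rcases h with rfl | h
  · exact subset_rfl
  · exact h.subset

theorem LevelLe.lt_or_eq {a b : τ.Level} (h : τ.LevelLe a b) : τ.LevelLt a b ∨ a = b := h.symm

variable (τ)

/-! ## The level of a vertex -/

theorem level_eq_inl {w : τ.SphereVertex} {v : τ.DiscVertex} (h : τ.Φ w = .inl v) :
    τ.level w = .inl v := by
  unfold level
  split
  · next h' => rw [h] at h'; cases h'; rfl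
  · next h' => rw [h] at h'; cases h'

theorem level_eq_inr {w : τ.SphereVertex} {e : τ.DiscEdge} (h : τ.Φ w = .inr e) :
    τ.level w = .inr ⟨e, τ.Ψ e ⟨w, h⟩⟩ := by
  unfold level
  split
  · next h' => rw [h] at h'; cases h'
  · next h' => rw [h] at h'; cases h'; rfl

theorem levelCell_level (w : τ.SphereVertex) : τ.levelCell (τ.level w) = τ.Φ w := by
  rcases h : τ.Φ w with v | e
  · rw [τ.level_eq_inl h]; rfl
  · rw [τ.level_eq_inr h]; rfl

/-- The level of a disc or sphere component. -/
def vertexLevel (v : τ.Vertex) : τ.Level :=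
  if h : IsDisc v.1 then .inl ⟨v.1, v.2.1, v.2.2, h⟩ else τ.level ⟨v.1, v.2.1, v.2.2, h⟩

theorem vertexLevel_disc (v : τ.DiscVertex) : τ.vertexLevel ⟨v.1, v.2.1, v.2.2.1⟩ = .inl v :=
  dif_pos v.2.2.2

theorem vertexLevel_sphere (w : τ.SphereVertex) :
    τ.vertexLevel ⟨w.1, w.2.1, w.2.2.1⟩ = τ.level w :=
  dif_neg w.2.2.2

variable {τ}

/-- The order conditions on the alignment data say that scales strictly decrease along the tree. A
disc comes before its spheres by `beyond`. For two spheres, `monotone` leaves only the case of equal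
cells, where `strict` rules out a disc and `Ψ_strict` orders the string on an edge. -/
theorem vertexLevel_lt {u v : τ.Vertex} (h : u.1 ⊂ v.1) :
    τ.LevelLt (τ.vertexLevel v) (τ.vertexLevel u) := by
  by_cases hv : IsDisc v.1
  · rw [vertexLevel, dif_pos hv]
    by_cases hu : IsDisc u.1
    · rw [vertexLevel, dif_pos hu]
      exact .inl h
    · rw [vertexLevel, dif_neg hu]
      refine .inl ?_
      rw [levelCell_level]
      exact τ.beyond ⟨u.1, u.2.1, u.2.2, hu⟩ ⟨v.1, v.2.1, v.2.2, hv⟩ h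
  · have hu : ¬ IsDisc u.1 := fun hu => hv (hu.mono h.1)
    rw [vertexLevel, dif_neg hv, vertexLevel, dif_neg hu]
    have hm := τ.monotone ⟨v.1, v.2.1, v.2.2, hv⟩ ⟨u.1, u.2.1, u.2.2, hu⟩ h
    rcases hm with hm | hm
    · rcases hΦ : τ.Φ ⟨v.1, v.2.1, v.2.2, hv⟩ with d | e
      · have := τ.strict ⟨v.1, v.2.1, v.2.2, hv⟩ ⟨u.1, u.2.1, u.2.2, hu⟩ d d h hΦ (hm ▸ hΦ)
        exact absurd (subset_rfl) this.2
      · refine .inr ⟨e, _, _, τ.Ψ_strict e ⟨_, hΦ⟩ ⟨_, hm ▸ hΦ⟩ h, τ.level_eq_inr hΦ,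
          τ.level_eq_inr _⟩
    · refine .inl ?_
      rwa [levelCell_level, levelCell_level]

theorem vertexLevel_le {u v : τ.Vertex} (h : u.1 ⊆ v.1) :
    τ.LevelLe (τ.vertexLevel v) (τ.vertexLevel u) := by
  by_cases he : u.1 = v.1
  · exact .inl (congrArg _ (Subtype.ext he.symm))
  · exact .inr (vertexLevel_lt (Finset.ssubset_iff_subset_ne.2 ⟨h, he⟩))

variable (τ)

/-- A disc edge contains the boundary points of the colors of its sprinkles. -/
theorem color_mem_of_isDisc {Q : Finset (Mark n l)} (hQ : Q ∈ τ.edges) (hd : IsDisc Q)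
    {f : Fin l} (hf : .inr f ∈ Q) : .inl (φ f) ∈ Q := by
  -- At the smallest disc vertex `v` beyond which `f` lies, the path to `f` leaves the tree of
  -- discs, so `flavored` puts the color of `f` into `v`. Every other disc edge containing `f`
  -- contains `v`.
  obtain ⟨v, hv, hmin⟩ := (τ.edges.filter fun e => IsDisc e ∧ .inr f ∈ e).exists_min_image
    Finset.card ⟨Q, Finset.mem_filter.2 ⟨hQ, hd, hf⟩⟩
  rw [Finset.mem_filter] at hv
  obtain ⟨hve, ⟨i, hi⟩, hvf⟩ := hv
  have hc : 2 ≤ v.card := Finset.one_lt_card.2 ⟨_, hi, _, hvf, by simp⟩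
  obtain ⟨e, he, hfe⟩ := τ.exists_child hc hvf
  have hout := τ.mem_out.1 he
  have hnd : ¬ IsDisc e := fun h => by
    have := hmin e (Finset.mem_filter.2 ⟨hout.1, h, hfe⟩)
    exact absurd (Finset.card_lt_card hout.2.1) (by omega)
  obtain ⟨d, hd1, hd2, hd3⟩ := τ.flavored ⟨v, hve, hc, i, hi⟩ e he hnd
  have h1 : φ f ∈ canonicalColor d := hd3 (by
    simp only [inducedColor, Finset.mem_image, Finset.mem_filter, Finset.mem_univ, true_and]
    exact ⟨f, hfe, rfl⟩)
  simp only [canonicalColor, Finset.mem_filter, Finset.mem_univ, true_and] at h1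
  have h2 := (τ.mem_out.1 hd1).2.1.1 h1
  rcases τ.le_or_le hve hQ hvf hf with h | h
  · exact h h2
  · have := hmin Q (Finset.mem_filter.2 ⟨hQ, hd, hf⟩)
    exact Finset.eq_of_subset_of_card_le h this ▸ h2

theorem mem_inducedColor {e : Finset (Mark n l)} {f : Fin l} (hf : .inr f ∈ e) :
    φ f ∈ inducedColor φ e := by
  simp only [inducedColor, Finset.mem_image, Finset.mem_filter, Finset.mem_univ, true_and]
  exact ⟨f, hf, rfl⟩

theorem mem_canonicalColor {e : Finset (Mark n l)} {i : Fin n} :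
    i ∈ canonicalColor e ↔ .inl i ∈ e := by
  simp [canonicalColor]

theorem OnLine.mem {v e d : Finset (Mark n l)} (h : τ.OnLine φ v e d) {f : Fin l}
    (hf : .inr f ∈ e) : .inl (φ f) ∈ d :=
  mem_canonicalColor.1 (h.2.2 (mem_inducedColor hf))

/-- On discs this comes from `flavored`, on spheres from `alignable`. It places the level of a
component on the paths to all of its colors, so that horizontal differences of its marks are
divisible by its scale. -/
theorem color_mem_levelSet (w : τ.Vertex) {a : Mark n l} (ha : a ∈ w.1) :
    .inl (markColor φ a) ∈ τ.levelSet (τ.vertexLevel w) := by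
  by_cases hw : IsDisc w.1
  · rw [vertexLevel, dif_pos hw]
    rcases a with i | f
    · exact ha
    · exact τ.color_mem_of_isDisc w.2.1 hw ha
  · rw [vertexLevel, dif_neg hw]
    rcases a with i | f
    · exact absurd ⟨i, ha⟩ hw
    · have hal := τ.alignable ⟨w.1, w.2.1, w.2.2, hw⟩
      rcases hΦ : τ.Φ ⟨w.1, w.2.1, w.2.2, hw⟩ with v | e
      · rw [τ.level_eq_inl hΦ]
        rw [hΦ] at hal
        obtain ⟨d, hd⟩ := hal _ (τ.child_mem_out w ⟨_, ha⟩)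
        exact (τ.mem_out.1 hd.1).2.1.1 (OnLine.mem τ hd (τ.mem_child w ⟨_, ha⟩))
      · rw [τ.level_eq_inr hΦ]
        rw [hΦ] at hal
        exact mem_canonicalColor.1 (hal (mem_inducedColor ha))

end PopsicleType

namespace PopsicleType

variable {n l : ℕ} {φ : Fin l → Fin n} (τ : PopsicleType φ)

/-! ## Scales of levels as products of ratios -/

section Scale

open Classical in
/-- The scale of a level, as the product of the ratios of successive scales. -/
noncomputable def scale (r : τ.Level → ℝ) (a : τ.Level) : ℝ :=
  ∏ b with τ.LevelLe b a, r b

open Classical in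
/-- The quotient of the scales of two levels `a ≤ b`. -/
noncomputable def scaleQuot (r : τ.Level → ℝ) (a b : τ.Level) : ℝ :=
  ∏ c with τ.LevelLe c b ∧ ¬ τ.LevelLe c a, r c

variable {τ}

theorem levelLt_wellFounded : WellFounded τ.LevelLt := by
  have : IsTrans τ.Level τ.LevelLt := ⟨fun _ _ _ => LevelLt.trans⟩
  have : Std.Irrefl τ.LevelLt := ⟨LevelLt.irrefl⟩
  exact Finite.wellFounded_of_trans_of_irrefl _

theorem scale_mul_scaleQuot (r : τ.Level → ℝ) {a b : τ.Level} (h : τ.LevelLe a b) :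
    τ.scale r a * τ.scaleQuot r a b = τ.scale r b := by
  classical
  rw [scale, scaleQuot, scale, ← Finset.prod_union]
  · congr 1
    ext c
    simp only [Finset.mem_union, Finset.mem_filter, Finset.mem_univ, true_and]
    constructor
    · rintro (hc | hc)
      · exact hc.trans h
      · exact hc.1
    · intro hc
      by_cases hca : τ.LevelLe c a
      · exact .inl hca
      · exact .inr ⟨hc, hca⟩
  · rw [Finset.disjoint_left]
    intro c hc hc'
    simp only [Finset.mem_filter, Finset.mem_univ, true_and] at hc hc'
    exact hc'.2 hc

theorem scale_pos {r : τ.Level → ℝ} (hr : ∀ a, 0 < r a) (a : τ.Level) : 0 < τ.scale r a :=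
  Finset.prod_pos fun _ _ => hr _

theorem scaleQuot_self (r : τ.Level → ℝ) (a : τ.Level) : τ.scaleQuot r a a = 1 := by
  classical
  rw [scaleQuot, Finset.filter_eq_empty_iff.2, Finset.prod_empty]
  exact fun c _ hc => hc.2 hc.1

theorem scaleQuot_eq_zero {r : τ.Level → ℝ} {a b : τ.Level} (h : τ.LevelLt a b) (hr : r b = 0) :
    τ.scaleQuot r a b = 0 := by
  classical
  refine Finset.prod_eq_zero (i := b) ?_ hr
  simp only [Finset.mem_filter, Finset.mem_univ, true_and]
  refine ⟨LevelLe.refl b, ?_⟩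
  rintro (h' | h')
  · exact LevelLt.irrefl b (h' ▸ h)
  · exact h.asymm h'

variable (τ)
variable [NeZero n] [Fact (2 ≤ n + l)]

/-- The vertex of the root disc. -/
def rootVertex : τ.DiscVertex :=
  ⟨Finset.univ, τ.univ_mem, by simpa using Fact.out, isDisc_univ⟩

def rootLevel : τ.Level := .inl τ.rootVertex

variable {τ}

theorem rootLevel_le (a : τ.Level) : τ.LevelLe τ.rootLevel a := by
  rcases a with v | ⟨e, k⟩
  · by_cases h : v.1 = Finset.univ
    · exact .inl (congrArg _ (Subtype.ext h.symm))
    · exact .inr (.inl (Finset.ssubset_univ_iff.2 h))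
  · refine .inr (.inl (Finset.ssubset_univ_iff.2 fun h => ?_))
    obtain ⟨w, hw⟩ := τ.Ψ_surjective e k
    have := τ.beyond w.1 τ.rootVertex (Finset.ssubset_univ_iff.2 fun h' =>
      w.1.2.2.2 (h' ▸ isDisc_univ))
    rw [w.2] at this
    exact this.2 (h ▸ Finset.subset_univ _)

theorem ne_rootLevel_of_lt {a b : τ.Level} (h : τ.LevelLt a b) : b ≠ τ.rootLevel := by
  rintro rfl
  rcases rootLevel_le a with h' | h'
  · exact LevelLt.irrefl a (h' ▸ h)
  · exact h.asymm h'

/-- The levels before `a` all contain its marks, hence form a chain. Its last element is the one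
with the most levels up to it. -/
theorem exists_pred {a : τ.Level} (ha : a ≠ τ.rootLevel) :
    ∃ b, τ.LevelLt b a ∧ ∀ c, τ.LevelLt c a → τ.LevelLe c b := by
  classical
  obtain ⟨b, hb, hmax⟩ := (Finset.univ.filter fun b => τ.LevelLt b a).exists_max_image
    (fun b => (Finset.univ.filter fun c => τ.LevelLe c b).card) ⟨τ.rootLevel, by
      simpa using (rootLevel_le a).lt_or_eq.resolve_right (Ne.symm ha)⟩
  simp only [Finset.mem_filter, Finset.mem_univ, true_and] at hb hmax
  refine ⟨b, hb, fun c hc => ?_⟩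
  obtain ⟨i, hi⟩ := τ.levelSet_disc a
  rcases levelLt_trichotomy (hc.subset hi) (hb.subset hi) with h | h | h
  · exact .inr h
  · exact .inl h
  · have := hmax c hc
    refine absurd (Finset.card_lt_card (Finset.ssubset_iff_of_subset ?_ |>.2 ⟨c, ?_, ?_⟩))
      (not_lt.2 this)
    · intro x hx
      simp only [Finset.mem_filter, Finset.mem_univ, true_and] at hx ⊢
      exact hx.trans (.inr h)
    · simpa using LevelLe.refl c
    · simp only [Finset.mem_filter, Finset.mem_univ, true_and]
      rintro (h' | h')
      · exact LevelLt.irrefl b (h' ▸ h)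
      · exact h.asymm h'

variable (τ)

open Classical in
/-- The level before a level other than the root. -/
noncomputable def pred (a : τ.Level) : τ.Level :=
  if h : a ≠ τ.rootLevel then (exists_pred h).choose else τ.rootLevel

variable {τ}

theorem pred_lt {a : τ.Level} (ha : a ≠ τ.rootLevel) : τ.LevelLt (τ.pred a) a := by
  rw [pred, dif_pos ha]
  exact (exists_pred ha).choose_spec.1

theorem le_pred {a b : τ.Level} (h : τ.LevelLt b a) : τ.LevelLe b (τ.pred a) := by
  rw [pred, dif_pos (ne_rootLevel_of_lt h)]
  exact (exists_pred (ne_rootLevel_of_lt h)).choose_spec.2 b h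

theorem scale_pred (r : τ.Level → ℝ) {a : τ.Level} (ha : a ≠ τ.rootLevel) :
    τ.scale r a = r a * τ.scale r (τ.pred a) := by
  classical
  rw [scale, scale, ← Finset.prod_insert]
  · congr 1
    ext c
    simp only [Finset.mem_insert, Finset.mem_filter, Finset.mem_univ, true_and]
    constructor
    · rintro (h | h)
      · exact .inl h
      · exact .inr (le_pred h)
    · rintro (h | h)
      · exact .inl h
      · exact h.trans (.inr (pred_lt ha))
  · simp only [Finset.mem_filter, Finset.mem_univ, true_and]
    rintro (h' | h')
    · have hp := pred_lt ha
      generalize τ.pred a = b at *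
      subst h'
      exact LevelLt.irrefl _ hp
    · exact (pred_lt ha).asymm h'

theorem scale_rootLevel (r : τ.Level → ℝ) : τ.scale r τ.rootLevel = r τ.rootLevel := by
  classical
  rw [scale, Finset.prod_eq_single τ.rootLevel]
  · intro b hb hne
    simp only [Finset.mem_filter, Finset.mem_univ, true_and] at hb
    exact absurd (hb.antisymm (rootLevel_le b)) hne
  · intro h
    simp [LevelLe.refl] at h

open Classical in
variable (τ) in
/-- The ratios of successive scales. -/
noncomputable def ratio (s : τ.Level → ℝ) (a : τ.Level) : ℝ :=
  if a = τ.rootLevel then 1 else s a / s (τ.pred a)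

theorem ratio_pos {s : τ.Level → ℝ} (hs : ∀ a, 0 < s a) (a : τ.Level) : 0 < τ.ratio s a := by
  unfold ratio
  split_ifs
  · exact one_pos
  · exact div_pos (hs _) (hs _)

/-- The product of successive ratios telescopes along the path from the root. The ratio at the root
is set to `1`, so the overall scale remains as a separate factor; this is the `S` of the later
statements. -/
theorem scale_ratio {s : τ.Level → ℝ} (hs : ∀ a, 0 < s a) (a : τ.Level) :
    s τ.rootLevel * τ.scale (τ.ratio s) a = s a := by
  refine levelLt_wellFounded.induction (C := fun a => s τ.rootLevel * τ.scale (τ.ratio s) a = s a)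
    a fun a ih => ?_
  · by_cases ha : a = τ.rootLevel
    · subst ha
      rw [scale_rootLevel, ratio, if_pos rfl, mul_one]
    · rw [scale_pred _ ha, mul_left_comm, ih _ (pred_lt ha), ratio, if_neg ha,
        div_mul_cancel₀ _ (hs _).ne']

end Scale

/-! ## Positions of the marks -/

/-- The mark whose path computes the horizontal (`B = true`) or vertical (`B = false`) position of
a mark. -/
def anchor (φ : Fin l → Fin n) (B : Bool) (a : Mark n l) : Mark n l :=
  if B then .inl (markColor φ a) else a

/-- The horizontal (`B = true`) or vertical (`B = false`) position of a mark. -/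
def pos (φ : Fin l → Fin n) (u : (Fin n → ℝ) × (Fin l → ℝ)) (B : Bool) (a : Mark n l) : ℝ :=
  if B then u.1 (markColor φ a) else Sum.elim 0 u.2 a

open Classical in
/-- The coefficient of the coordinate of an edge in the position of a mark. -/
noncomputable def coeff (B : Bool) (a : Mark n l) (e : τ.Edge') : ℝ :=
  if (IsDisc e.1 ↔ B = true) ∧ anchor φ B a ∈ e.1 then 1 else 0

/-- The positions are given by coordinates `c` on the components and scales `s`, up to
translations. -/
def Represents (u : (Fin n → ℝ) × (Fin l → ℝ)) (c : τ.Edge' → ℝ) (s : τ.Level → ℝ) : Prop :=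
  ∀ B a b, pos φ u B a - pos φ u B b =
    ∑ e, (τ.coeff B a e - τ.coeff B b e) * c e * s (τ.vertexLevel (τ.parent e))

/-- The popsicle with coordinates `c` on the components and scales `s`. -/
noncomputable def glue (c : τ.Edge' → ℝ) (s : τ.Level → ℝ) : (Fin n → ℝ) × (Fin l → ℝ) :=
  (fun i => ∑ e, τ.coeff true (.inl i) e * c e * s (τ.vertexLevel (τ.parent e)),
    fun f => ∑ e, τ.coeff false (.inr f) e * c e * s (τ.vertexLevel (τ.parent e)))

variable {τ}

theorem pos_glue (c : τ.Edge' → ℝ) (s : τ.Level → ℝ) (B : Bool) (a : Mark n l) :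
    pos φ (τ.glue c s) B a =
      ∑ e, τ.coeff B a e * c e * s (τ.vertexLevel (τ.parent e)) := by
  rcases B with _ | _
  · rcases a with i | f
    · refine (Finset.sum_eq_zero fun e _ => ?_).symm
      rw [coeff, if_neg, zero_mul, zero_mul]
      rintro ⟨h1, h2⟩
      exact absurd (h1.1 ⟨i, h2⟩) (by simp)
    · rfl
  · rfl

theorem represents_glue (c : τ.Edge' → ℝ) (s : τ.Level → ℝ) : τ.Represents (τ.glue c s) c s := by
  intro B a b
  rw [pos_glue, pos_glue, ← Finset.sum_sub_distrib]
  exact Finset.sum_congr rfl fun e _ => by ring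

theorem pos_anchor (u : (Fin n → ℝ) × (Fin l → ℝ)) (B : Bool) (a : Mark n l) :
    pos φ u B (anchor φ B a) = pos φ u B a := by
  rcases B with _ | _ <;> rfl

section Gap

variable [NeZero n]

variable (τ) in
/-- The position of the first mark of an edge, relative to the first mark of its parent. -/
noncomputable def gap (u : (Fin n → ℝ) × (Fin l → ℝ)) (e : τ.Edge') : ℝ :=
  pos φ u (decide (IsDisc e.1)) (minMark e.1) -
    pos φ u (decide (IsDisc e.1)) (minMark (τ.parent e).1)

/-- Along the path to the anchor of `a` the gaps telescope. Hence the gaps determine all differences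
of positions. -/
theorem sum_coeff_gap (u : (Fin n → ℝ) × (Fin l → ℝ)) (B : Bool) (a : Mark n l) :
    ∑ e, τ.coeff B a e * τ.gap u e = pos φ u B a - pos φ u B (minMark Finset.univ) := by
  have h := τ.sum_path (fun Q => pos φ u B (minMark Q)) (anchor φ B a)
  rw [minMark_singleton, pos_anchor] at h
  rw [← h]
  refine Finset.sum_congr rfl fun e _ => ?_
  by_cases ha : anchor φ B a ∈ e.1
  · by_cases hB : IsDisc e.1 ↔ B = true
    · have : decide (IsDisc e.1) = B := by
        rcases B with _ | _ <;> simpa using hB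
      rw [coeff, if_pos ⟨hB, ha⟩, if_pos ha, gap, this, one_mul]
    · rw [coeff, if_neg (fun h => hB h.1), if_pos ha, zero_mul]
      -- Edges of the wrong kind contribute nothing. For heights, a disc edge and its parent both
      -- have a boundary point as first mark, at height `0`. For horizontal positions, an edge
      -- containing the anchor is always a disc edge.
      rcases B with _ | _
      · have hd : IsDisc e.1 := by simpa using hB
        obtain ⟨i, hi⟩ := hd.exists_minMark
        obtain ⟨j, hj⟩ := (hd.mono (τ.ssubset_parent e).1).exists_minMark
        rw [hi, hj]
        simp [pos]
      · exact absurd ⟨fun _ => rfl, fun _ => ⟨_, ha⟩⟩ hB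
  · rw [coeff, if_neg (fun h => ha h.2), if_neg ha, zero_mul]

theorem represents_of_gap {u : (Fin n → ℝ) × (Fin l → ℝ)} {c : τ.Edge' → ℝ} {s : τ.Level → ℝ}
    (h : ∀ e, τ.gap u e = c e * s (τ.vertexLevel (τ.parent e))) : τ.Represents u c s := by
  intro B a b
  have ha := sum_coeff_gap (τ := τ) u B a
  have hb := sum_coeff_gap (τ := τ) u B b
  have : pos φ u B a - pos φ u B b = ∑ e, τ.coeff B a e * τ.gap u e -
      ∑ e, τ.coeff B b e * τ.gap u e := by rw [ha, hb]; ring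
  rw [this, ← Finset.sum_sub_distrib]
  exact Finset.sum_congr rfl fun e _ => by rw [h]; ring

/-- Compare the paths to the first marks of `e` and of its parent. Apart from `e`, an edge on only
one of them shares its first mark with its own parent, so its coordinate is `0` and only the term of
`e` survives. -/
theorem gap_of_represents {u : (Fin n → ℝ) × (Fin l → ℝ)} {c : τ.Edge' → ℝ} {s : τ.Level → ℝ}
    (h : τ.Represents u c s) (hc : ∀ e, minMark e.1 = minMark (τ.parent e).1 → c e = 0)
    (e : τ.Edge') : τ.gap u e = c e * s (τ.vertexLevel (τ.parent e)) := by
  by_cases hb : minMark e.1 = minMark (τ.parent e).1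
  · rw [hc e hb, gap, hb, sub_self, zero_mul]
  rw [gap, h]
  have hae := τ.minMark_mem_edge e
  have hbp := τ.minMark_mem_vertex (τ.parent e)
  have hbe : minMark (τ.parent e).1 ∉ e.1 := fun h' =>
    hb (minMark_eq_of_subset (τ.ssubset_parent e).1 h')
  set B := decide (IsDisc e.1) with hB
  have hBe : IsDisc e.1 ↔ B = true := by simp [hB]
  have hA : anchor φ B (minMark e.1) = minMark e.1 := by
    by_cases hd : IsDisc e.1
    · obtain ⟨i, hi⟩ := hd.exists_minMark
      rw [hi]
      simp [anchor, markColor]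
    · simp [anchor, hB, hd]
  have hA' : anchor φ B (minMark (τ.parent e).1) = minMark (τ.parent e).1 := by
    by_cases hd : IsDisc e.1
    · obtain ⟨i, hi⟩ := (hd.mono (τ.ssubset_parent e).1).exists_minMark
      rw [hi]
      simp [anchor, markColor]
    · simp [anchor, hB, hd]
  rw [Finset.sum_eq_single e]
  · simp only [coeff, hA, hA', hBe, hae, hbe]
    simp
  · intro e' _ hne
    simp only [coeff, hA, hA']
    have hne' : e'.1 ≠ e.1 := fun h => hne (Subtype.ext h)
    by_cases h1 : minMark e.1 ∈ e'.1 <;> by_cases h2 : minMark (τ.parent e).1 ∈ e'.1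
    · simp [h1, h2]
    · have hs : e'.1 ⊂ e.1 := by
        rcases τ.le_or_le e'.2.1 e.2.1 h1 hae with hs | hs
        · exact Finset.ssubset_iff_subset_ne.2 ⟨hs, hne'⟩
        · exact absurd (τ.parent_subset e e'.2.1
            (Finset.ssubset_iff_subset_ne.2 ⟨hs, hne'.symm⟩) hbp) h2
      rw [hc e' (τ.minMark_parent_eq e.2.1 hs h1 rfl)]
      ring
    · have hs : e'.1 ⊂ (τ.parent e).1 := by
        rcases τ.le_or_le e'.2.1 (τ.parent e).2.1 h2 hbp with hs | hs
        · exact Finset.ssubset_iff_subset_ne.2 ⟨hs, fun h' =>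
            h1 (h' ▸ (τ.ssubset_parent e).1 hae)⟩
        · exact absurd (hs ((τ.ssubset_parent e).1 hae)) h1
      rw [hc e' (τ.minMark_parent_eq (τ.parent e).2.1 hs h2 rfl)]
      ring
    · simp [h1, h2]
  · simp

end Gap

end PopsicleType

namespace PopsicleType

variable {n l : ℕ} {φ : Fin l → Fin n} (τ : PopsicleType φ)

/-! ## Coordinates of stable popsicles, as functions of the edges -/

theorem ne_univ_of_not_isDisc [NeZero n] {e : Finset (Mark n l)} (h : ¬ IsDisc e) :
    e ≠ Finset.univ := fun h' => h (h' ▸ isDisc_univ)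

variable {τ} in
theorem mem_out_parent (e : τ.Edge') : e.1 ∈ τ.out (τ.parent e).1 :=
  (τ.mem_out_iff (τ.parent e).2.1 e).2 rfl

variable {τ} in
theorem parent_eq_iff {e : τ.Edge'} {v : τ.Vertex} : τ.parent e = v ↔ e.1 ∈ τ.out v.1 := by
  rw [τ.mem_out_iff v.2.1]
  exact Subtype.ext_iff

variable {τ} in
-- All colors of `e` lie on one line by `flavored`, so a single color identifies the line.
theorem onLine_of_disc {e d : τ.Edge'} (he : ¬ IsDisc e.1) (hv : IsDisc (τ.parent e).1)
    (hp : τ.parent d = τ.parent e) {f : Fin l} (hf : .inr f ∈ e.1) (hd : .inl (φ f) ∈ d.1) :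
    τ.OnLine φ (τ.parent e).1 e.1 d.1 := by
  obtain ⟨d', hd'⟩ := τ.flavored ⟨(τ.parent e).1, (τ.parent e).2.1, (τ.parent e).2.2, hv⟩ e.1
    (mem_out_parent e) he
  rwa [τ.child_unique (parent_eq_iff.1 hp) hd'.1 hd (OnLine.mem τ hd' hf)]

section CoordEquiv

variable [NeZero n]

open Classical in
/-- Coordinates as a function on the edges below the root. -/
noncomputable def coordEquiv : τ.Coord ≃L[ℝ] (τ.Edge' → ℝ) :=
  LinearEquiv.toContinuousLinearEquiv
  { toFun := fun c e => if h : IsDisc e.1 then c.1 ⟨e.1, e.2.1, e.2.2, h⟩ else c.2 ⟨e.1, e.2.1, h⟩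
    map_add' := fun c c' => by ext e; by_cases h : IsDisc e.1 <;> simp [h]
    map_smul' := fun s c => by ext e; by_cases h : IsDisc e.1 <;> simp [h]
    invFun := fun c => (fun d => c ⟨d.1, d.2.1, d.2.2.1⟩,
      fun e => c ⟨e.1, e.2.1, ne_univ_of_not_isDisc e.2.2⟩)
    left_inv := fun c => by
      refine Prod.ext (funext fun d => ?_) (funext fun e => ?_)
      · simp [d.2.2.2]
      · simp only [dif_neg e.2.2]
    right_inv := fun c => by ext e; by_cases h : IsDisc e.1 <;> simp [h] }

variable {τ}

theorem coordEquiv_disc (c : τ.Coord) (d : τ.BoundaryPoint) :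
    τ.coordEquiv c ⟨d.1, d.2.1, d.2.2.1⟩ = c.1 d := dif_pos d.2.2.2

theorem coordEquiv_interior (c : τ.Coord) (e : τ.InteriorPoint) (h : e.1 ≠ Finset.univ) :
    τ.coordEquiv c ⟨e.1, e.2.1, h⟩ = c.2 e := dif_neg e.2.2

theorem coordEquiv_symm_fst (c : τ.Edge' → ℝ) (d : τ.BoundaryPoint) :
    (τ.coordEquiv.symm c).1 d = c ⟨d.1, d.2.1, d.2.2.1⟩ := rfl

theorem coordEquiv_symm_snd (c : τ.Edge' → ℝ) (e : τ.InteriorPoint) :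
    (τ.coordEquiv.symm c).2 e = c ⟨e.1, e.2.1, ne_univ_of_not_isDisc e.2.2⟩ := rfl

variable (τ)

/-- The open set of coordinates, as functions on the edges. -/
def edgeConf : Set (τ.Edge' → ℝ) := τ.coordEquiv.symm ⁻¹' τ.confSet

theorem isOpen_edgeConf : IsOpen τ.edgeConf := τ.isOpen_confSet.preimage τ.coordEquiv.symm.continuous

variable {τ}

theorem coordEquiv_mem {c : τ.Coord} (hc : c ∈ τ.confSet) : τ.coordEquiv c ∈ τ.edgeConf := by
  simpa [edgeConf] using hc

/-- The sets of boundary points of `d` and `d'` are disjoint intervals by planarity, so one ordered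
pair orders them completely, which is what `confSet` asks for. -/
theorem coord_lt {c : τ.Edge' → ℝ} (hc : c ∈ τ.edgeConf) {d d' : τ.Edge'}
    (hp : τ.parent d = τ.parent d') (hne : d ≠ d') {i j : Fin n} (hi : .inl i ∈ d.1)
    (hj : .inl j ∈ d'.1) (hij : i < j) : c d < c d' := by
  have hd : IsDisc d.1 := ⟨i, hi⟩
  have hd' : IsDisc d'.1 := ⟨j, hj⟩
  have hv : IsDisc (τ.parent d).1 := hd.mono (τ.ssubset_parent d).1
  refine hc.1 ⟨(τ.parent d).1, (τ.parent d).2.1, (τ.parent d).2.2, hv⟩ ⟨d.1, d.2.1, d.2.2, hd⟩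
    ⟨d'.1, d'.2.1, d'.2.2, hd'⟩ (mem_out_parent d) (parent_eq_iff.1 hp.symm) ?_
  have hdisj : ∀ k, .inl k ∈ d.1 → .inl k ∉ d'.1 := fun k hk hk' =>
    hne (Subtype.ext (τ.child_unique (mem_out_parent d) (parent_eq_iff.1 hp.symm) hk hk'))
  intro i' j' hi' hj'
  by_contra hlt
  have h1 := τ.planar d.1 d.2.1
  have h2 := τ.planar d'.1 d'.2.1
  rcases lt_or_ge i j' with h | h
  · exact hdisj j' (h1.out hi hi' ⟨h.le, not_lt.1 hlt⟩) hj'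
  · exact hdisj i hi (h2.out hj' hj ⟨h, hij.le⟩)

theorem coord_ne_of_isDisc {c : τ.Edge' → ℝ} (hc : c ∈ τ.edgeConf) {d d' : τ.Edge'}
    (hp : τ.parent d = τ.parent d') (hd : IsDisc d.1) (hd' : IsDisc d'.1) (hne : d ≠ d') :
    c d ≠ c d' := by
  obtain ⟨i, hi⟩ := hd
  obtain ⟨j, hj⟩ := hd'
  rcases lt_trichotomy i j with h | rfl | h
  · exact (coord_lt hc hp hne hi hj h).ne
  · exact absurd (Subtype.ext (τ.child_unique (mem_out_parent d) (parent_eq_iff.1 hp.symm) hi hj))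
      hne
  · exact (coord_lt hc hp.symm hne.symm hj hi h).ne'

theorem coord_pos {c : τ.Edge' → ℝ} (hc : c ∈ τ.edgeConf) {e : τ.Edge'} (he : ¬ IsDisc e.1)
    (hv : IsDisc (τ.parent e).1) : 0 < c e :=
  hc.2.1 ⟨(τ.parent e).1, (τ.parent e).2.1, (τ.parent e).2.2, hv⟩ ⟨e.1, e.2.1, he⟩
    (mem_out_parent e)

theorem coord_ne_of_disc {c : τ.Edge' → ℝ} (hc : c ∈ τ.edgeConf) {e e' d : τ.Edge'}
    (he : ¬ IsDisc e.1) (he' : ¬ IsDisc e'.1) (hp : τ.parent e = τ.parent e') (hne : e ≠ e')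
    (hv : IsDisc (τ.parent e).1) (hd : τ.parent d = τ.parent e) {f g : Fin l}
    (hf : .inr f ∈ e.1) (hg : .inr g ∈ e'.1) (hfd : .inl (φ f) ∈ d.1) (hgd : .inl (φ g) ∈ d.1) :
    c e ≠ c e' := by
  refine hc.2.2.1 ⟨(τ.parent e).1, (τ.parent e).2.1, (τ.parent e).2.2, hv⟩ ⟨e.1, e.2.1, he⟩
    ⟨e'.1, e'.2.1, he'⟩ (mem_out_parent e) (parent_eq_iff.1 hp.symm)
    (fun h => hne (Subtype.ext (congrArg (fun x : τ.InteriorPoint => x.1) h))) ⟨d.1, onLine_of_disc he hv hd hf hfd, ?_⟩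
  have := onLine_of_disc he' (hp ▸ hv) (hp ▸ hd) hg hgd
  rwa [← hp] at this

/-- The assumption `h` expresses the same layer through single colors on a common line. It is void
for a sphere aligned with an edge, which has only one line. -/
theorem coord_ne_of_sphere {c : τ.Edge' → ℝ} (hc : c ∈ τ.edgeConf) {e e' : τ.Edge'}
    (hp : τ.parent e = τ.parent e') (hne : e ≠ e') (hw : ¬ IsDisc (τ.parent e).1)
    (h : ∀ v, τ.Φ ⟨(τ.parent e).1, (τ.parent e).2.1, (τ.parent e).2.2, hw⟩ = .inl v →
      ∃ f g d, .inr f ∈ e.1 ∧ .inr g ∈ e'.1 ∧ d ∈ τ.out v.1 ∧ .inl (φ f) ∈ d ∧ .inl (φ g) ∈ d) :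
    c e ≠ c e' := by
  have he : ¬ IsDisc e.1 := fun h => hw (h.mono (τ.ssubset_parent e).1)
  have he' : ¬ IsDisc e'.1 := fun h => hw (hp ▸ h.mono (τ.ssubset_parent e').1)
  refine hc.2.2.2 ⟨(τ.parent e).1, (τ.parent e).2.1, (τ.parent e).2.2, hw⟩ ⟨e.1, e.2.1, he⟩
    ⟨e'.1, e'.2.1, he'⟩ (mem_out_parent e) (parent_eq_iff.1 hp.symm)
    (fun h => hne (Subtype.ext (congrArg (fun x : τ.InteriorPoint => x.1) h))) ?_
  have hal := τ.alignable ⟨(τ.parent e).1, (τ.parent e).2.1, (τ.parent e).2.2, hw⟩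
  unfold SameLayer
  split
  · next v hΦ =>
    rw [hΦ] at hal
    obtain ⟨f, g, d, hf, hg, hd, hfd, hgd⟩ := h v hΦ
    obtain ⟨d₁, hd₁⟩ := hal _ (mem_out_parent e)
    obtain ⟨d₂, hd₂⟩ := hal e'.1 (parent_eq_iff.1 hp.symm)
    have h1 := τ.child_unique hd hd₁.1 hfd (OnLine.mem τ hd₁ hf)
    have h2 := τ.child_unique hd hd₂.1 hgd (OnLine.mem τ hd₂ hg)
    exact ⟨d, h1 ▸ hd₁, h2 ▸ hd₂⟩
  · trivial

end CoordEquiv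

/-! ## Differences of positions, divided by scales -/

section Quot

/-- The difference of the positions of two marks, divided by the scale of a level. -/
noncomputable def quot (a : τ.Level) (c : τ.Edge' → ℝ) (r : τ.Level → ℝ) (B : Bool)
    (p q : Mark n l) : ℝ :=
  ∑ e, (τ.coeff B p e - τ.coeff B q e) * c e * τ.scaleQuot r a (τ.vertexLevel (τ.parent e))

/-- The difference of the positions of two marks is divisible by the scale of a level. -/
def Divisible (a : τ.Level) (B : Bool) (p q : Mark n l) : Prop :=
  ∀ e, τ.coeff B p e ≠ τ.coeff B q e → τ.LevelLe a (τ.vertexLevel (τ.parent e))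

variable {τ}

theorem Divisible.mono {a b : τ.Level} {B : Bool} {p q : Mark n l} (h : τ.Divisible b B p q)
    (hab : τ.LevelLe a b) : τ.Divisible a B p q := fun e he => hab.trans (h e he)

theorem Divisible.sub {a : τ.Level} {B : Bool} {p q o : Mark n l} (h : τ.Divisible a B p o)
    (h' : τ.Divisible a B q o) : τ.Divisible a B p q := fun e he => by
  by_cases hp : τ.coeff B p e = τ.coeff B o e
  · exact h' e fun hq => he (hp.trans hq.symm)
  · exact h e hp

theorem Represents.pos_sub {u : (Fin n → ℝ) × (Fin l → ℝ)} {c : τ.Edge' → ℝ} {r : τ.Level → ℝ}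
    {S : ℝ} (h : τ.Represents u c fun a => S * τ.scale r a) {a : τ.Level} {B : Bool}
    {p q : Mark n l} (hd : τ.Divisible a B p q) :
    pos φ u B p - pos φ u B q = S * τ.scale r a * τ.quot a c r B p q := by
  rw [h, quot, Finset.mul_sum]
  refine Finset.sum_congr rfl fun e _ => ?_
  by_cases he : τ.coeff B p e = τ.coeff B q e
  · rw [he]; ring
  · beta_reduce
    rw [← scale_mul_scaleQuot r (hd e he)]; ring

theorem ssubset_of_coeff_ne {v : τ.Vertex} {B : Bool} {p q : Mark n l} (hp : anchor φ B p ∈ v.1)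
    (hq : anchor φ B q ∈ v.1) {e : τ.Edge'} (h : τ.coeff B p e ≠ τ.coeff B q e) : e.1 ⊂ v.1 := by
  unfold coeff at h
  by_cases h1 : anchor φ B p ∈ e.1 <;> by_cases h2 : anchor φ B q ∈ e.1
  · simp [h1, h2] at h
  · rcases τ.le_or_le e.2.1 v.2.1 h1 hp with hs | hs
    · exact ⟨hs, fun h' => h2 (h' hq)⟩
    · exact absurd (hs hq) h2
  · rcases τ.le_or_le e.2.1 v.2.1 h2 hq with hs | hs
    · exact ⟨hs, fun h' => h1 (h' hp)⟩
    · exact absurd (hs hp) h1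
  · simp [h1, h2] at h

/-- Both paths pass through `v`, so the edges before `v` cancel, and the scales of the components
from `v` on are multiples of the scale of `v`. -/
theorem divisible_of_mem {v : τ.Vertex} {B : Bool} {p q : Mark n l} (hp : anchor φ B p ∈ v.1)
    (hq : anchor φ B q ∈ v.1) {a : τ.Level} (ha : τ.LevelLe a (τ.vertexLevel v)) :
    τ.Divisible a B p q := fun e he =>
  ha.trans (vertexLevel_le (τ.parent_subset e v.2.1 (ssubset_of_coeff_ne hp hq he)))

/-- The horizontal or vertical coordinate of an edge. -/
noncomputable def lineCoord (B : Bool) (c : τ.Edge' → ℝ) (e : τ.Edge') : ℝ :=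
  if IsDisc e.1 ↔ B = true then c e else 0

theorem child_disc {v : τ.Vertex} {i : Fin n} (h : .inl i ∈ v.1) :
    IsDisc (τ.child v ⟨_, h⟩).1 := ⟨i, τ.mem_child v ⟨_, h⟩⟩

/-- Horizontal differences within a level are divisible by its scale. -/
theorem divisible_of_mem_levelSet {a : τ.Level} {p q : Mark n l}
    (hp : .inl (markColor φ p) ∈ τ.levelSet a) (hq : .inl (markColor φ q) ∈ τ.levelSet a) :
    τ.Divisible a true p q := by
  rcases a with v | ⟨e, k⟩
  · exact divisible_of_mem (v := ⟨v.1, v.2.1, v.2.2.1⟩) (B := true) hp hq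
      (.inl (τ.vertexLevel_disc v).symm)
  · by_cases hpq : markColor φ p = markColor φ q
    · intro e he
      simp [coeff, anchor, hpq] at he
    · have hc : 2 ≤ e.1.card := Finset.one_lt_card.2 ⟨_, hp, _, hq, by simpa using hpq⟩
      refine divisible_of_mem (v := ⟨e.1, e.2.1, hc⟩) (B := true) hp hq (.inr ?_)
      rw [τ.vertexLevel_disc ⟨e.1, e.2.1, hc, e.2.2⟩]
      exact .inl (subset_rfl : e.1 ⊆ e.1)

theorem lineCoord_pos {B : Bool} {e : τ.Edge'} (h : IsDisc e.1 ↔ B = true) (c : τ.Edge' → ℝ) :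
    lineCoord B c e = c e := if_pos h

theorem lineCoord_neg {B : Bool} {e : τ.Edge'} (h : ¬ (IsDisc e.1 ↔ B = true)) (c : τ.Edge' → ℝ) :
    lineCoord B c e = 0 := if_neg h

variable [NeZero n] [Fact (2 ≤ n + l)]

/-- In the limit only the edges leaving `v` count: an edge farther out carries a quotient of scales
with a vanishing ratio as a factor. `lineCoord` takes care of an outgoing edge of the other kind,
whose coefficient is `0`. -/
theorem quot_eq {v : τ.Vertex} {B : Bool} {p q : Mark n l} (hp : anchor φ B p ∈ v.1)
    (hq : anchor φ B q ∈ v.1) (c : τ.Edge' → ℝ) {r : τ.Level → ℝ}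
    (hr : ∀ a ≠ τ.rootLevel, r a = 0) :
    τ.quot (τ.vertexLevel v) c r B p q =
      lineCoord B c (τ.child v ⟨_, hp⟩) - lineCoord B c (τ.child v ⟨_, hq⟩) := by
  classical
  have key : ∀ p (hp : anchor φ B p ∈ v.1), ∑ e, τ.coeff B p e * c e *
      (if τ.parent e = v then 1 else 0) = lineCoord B c (τ.child v ⟨_, hp⟩) := by
    intro p hp
    rw [Finset.sum_eq_single (τ.child v ⟨_, hp⟩)]
    · rw [if_pos (τ.parent_child _ _), coeff, lineCoord]
      have := τ.mem_child v ⟨_, hp⟩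
      by_cases hB : IsDisc (τ.child v ⟨_, hp⟩).1 ↔ B = true
      · rw [if_pos ⟨hB, this⟩, if_pos hB]; ring
      · rw [if_neg (fun h => hB h.1), if_neg hB]; ring
    · intro e _ hne
      by_cases hpe : τ.parent e = v
      · rw [coeff, if_neg]
        · ring
        · exact fun h => hne (τ.eq_child hpe h.2)
      · rw [if_neg hpe, mul_zero]
    · simp
  rw [← key p hp, ← key q hq, ← Finset.sum_sub_distrib, quot]
  refine Finset.sum_congr rfl fun e _ => ?_
  by_cases he : τ.coeff B p e = τ.coeff B q e
  · rw [he]; ring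
  · have hs := τ.parent_subset e v.2.1 (ssubset_of_coeff_ne hp hq he)
    by_cases hpe : τ.parent e = v
    · rw [if_pos hpe, hpe, scaleQuot_self]; ring
    · have hlt : τ.LevelLt (τ.vertexLevel v) (τ.vertexLevel (τ.parent e)) := vertexLevel_lt
        (Finset.ssubset_iff_subset_ne.2 ⟨hs, fun h => hpe (Subtype.ext h)⟩)
      rw [if_neg hpe, scaleQuot_eq_zero hlt (hr _ (ne_rootLevel_of_lt hlt))]; ring

theorem quot_disc {v : τ.Vertex} {p q : Mark n l} (hp : .inl (markColor φ p) ∈ v.1)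
    (hq : .inl (markColor φ q) ∈ v.1) (c : τ.Edge' → ℝ) {r : τ.Level → ℝ}
    (hr : ∀ a ≠ τ.rootLevel, r a = 0) :
    τ.quot (τ.vertexLevel v) c r true p q =
      c (τ.child v ⟨_, hp⟩) - c (τ.child v ⟨_, hq⟩) := by
  exact (quot_eq (B := true) hp hq c hr).trans (congrArg₂ (· - ·)
    (lineCoord_pos (iff_of_true (child_disc hp) rfl) c)
    (lineCoord_pos (iff_of_true (child_disc hq) rfl) c))

/-- At a vertex, two marks that belong to different outgoing edges are apart at its scale. -/
theorem quot_ne_zero {c : τ.Edge' → ℝ} (hc : c ∈ τ.edgeConf) {r : τ.Level → ℝ}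
    (hr : ∀ a ≠ τ.rootLevel, r a = 0) {w : τ.Vertex} {p q : Mark n l} (hp : p ∈ w.1)
    (hq : q ∈ w.1) (hpq : τ.child w ⟨p, hp⟩ ≠ τ.child w ⟨q, hq⟩) {i : Fin n}
    (hi : .inl i ∈ τ.levelSet (τ.vertexLevel w))
    (h1 : τ.quot (τ.vertexLevel w) c r true p (.inl i) = 0)
    (h2 : τ.quot (τ.vertexLevel w) c r true q (.inl i) = 0) :
    τ.quot (τ.vertexLevel w) c r false p q ≠ 0 := by
  have hp' := τ.color_mem_levelSet w hp
  have hq' := τ.color_mem_levelSet w hq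
  have hep := τ.mem_child w ⟨p, hp⟩
  have heq := τ.mem_child w ⟨q, hq⟩
  have hpp := τ.parent_child w ⟨p, hp⟩
  have hpq' := τ.parent_child w ⟨q, hq⟩
  rw [quot_eq (B := false) hp hq c hr, sub_ne_zero]
  change lineCoord false c (τ.child w ⟨p, hp⟩) ≠ lineCoord false c (τ.child w ⟨q, hq⟩)
  generalize τ.child w ⟨p, hp⟩ = ep at *
  generalize τ.child w ⟨q, hq⟩ = eq at *
  -- on a disc vertex `v` at the level, the colors of `p` and `q` are on the same line
  have line : ∀ v : τ.Vertex, IsDisc v.1 → τ.vertexLevel w = τ.vertexLevel v →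
      ∃ d : τ.Edge', τ.parent d = v ∧ IsDisc d.1 ∧ .inl (markColor φ p) ∈ d.1 ∧
        .inl (markColor φ q) ∈ d.1 := by
    intro v hv hwv
    rw [hwv] at h1 h2 hp' hq' hi
    rw [vertexLevel, dif_pos hv] at hp' hq' hi
    rw [quot_disc (q := .inl i) hp' hi c hr, sub_eq_zero] at h1
    rw [quot_disc (q := .inl i) hq' hi c hr, sub_eq_zero] at h2
    have hcc : τ.child v ⟨_, hp'⟩ = τ.child v ⟨_, hq'⟩ := by
      by_contra hne
      exact coord_ne_of_isDisc hc (by rw [τ.parent_child, τ.parent_child]) (child_disc hp')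
        (child_disc hq') hne (h1.trans h2.symm)
    refine ⟨τ.child v ⟨_, hp'⟩, τ.parent_child _ _, child_disc hp', τ.mem_child v ⟨_, hp'⟩, ?_⟩
    rw [hcc]
    exact τ.mem_child v ⟨_, hq'⟩
  -- On a disc, at most one of the two edges is the boundary point `d` of the common line. A
  -- boundary point has height `0` and an interior point positive height, and two interior points on
  -- a line have different heights. On a sphere both are interior points of the same layer.
  by_cases hw : IsDisc w.1
  · obtain ⟨d, hd, hdd, hpd, hqd⟩ := line w hw rfl
    have same : ∀ (e : τ.Edge') (x : Mark n l), τ.parent e = w → IsDisc e.1 → x ∈ e.1 →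
        .inl (markColor φ x) ∈ d.1 → e = d := by
      intro e x hew he hx hxd
      refine Subtype.ext (τ.child_unique (parent_eq_iff.1 hew) (parent_eq_iff.1 hd) ?_ hxd)
      rcases x with j | f
      · exact hx
      · exact τ.color_mem_of_isDisc e.2.1 he hx
    by_cases hdp : IsDisc ep.1 <;> by_cases hdq : IsDisc eq.1
    · exact absurd ((same ep p hpp hdp hep hpd).trans (same eq q hpq' hdq heq hqd).symm) hpq
    · rw [lineCoord_neg (by simp [hdp]), lineCoord_pos (by simp [hdq])]
      exact (coord_pos hc hdq (hpq' ▸ hw)).ne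
    · rw [lineCoord_pos (by simp [hdp]), lineCoord_neg (by simp [hdq])]
      exact (coord_pos hc hdp (hpp ▸ hw)).ne'
    · rw [lineCoord_pos (by simp [hdp]), lineCoord_pos (by simp [hdq])]
      rcases p with j | f
      · exact absurd ⟨j, hep⟩ hdp
      rcases q with j | g
      · exact absurd ⟨j, heq⟩ hdq
      exact coord_ne_of_disc hc hdp hdq (hpp.trans hpq'.symm) hpq (hpp ▸ hw)
        (hd.trans hpp.symm) hep heq hpd hqd
  · have hdp : ¬ IsDisc ep.1 := fun h => hw (hpp ▸ h.mono (τ.ssubset_parent ep).1)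
    have hdq : ¬ IsDisc eq.1 := fun h => hw (hpq' ▸ h.mono (τ.ssubset_parent eq).1)
    rw [lineCoord_pos (by simp [hdp]), lineCoord_pos (by simp [hdq])]
    rcases p with j | f
    · exact absurd ⟨j, hep⟩ hdp
    rcases q with j | g
    · exact absurd ⟨j, heq⟩ hdq
    refine coord_ne_of_sphere hc (hpp.trans hpq'.symm) hpq (hpp ▸ hw) fun v hv => ?_
    subst hpp
    obtain ⟨d, hd, -, hfd, hgd⟩ := line ⟨v.1, v.2.1, v.2.2.1⟩ v.2.2.2 (by
      rw [τ.vertexLevel_disc, vertexLevel, dif_neg hw, τ.level_eq_inl hv])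
    exact ⟨f, g, d.1, hep, heq, parent_eq_iff.1 hd, hfd, hgd⟩

end Quot

end PopsicleType

/-! ## Bounded functions of the marked points -/

namespace PopsicleType

/-- The indices of the functions `ratioFun`. -/
abbrev RatioIndex (n l : ℕ) := Bool × {q : Mark n l × Mark n l // q.1 ≠ q.2} ×
  {q : Mark n l × Mark n l // q.1 ≠ q.2} × Fin n

/-- The square of the scale at which the path to the boundary point `i` and the paths to the two
marks `q` are all separated. -/
noncomputable def radicand {n l : ℕ} (φ : Fin l → Fin n) (u : (Fin n → ℝ) × (Fin l → ℝ))
    (i : Fin n) (q : Mark n l × Mark n l) : ℝ :=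
  (pos φ u true q.1 - pos φ u true (.inl i)) ^ 2 + (pos φ u true q.2 - pos φ u true (.inl i)) ^ 2 +
    (pos φ u false q.1 - pos φ u false q.2) ^ 2

/-- Differences of positions, divided by scales. -/
noncomputable def ratioFun {n l : ℕ} (φ : Fin l → Fin n) (u : (Fin n → ℝ) × (Fin l → ℝ))
    (x : RatioIndex n l) : ℝ :=
  (pos φ u x.1 x.2.1.1.1 - pos φ u x.1 x.2.1.1.2) /
    √(radicand φ u x.2.2.2 x.2.1.1 + radicand φ u x.2.2.2 x.2.2.1.1)

theorem radicand_nonneg {n l : ℕ} (φ : Fin l → Fin n) (u : (Fin n → ℝ) × (Fin l → ℝ))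
    (i : Fin n) (q : Mark n l × Mark n l) : 0 ≤ radicand φ u i q := by
  unfold radicand; positivity

/-- The first radicand alone controls the numerator: a vertical difference occurs in it, and for a
horizontal one `(x - y)² ≤ 2 ((x - z)² + (y - z)²)`. The bound gives compactness and is not meant to
be sharp. -/
theorem abs_ratioFun_le {n l : ℕ} (φ : Fin l → Fin n) (u : (Fin n → ℝ) × (Fin l → ℝ))
    (x : RatioIndex n l) : |ratioFun φ u x| ≤ 2 := by
  obtain ⟨B, ⟨q, hq⟩, ⟨q', hq'⟩, i⟩ := x
  simp only [ratioFun]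
  rw [abs_div, abs_of_nonneg (Real.sqrt_nonneg _)]
  refine div_le_of_le_mul₀ (Real.sqrt_nonneg _) (by norm_num) ?_
  have h : ((pos φ u B q.1 - pos φ u B q.2) / 2) ^ 2 ≤ radicand φ u i q + radicand φ u i q' := by
    have := radicand_nonneg φ u i q'
    refine le_trans ?_ (le_add_of_nonneg_right this)
    unfold radicand
    rcases B with _ | _
    · nlinarith [sq_nonneg (pos φ u true q.1 - pos φ u true (.inl i)),
        sq_nonneg (pos φ u true q.2 - pos φ u true (.inl i)),
        sq_nonneg (pos φ u false q.1 - pos φ u false q.2)]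
    · nlinarith [sq_nonneg (pos φ u true q.1 - pos φ u true (.inl i) +
        (pos φ u true q.2 - pos φ u true (.inl i))),
        sq_nonneg (pos φ u false q.1 - pos φ u false q.2),
        sq_nonneg (pos φ u true q.1 - pos φ u true q.2)]
  have := Real.abs_le_sqrt h
  rw [abs_div, abs_two] at this
  linarith

variable {n l : ℕ} {φ : Fin l → Fin n} (τ : PopsicleType φ)

/-! ## Their extension to stable popsicles -/

/-- The level of the scale given by `radicand`. -/
noncomputable def pairLevel (i : Fin n) (q : {q : Mark n l × Mark n l // q.1 ≠ q.2}) : τ.Level :=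
  if h : .inl i ∈ τ.levelSet (τ.vertexLevel (τ.join q.2)) then τ.vertexLevel (τ.join q.2) else
    τ.vertexLevel (τ.join (a := .inl i) (b := .inl (markColor φ q.1.1)) (fun h' => h (h' ▸
      τ.color_mem_levelSet _ (τ.left_mem_join q.2))))

/-- This is `radicand` divided by the square of the scale of `a`, for `a` up to the pair level
(`Represents.radicand`). It is polynomial in `c` and `r`, so it makes sense at vanishing ratios. -/
noncomputable def quotRadicand (a : τ.Level) (c : τ.Edge' → ℝ) (r : τ.Level → ℝ)
    (i : Fin n) (q : Mark n l × Mark n l) : ℝ :=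
  τ.quot a c r true q.1 (.inl i) ^ 2 + τ.quot a c r true q.2 (.inl i) ^ 2 +
    τ.quot a c r false q.1 q.2 ^ 2

open Classical in
/-- The level of the denominator of `ratioFun`. -/
noncomputable def ratioLevel (x : RatioIndex n l) : τ.Level :=
  if τ.LevelLe (τ.pairLevel x.2.2.2 x.2.1) (τ.pairLevel x.2.2.2 x.2.2.1) then
    τ.pairLevel x.2.2.2 x.2.1 else τ.pairLevel x.2.2.2 x.2.2.1

/-- The extension of `ratioFun` to popsicles glued from `τ`, including those with ratios `0`. -/
noncomputable def ratioExt (c : τ.Edge' → ℝ) (r : τ.Level → ℝ) (x : RatioIndex n l) : ℝ :=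
  τ.quot (τ.ratioLevel x) c r x.1 x.2.1.1.1 x.2.1.1.2 /
    √(τ.quotRadicand (τ.ratioLevel x) c r x.2.2.2 x.2.1.1 +
      τ.quotRadicand (τ.ratioLevel x) c r x.2.2.2 x.2.2.1.1)

variable {τ}

theorem pairLevel_of_mem {i : Fin n} {q : {q : Mark n l × Mark n l // q.1 ≠ q.2}}
    (h : .inl i ∈ τ.levelSet (τ.vertexLevel (τ.join q.2))) :
    τ.pairLevel i q = τ.vertexLevel (τ.join q.2) := dif_pos h

/-- Away from the path to `i`, the level of a pair is a disc with `i` and the color of the pair. -/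
theorem exists_pairLevel {i : Fin n} {q : {q : Mark n l × Mark n l // q.1 ≠ q.2}}
    (h : .inl i ∉ τ.levelSet (τ.vertexLevel (τ.join q.2))) :
    ∃ h' : (.inl i : Mark n l) ≠ .inl (markColor φ q.1.1),
      τ.pairLevel i q = τ.vertexLevel (τ.join h') ∧
      τ.levelSet (τ.vertexLevel (τ.join q.2)) ⊂ (τ.join h').1 := by
  have hc := τ.color_mem_levelSet _ (τ.left_mem_join q.2)
  refine ⟨fun h' => h (h' ▸ hc), dif_neg h, ?_⟩
  have hi := τ.left_mem_join (a := .inl i) (b := .inl (markColor φ q.1.1)) fun h' => h (h' ▸ hc)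
  rcases τ.le_or_le (τ.levelSet_mem _) (τ.join _).2.1 hc (τ.right_mem_join
    (a := .inl i) (b := .inl (markColor φ q.1.1)) fun h' => h (h' ▸ hc)) with hs | hs
  · exact ⟨hs, fun h' => h (h' hi)⟩
  · exact absurd (hs hi) h

theorem vertexLevel_join_disc {i : Fin n} {b : Mark n l} (h : .inl i ≠ b) :
    τ.levelSet (τ.vertexLevel (τ.join h)) = (τ.join h).1 := by
  rw [vertexLevel, dif_pos ⟨i, τ.left_mem_join h⟩]
  rfl

theorem mem_pairLevel (i : Fin n) (q : {q : Mark n l × Mark n l // q.1 ≠ q.2}) :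
    .inl i ∈ τ.levelSet (τ.pairLevel i q) := by
  by_cases h : .inl i ∈ τ.levelSet (τ.vertexLevel (τ.join q.2))
  · rwa [pairLevel_of_mem h]
  · obtain ⟨h', h1, -⟩ := exists_pairLevel h
    rw [h1, vertexLevel_join_disc]
    exact τ.left_mem_join h'

theorem pairLevel_le (i : Fin n) (q : {q : Mark n l × Mark n l // q.1 ≠ q.2}) :
    τ.LevelLe (τ.pairLevel i q) (τ.vertexLevel (τ.join q.2)) := by
  by_cases h : .inl i ∈ τ.levelSet (τ.vertexLevel (τ.join q.2))
  · rw [pairLevel_of_mem h]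
    exact LevelLe.refl _
  · obtain ⟨h', h1, h2⟩ := exists_pairLevel h
    rw [h1]
    refine .inr (levelLt_iff _ |>.2 (.inl ?_))
    rwa [vertexLevel_join_disc]

/-- The pair level contains `i` and both colors, which handles the horizontal differences, and it
does not come after the level where the two marks separate, which handles the vertical one. -/
theorem divisible_pairLevel (i : Fin n) (q : {q : Mark n l × Mark n l // q.1 ≠ q.2}) :
    τ.Divisible (τ.pairLevel i q) true q.1.1 (.inl i) ∧
      τ.Divisible (τ.pairLevel i q) true q.1.2 (.inl i) ∧
      τ.Divisible (τ.pairLevel i q) false q.1.1 q.1.2 := by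
  have hl := (pairLevel_le i q).subset (τ.color_mem_levelSet _ (τ.left_mem_join q.2))
  have hr := (pairLevel_le i q).subset (τ.color_mem_levelSet _ (τ.right_mem_join q.2))
  exact ⟨divisible_of_mem_levelSet hl (mem_pairLevel i q),
    divisible_of_mem_levelSet hr (mem_pairLevel i q),
    divisible_of_mem (B := false) (τ.left_mem_join q.2) (τ.right_mem_join q.2) (pairLevel_le i q)⟩

/-- Both pair levels lie on the path to the boundary point `i`, hence they are comparable. This is
the reason for using one `i` in both radicands. -/
theorem ratioLevel_le (x : RatioIndex n l) :
    τ.LevelLe (τ.ratioLevel x) (τ.pairLevel x.2.2.2 x.2.1) ∧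
      τ.LevelLe (τ.ratioLevel x) (τ.pairLevel x.2.2.2 x.2.2.1) := by
  unfold ratioLevel
  split_ifs with h
  · exact ⟨LevelLe.refl _, h⟩
  · refine ⟨?_, LevelLe.refl _⟩
    rcases levelLt_trichotomy (mem_pairLevel x.2.2.2 x.2.1) (mem_pairLevel x.2.2.2 x.2.2.1)
      with h' | h' | h'
    · exact absurd (.inr h') h
    · exact absurd (.inl h') h
    · exact .inr h'

theorem divisible_ratioLevel (x : RatioIndex n l) :
    τ.Divisible (τ.ratioLevel x) x.1 x.2.1.1.1 x.2.1.1.2 := by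
  obtain ⟨h1, h2, h3⟩ := divisible_pairLevel (τ := τ) x.2.2.2 x.2.1
  refine Divisible.mono ?_ (ratioLevel_le x).1
  rcases x.1 with _ | _
  · exact h3
  · exact h1.sub h2

theorem quotRadicand_nonneg (a : τ.Level) (c : τ.Edge' → ℝ) (r : τ.Level → ℝ) (i : Fin n)
    (q : Mark n l × Mark n l) : 0 ≤ τ.quotRadicand a c r i q := by
  unfold quotRadicand; positivity

theorem Represents.radicand {u : (Fin n → ℝ) × (Fin l → ℝ)} {c : τ.Edge' → ℝ} {r : τ.Level → ℝ}
    {S : ℝ} (h : τ.Represents u c fun a => S * τ.scale r a) {a : τ.Level} (i : Fin n)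
    (q : {q : Mark n l × Mark n l // q.1 ≠ q.2}) (ha : τ.LevelLe a (τ.pairLevel i q)) :
    radicand φ u i q.1 = (S * τ.scale r a) ^ 2 * τ.quotRadicand a c r i q.1 := by
  obtain ⟨h1, h2, h3⟩ := divisible_pairLevel (τ := τ) i q
  rw [PopsicleType.radicand, quotRadicand, h.pos_sub (h1.mono ha), h.pos_sub (h2.mono ha),
    h.pos_sub (h3.mono ha)]
  ring

/-- Numerator and denominator are both divisible by the scale at `ratioLevel`. It cancels together
with the overall scale `S`, and the remaining expression no longer needs positive ratios. -/
theorem Represents.ratioFun {u : (Fin n → ℝ) × (Fin l → ℝ)} {c : τ.Edge' → ℝ} {r : τ.Level → ℝ}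
    {S : ℝ} (h : τ.Represents u c fun a => S * τ.scale r a) (hS : 0 < S) (hr : ∀ a, 0 < r a) :
    ratioFun φ u = τ.ratioExt c r := by
  funext x
  have hs : 0 < S * τ.scale r (τ.ratioLevel x) := mul_pos hS (scale_pos hr _)
  rw [PopsicleType.ratioFun, ratioExt, h.pos_sub (divisible_ratioLevel x),
    h.radicand _ x.2.1 (ratioLevel_le x).1, h.radicand _ x.2.2.1 (ratioLevel_le x).2, ← mul_add,
    Real.sqrt_mul (sq_nonneg _), Real.sqrt_sq hs.le, mul_div_mul_left _ _ hs.ne']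

theorem contDiff_quot (a : τ.Level) (B : Bool) (p q : Mark n l) :
    ContDiff ℝ ∞ fun z : (τ.Edge' → ℝ) × (τ.Level → ℝ) => τ.quot a z.1 z.2 B p q := by
  classical
  unfold quot scaleQuot
  refine ContDiff.sum fun e _ => ContDiff.mul (by fun_prop) (contDiff_prod fun b _ => by fun_prop)

theorem contDiff_quotRadicand (a : τ.Level) (i : Fin n) (q : Mark n l × Mark n l) :
    ContDiff ℝ ∞ fun z : (τ.Edge' → ℝ) × (τ.Level → ℝ) => τ.quotRadicand a z.1 z.2 i q := by
  unfold quotRadicand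
  exact (((contDiff_quot a _ _ _).pow 2).add ((contDiff_quot a _ _ _).pow 2)).add
    ((contDiff_quot a _ _ _).pow 2)

variable (τ) in
/-- The domain where the extension is smooth. -/
def smoothDomain : Set ((τ.Edge' → ℝ) × (τ.Level → ℝ)) :=
  {z | ∀ x, 0 < τ.quotRadicand (τ.ratioLevel x) z.1 z.2 x.2.2.2 x.2.1.1 +
      τ.quotRadicand (τ.ratioLevel x) z.1 z.2 x.2.2.2 x.2.2.1.1}

theorem isOpen_smoothDomain : IsOpen τ.smoothDomain := by
  simp only [smoothDomain, Set.ofPred_forall]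
  exact isOpen_iInter_of_finite fun x => isOpen_lt continuous_const
    ((contDiff_quotRadicand _ _ _).continuous.add (contDiff_quotRadicand _ _ _).continuous)

theorem contDiffOn_ratioExt :
    ContDiffOn ℝ ∞ (fun z : (τ.Edge' → ℝ) × (τ.Level → ℝ) => τ.ratioExt z.1 z.2)
      τ.smoothDomain := by
  rw [contDiffOn_pi]
  intro x
  refine (contDiff_quot _ _ _ _).contDiffOn.div (ContDiffOn.sqrt
    ((contDiff_quotRadicand _ _ _).add (contDiff_quotRadicand _ _ _)).contDiffOn
    fun z hz => (hz x).ne') fun z hz => (Real.sqrt_pos.2 (hz x)).ne'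

variable [NeZero n] [Fact (2 ≤ n + l)]

/-- If it vanished, both marks would lie over the line of `i`, at equal heights. When the pair level
is the level where the marks separate, this contradicts `quot_ne_zero`. Otherwise it is a disc on
which `i` and the color of the first mark are different boundary points. -/
theorem quotRadicand_pos {c : τ.Edge' → ℝ} (hc : c ∈ τ.edgeConf) {r : τ.Level → ℝ}
    (hr : ∀ a ≠ τ.rootLevel, r a = 0) (i : Fin n) (q : {q : Mark n l × Mark n l // q.1 ≠ q.2}) :
    0 < τ.quotRadicand (τ.pairLevel i q) c r i q.1 := by
  refine lt_of_le_of_ne (quotRadicand_nonneg _ _ _ _ _) fun h => ?_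
  unfold quotRadicand at h
  have hp := sq_nonneg (τ.quot (τ.pairLevel i q) c r true q.1.1 (.inl i))
  have hq := sq_nonneg (τ.quot (τ.pairLevel i q) c r true q.1.2 (.inl i))
  have hpq := sq_nonneg (τ.quot (τ.pairLevel i q) c r false q.1.1 q.1.2)
  have h1 : τ.quot (τ.pairLevel i q) c r true q.1.1 (.inl i) = 0 := by
    rw [← sq_eq_zero_iff]; linarith
  have h2 : τ.quot (τ.pairLevel i q) c r true q.1.2 (.inl i) = 0 := by
    rw [← sq_eq_zero_iff]; linarith
  have h3 : τ.quot (τ.pairLevel i q) c r false q.1.1 q.1.2 = 0 := by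
    rw [← sq_eq_zero_iff]; linarith
  by_cases hi : .inl i ∈ τ.levelSet (τ.vertexLevel (τ.join q.2))
  · rw [pairLevel_of_mem hi] at h1 h2 h3
    exact quot_ne_zero hc hr _ _ (τ.child_join_ne q.2) hi h1 h2 h3
  · obtain ⟨h', hl, hs⟩ := exists_pairLevel hi
    rw [hl, quot_disc (q := .inl i) (τ.right_mem_join h') (τ.left_mem_join h') c hr,
      sub_eq_zero] at h1
    refine coord_ne_of_isDisc hc ?_ ?_ ?_ (τ.child_join_ne h') h1.symm
    · rw [τ.parent_child, τ.parent_child]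
    · exact child_disc (τ.left_mem_join h')
    · exact child_disc (τ.right_mem_join h')

theorem mem_smoothDomain {c : τ.Edge' → ℝ} (hc : c ∈ τ.edgeConf) {r : τ.Level → ℝ}
    (hr : ∀ a ≠ τ.rootLevel, r a = 0) : (c, r) ∈ τ.smoothDomain := by
  intro x
  change 0 < τ.quotRadicand (τ.ratioLevel x) c r x.2.2.2 x.2.1.1 +
      τ.quotRadicand (τ.ratioLevel x) c r x.2.2.2 x.2.2.1.1
  unfold ratioLevel
  split_ifs
  · exact add_pos_of_pos_of_nonneg (quotRadicand_pos hc hr _ _) (quotRadicand_nonneg _ _ _ _ _)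
  · exact add_pos_of_nonneg_of_pos (quotRadicand_nonneg _ _ _ _ _) (quotRadicand_pos hc hr _ _)

end PopsicleType

namespace PopsicleType

variable {n l : ℕ} {φ : Fin l → Fin n} (τ : PopsicleType φ)

/-! ## Normalized coordinates -/

section Normal

variable [NeZero n]

open Classical in
/-- The coordinates after translations, such that the base point of each component is at `0`. -/
noncomputable def normal (c : τ.Edge' → ℝ) (e : τ.Edge') : ℝ :=
  if IsDisc (τ.parent e).1 ∧ ¬ IsDisc e.1 then c e else c e - c (τ.base (τ.parent e))

/-- The base point of each component is at `0`. -/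
def Normalized (c : τ.Edge' → ℝ) : Prop := ∀ e : τ.Edge',
  minMark e.1 = minMark (τ.parent e).1 → c e = 0

variable {τ}

theorem normal_interior (c : τ.Edge' → ℝ) {e : τ.Edge'} (h : IsDisc (τ.parent e).1)
    (he : ¬ IsDisc e.1) : τ.normal c e = c e := if_pos ⟨h, he⟩

theorem normal_disc (c : τ.Edge' → ℝ) {e : τ.Edge'} (he : IsDisc e.1) :
    τ.normal c e = c e - c (τ.base (τ.parent e)) := if_neg fun h => h.2 he

theorem normal_sphere (c : τ.Edge' → ℝ) {e : τ.Edge'} (h : ¬ IsDisc (τ.parent e).1) :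
    τ.normal c e = c e - c (τ.base (τ.parent e)) := if_neg fun h' => h h'.1

theorem isDisc_base {v : τ.Vertex} (hv : IsDisc v.1) : IsDisc (τ.base v).1 := by
  obtain ⟨i, hi⟩ := hv.exists_minMark
  rw [← τ.minMark_base] at hi
  exact isDisc_of_minMark (τ.nonempty_of_mem _ (τ.base v).2.1) hi

theorem normalized_normal (c : τ.Edge' → ℝ) : τ.Normalized (τ.normal c) := by
  intro e he
  have h := (τ.eq_base_iff e).2 he
  have : τ.normal c e = c e - c (τ.base (τ.parent e)) := if_neg fun h' => h'.2 (by
    rw [h]; exact isDisc_base h'.1)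
  rw [this, ← h, sub_self]

theorem normal_mem {c : τ.Edge' → ℝ} (hc : c ∈ τ.edgeConf) : τ.normal c ∈ τ.edgeConf := by
  refine ⟨fun v d d' hd hd' hlt => ?_, fun v e he => ?_, fun v e e' he he' hne hl => ?_,
    fun w e e' he he' hne hl => ?_⟩
  · have h := hc.1 v d d' hd hd' hlt
    rw [coordEquiv_symm_fst] at h ⊢
    rw [coordEquiv_symm_fst] at h ⊢
    rw [normal_disc _ d.2.2.2, normal_disc _ d'.2.2.2,
      parent_eq_iff (v := ⟨v.1, v.2.1, v.2.2.1⟩) |>.2 hd,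
      parent_eq_iff (v := ⟨v.1, v.2.1, v.2.2.1⟩) |>.2 hd']
    linarith
  · have h := hc.2.1 v e he
    rw [coordEquiv_symm_snd] at h ⊢
    rwa [normal_interior _ _ e.2.2]
    rw [parent_eq_iff (v := ⟨v.1, v.2.1, v.2.2.1⟩) |>.2 he]
    exact v.2.2.2
  · have h := hc.2.2.1 v e e' he he' hne hl
    have hp := parent_eq_iff (v := ⟨v.1, v.2.1, v.2.2.1⟩)
      (e := ⟨e.1, e.2.1, ne_univ_of_not_isDisc e.2.2⟩) |>.2 he
    have hp' := parent_eq_iff (v := ⟨v.1, v.2.1, v.2.2.1⟩)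
      (e := ⟨e'.1, e'.2.1, ne_univ_of_not_isDisc e'.2.2⟩) |>.2 he'
    simp only [coordEquiv_symm_snd] at h ⊢
    rwa [normal_interior _ (by rw [hp]; exact v.2.2.2) e.2.2,
      normal_interior _ (by rw [hp']; exact v.2.2.2) e'.2.2]
  · have h := hc.2.2.2 w e e' he he' hne hl
    have hp := parent_eq_iff (v := ⟨w.1, w.2.1, w.2.2.1⟩)
      (e := ⟨e.1, e.2.1, ne_univ_of_not_isDisc e.2.2⟩) |>.2 he
    have hp' := parent_eq_iff (v := ⟨w.1, w.2.1, w.2.2.1⟩)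
      (e := ⟨e'.1, e'.2.1, ne_univ_of_not_isDisc e'.2.2⟩) |>.2 he'
    simp only [coordEquiv_symm_snd] at h ⊢
    rw [normal_sphere _ (by rw [hp]; exact w.2.2.2), normal_sphere _ (by rw [hp']; exact w.2.2.2),
      hp, hp']
    exact fun h' => h (sub_left_injective h')

/-- The point of `Conf` with given coordinates on the edges. -/
noncomputable def toConf (c : τ.Edge' → ℝ) (hc : c ∈ τ.edgeConf) : τ.Conf :=
  ⟨τ.coordEquiv.symm c, hc⟩

theorem iso_normal (c : τ.Conf) :
    τ.Iso c (toConf (τ.normal (τ.coordEquiv c.1)) (normal_mem (coordEquiv_mem c.2))) := by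
  refine ⟨1, fun v => - τ.coordEquiv c.1 (τ.base ⟨v.1, v.2.1, v.2.2.1⟩),
    fun w => - τ.coordEquiv c.1 (τ.base ⟨w.1, w.2.1, w.2.2.1⟩), fun _ => one_pos,
    fun v d hd => ?_, fun v e he => ?_, fun w e he => ?_⟩
  · change τ.normal _ _ = _
    rw [normal_disc _ d.2.2.2, parent_eq_iff (v := ⟨v.1, v.2.1, v.2.2.1⟩) |>.2 hd,
      coordEquiv_disc, Pi.one_apply]
    ring
  · change τ.normal _ _ = _
    have hp := parent_eq_iff (v := ⟨v.1, v.2.1, v.2.2.1⟩)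
      (e := ⟨e.1, e.2.1, ne_univ_of_not_isDisc e.2.2⟩) |>.2 he
    rw [normal_interior _ (by rw [hp]; exact v.2.2.2) e.2.2,
      coordEquiv_interior _ _ (ne_univ_of_not_isDisc e.2.2), Pi.one_apply, one_mul]
  · have hp := parent_eq_iff (v := ⟨w.1, w.2.1, w.2.2.1⟩)
      (e := ⟨e.1, e.2.1, ne_univ_of_not_isDisc e.2.2⟩) |>.2 he
    change τ.normal _ _ = _
    rw [normal_sphere _ (by rw [hp]; exact w.2.2.2), hp,
      coordEquiv_interior _ _ (ne_univ_of_not_isDisc e.2.2), Pi.one_apply]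
    ring

end Normal

/-! ## Approximation by glued popsicles -/

/-- The constants of the isomorphism are absorbed by the scales and translations, so convergence
depends only on the isomorphism class. -/
theorem GromovConverges.iso {τ : PopsicleType φ} {u : ℕ → (Fin n → ℝ) × (Fin l → ℝ)}
    {c c' : τ.Conf} (h : τ.GromovConverges u c) (hi : τ.Iso c c') : τ.GromovConverges u c' := by
  obtain ⟨s, b, t, hs, hlt, h1, h2, h3⟩ := h
  obtain ⟨s₀, b₀, t₀, hs₀, i1, i2, i3⟩ := hi
  refine ⟨fun a k => s a k / s₀ a, fun v k => b v k - b₀ v * (s (.inl v) k / s₀ (.inl v)),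
    fun w k => t w k - t₀ w * (s (τ.level w) k / s₀ (τ.level w)),
    fun a k => div_pos (hs a k) (hs₀ a), fun a a' ha => ?_, fun v d hd i hi => ?_,
    fun v e he f hf => ?_, fun w e he f hf => ?_⟩
  · have := (hlt a a' ha).mul_const (s₀ a / s₀ a')
    rw [zero_mul] at this
    refine this.congr fun k => ?_
    have := (hs a k).ne'; have := (hs₀ a).ne'; have := (hs₀ a').ne'
    field_simp
  · rw [i1 v d hd]
    refine (((h1 v d hd i hi).const_mul (s₀ (.inl v))).add_const (b₀ v)).congr fun k => ?_
    have := (hs (.inl v) k).ne'; have := (hs₀ (.inl v)).ne'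
    field_simp; ring
  · rw [i2 v e he]
    refine ((h2 v e he f hf).const_mul (s₀ (.inl v))).congr fun k => ?_
    have := (hs (.inl v) k).ne'; have := (hs₀ (.inl v)).ne'
    field_simp
  · rw [i3 w e he]
    refine (((h3 w e he f hf).const_mul (s₀ (τ.level w))).add_const (t₀ w)).congr fun k => ?_
    have := (hs (τ.level w) k).ne'; have := (hs₀ (τ.level w)).ne'
    field_simp; ring

theorem GromovConverges.comp {τ : PopsicleType φ} {u : ℕ → (Fin n → ℝ) × (Fin l → ℝ)}
    {c : τ.Conf} (h : τ.GromovConverges u c) {ι : ℕ → ℕ} (hι : Tendsto ι atTop atTop) :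
    τ.GromovConverges (u ∘ ι) c := by
  obtain ⟨s, b, t, hs, hlt, h1, h2, h3⟩ := h
  exact ⟨fun a => s a ∘ ι, fun v => b v ∘ ι, fun w => t w ∘ ι, fun a k => hs a _,
    fun a a' ha => (hlt a a' ha).comp hι, fun v d hd i hi => (h1 v d hd i hi).comp hι,
    fun v e he f hf => (h2 v e he f hf).comp hι, fun w e he f hf => (h3 w e he f hf).comp hι⟩

variable [NeZero n]

variable {τ} in
theorem Normalized.base {c : τ.Edge' → ℝ} (h : τ.Normalized c) (v : τ.Vertex) :
    c (τ.base v) = 0 := h _ (by rw [τ.minMark_base, τ.parent_base])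

variable {τ} in
theorem anchor_minMark {v : τ.Vertex} {B : Bool} (h : B = true → IsDisc v.1) :
    anchor φ B (minMark v.1) = minMark v.1 := by
  rcases B with _ | _
  · rfl
  · obtain ⟨i, hi⟩ := (h rfl).exists_minMark
    rw [hi]; rfl

variable {τ} in
-- A gap is a difference of two marks on one component, so the translations cancel. Heights on discs
-- are not translated; there the first mark of the parent is a boundary point, at height `0`.
theorem GromovConverges.tendsto_gap {u : ℕ → (Fin n → ℝ) × (Fin l → ℝ)} {c : τ.Conf}
    {s : τ.Level → ℕ → ℝ} {b : τ.DiscVertex → ℕ → ℝ} {t : τ.SphereVertex → ℕ → ℝ}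
    (h1 : ∀ v : τ.DiscVertex, ∀ d : τ.BoundaryPoint, d.1 ∈ τ.out v.1 → ∀ i, Sum.inl i ∈ d.1 →
      Tendsto (fun k => ((u k).1 i - b v k) / s (.inl v) k) atTop (𝓝 (c.1.1 d)))
    (h2 : ∀ v : τ.DiscVertex, ∀ e : τ.InteriorPoint, e.1 ∈ τ.out v.1 → ∀ f, Sum.inr f ∈ e.1 →
      Tendsto (fun k => (u k).2 f / s (.inl v) k) atTop (𝓝 (c.1.2 e)))
    (h3 : ∀ w : τ.SphereVertex, ∀ e : τ.InteriorPoint, e.1 ∈ τ.out w.1 → ∀ f, Sum.inr f ∈ e.1 →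
      Tendsto (fun k => ((u k).2 f - t w k) / s (τ.level w) k) atTop (𝓝 (c.1.2 e)))
    (e : τ.Edge') : Tendsto (fun k => τ.gap (u k) e / s (τ.vertexLevel (τ.parent e)) k) atTop
      (𝓝 (τ.normal (τ.coordEquiv c.1) e)) := by
  have hme := τ.minMark_mem_edge e
  have hmb := τ.minMark_mem_edge (τ.base (τ.parent e))
  rw [τ.minMark_base] at hmb
  have hbo := mem_out_parent (τ.base (τ.parent e))
  rw [τ.parent_base] at hbo
  have heo := mem_out_parent e
  by_cases hv : IsDisc (τ.parent e).1
  · rw [vertexLevel, dif_pos hv]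
    obtain ⟨j, hj⟩ := hv.exists_minMark
    have hb := isDisc_base hv
    by_cases he : IsDisc e.1
    · obtain ⟨i, hi⟩ := he.exists_minMark
      rw [hj] at hmb
      rw [hi] at hme
      have hc1 := h1 ⟨_, (τ.parent e).2.1, (τ.parent e).2.2, hv⟩ ⟨e.1, e.2.1, e.2.2, he⟩ heo i hme
      have hc2 := h1 ⟨_, (τ.parent e).2.1, (τ.parent e).2.2, hv⟩
        ⟨_, (τ.base (τ.parent e)).2.1, (τ.base (τ.parent e)).2.2, hb⟩ hbo j hmb
      rw [normal_disc _ he]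
      rw [← coordEquiv_disc] at hc1 hc2
      refine (hc1.sub hc2).congr fun k => ?_
      simp only [PopsicleType.gap, pos, hi, hj, he, decide_true, markColor, Sum.elim_inl, if_true,
        id]
      ring
    · rcases hi : minMark e.1 with i | f
      · exact absurd ⟨i, hi ▸ hme⟩ he
      rw [hi] at hme
      have hc := h2 ⟨_, (τ.parent e).2.1, (τ.parent e).2.2, hv⟩ ⟨e.1, e.2.1, he⟩ heo f hme
      rw [← coordEquiv_interior _ _ e.2.2] at hc
      rw [normal_interior _ hv he]
      refine hc.congr fun k => ?_
      simp [PopsicleType.gap, pos, hi, hj, he]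
  · rw [vertexLevel, dif_neg hv, normal_sphere _ hv]
    have he : ¬ IsDisc e.1 := fun h => hv (h.mono (τ.ssubset_parent e).1)
    have hb : ¬ IsDisc (τ.base (τ.parent e)).1 := fun h => hv (by
      have := h.mono (τ.ssubset_parent _).1
      rwa [τ.parent_base] at this)
    rcases hi : minMark e.1 with i | f
    · exact absurd ⟨i, hi ▸ hme⟩ he
    rcases hj : minMark (τ.parent e).1 with i | g
    · exact absurd ⟨i, hj ▸ hmb⟩ hb
    rw [hi] at hme
    rw [hj] at hmb
    have hc1 := h3 ⟨_, (τ.parent e).2.1, (τ.parent e).2.2, hv⟩ ⟨e.1, e.2.1, he⟩ heo f hme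
    have hc2 := h3 ⟨_, (τ.parent e).2.1, (τ.parent e).2.2, hv⟩
      ⟨_, (τ.base (τ.parent e)).2.1, hb⟩ hbo g hmb
    rw [← coordEquiv_interior _ _ e.2.2] at hc1
    rw [← coordEquiv_interior _ _ (τ.base (τ.parent e)).2.2] at hc2
    refine (hc1.sub hc2).congr fun k => ?_
    simp only [PopsicleType.gap, pos, hi, hj, he, decide_false, Sum.elim_inr, if_false,
      Bool.false_eq_true]
    ring

/-- This is the place where the path to `f` leaves the tree of discs. The coordinate there is a true
height, and its positivity gives that of the sprinkle. -/
theorem exists_discParent (τ : PopsicleType φ) (f : Fin l) :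
    ∃ e : τ.Edge', ¬ IsDisc e.1 ∧ IsDisc (τ.parent e).1 ∧ .inr f ∈ e.1 := by
  obtain ⟨v, hv, hmin⟩ := (τ.edges.filter fun e => IsDisc e ∧ .inr f ∈ e).exists_min_image
    Finset.card ⟨Finset.univ, Finset.mem_filter.2 ⟨τ.univ_mem, isDisc_univ, Finset.mem_univ _⟩⟩
  rw [Finset.mem_filter] at hv
  obtain ⟨hve, ⟨i, hi⟩, hvf⟩ := hv
  let v' : τ.Vertex := ⟨v, hve, Finset.one_lt_card.2 ⟨_, hi, _, hvf, by simp⟩⟩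
  have hp := τ.parent_child v' ⟨_, hvf⟩
  have hs := τ.ssubset_parent (τ.child v' ⟨_, hvf⟩)
  refine ⟨τ.child v' ⟨_, hvf⟩, fun h => ?_, by rw [hp]; exact ⟨i, hi⟩, τ.mem_child _ _⟩
  have := hmin _ (Finset.mem_filter.2 ⟨(τ.child v' ⟨_, hvf⟩).2.1, h, τ.mem_child _ _⟩)
  rw [hp] at hs
  exact absurd (Finset.card_lt_card hs) (not_lt.2 this)

variable {τ} in
theorem divisible_minMark (e : τ.Edge') {a : Mark n l}
    (ha : anchor φ (decide (IsDisc e.1)) a ∈ e.1) :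
    τ.Divisible (τ.vertexLevel (τ.parent e)) (decide (IsDisc e.1)) a (minMark (τ.parent e).1) := by
  refine divisible_of_mem ((τ.ssubset_parent e).1 ha) ?_ (LevelLe.refl _)
  rw [anchor_minMark fun h => (of_decide_eq_true h).mono (τ.ssubset_parent e).1]
  exact τ.minMark_mem_vertex _

variable [Fact (2 ≤ n + l)]

open Classical in
/-- The ratios of scales for stable popsicles of type `τ`. -/
noncomputable def rootRatio (a : τ.Level) : ℝ := if a = τ.rootLevel then 1 else 0

/-- The popsicles `u` have coordinates that converge to `c`, with ratios of scales tending to `0`. -/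
def Approximates {α : Type*} (F : Filter α) (u : α → (Fin n → ℝ) × (Fin l → ℝ))
    (c : τ.Edge' → ℝ) : Prop :=
  ∃ (d : α → τ.Edge' → ℝ) (r : α → τ.Level → ℝ) (S : α → ℝ),
    (∀ᶠ k in F, 0 < S k ∧ (∀ a, 0 < r k a) ∧
      τ.Represents (u k) (d k) fun a => S k * τ.scale (r k) a) ∧
    Tendsto d F (𝓝 c) ∧ Tendsto r F (𝓝 τ.rootRatio)

variable {τ}

theorem rootRatio_eq_zero : ∀ a ≠ τ.rootLevel, τ.rootRatio a = 0 := fun _ ha => if_neg ha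

theorem represents_div {u : (Fin n → ℝ) × (Fin l → ℝ)} {s : τ.Level → ℝ} (hs : ∀ a, 0 < s a) :
    τ.Represents u (fun e => τ.gap u e / s (τ.vertexLevel (τ.parent e)))
      fun a => s τ.rootLevel * τ.scale (τ.ratio s) a :=
  represents_of_gap fun e => by
    rw [scale_ratio hs, div_mul_cancel₀ _ (hs _).ne']

theorem tendsto_ratio {α : Type*} {F : Filter α} {s : τ.Level → α → ℝ}
    (h : ∀ a a', τ.LevelLt a a' → Tendsto (fun k => s a' k / s a k) F (𝓝 0)) :
    Tendsto (fun k => τ.ratio fun a => s a k) F (𝓝 τ.rootRatio) := by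
  rw [tendsto_pi_nhds]
  intro a
  unfold ratio rootRatio
  split_ifs with ha
  · exact tendsto_const_nhds
  · exact h _ _ (pred_lt ha)

theorem GromovConverges.approximates {u : ℕ → (Fin n → ℝ) × (Fin l → ℝ)} {c : τ.Conf}
    (h : τ.GromovConverges u c) : τ.Approximates atTop u (τ.normal (τ.coordEquiv c.1)) := by
  obtain ⟨s, b, t, hs, hlt, h1, h2, h3⟩ := h
  exact ⟨_, fun k => τ.ratio fun a => s a k, fun k => s τ.rootLevel k,
    Eventually.of_forall fun k => ⟨hs _ _, ratio_pos fun a => hs a k, represents_div fun a => hs a k⟩,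
    tendsto_pi_nhds.2 fun e => GromovConverges.tendsto_gap h1 h2 h3 e, tendsto_ratio hlt⟩

section

variable {α : Type*} {F : Filter α} {u : α → (Fin n → ℝ) × (Fin l → ℝ)} {c : τ.Edge' → ℝ}

/-- Continuity of `ratioExt` at `(c, τ.rootRatio)`, where the denominators do not vanish. -/
theorem Approximates.tendsto_ratioFun (h : τ.Approximates F u c) (hc : c ∈ τ.edgeConf) :
    Tendsto (fun k => ratioFun φ (u k)) F (𝓝 (τ.ratioExt c τ.rootRatio)) := by
  obtain ⟨d, r, S, h, hd, hr⟩ := h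
  have hcont := (contDiffOn_ratioExt (τ := τ)).continuousOn.continuousAt
    (isOpen_smoothDomain.mem_nhds (mem_smoothDomain hc rootRatio_eq_zero))
  refine (hcont.tendsto.comp (hd.prodMk_nhds hr)).congr' ?_
  filter_upwards [h] with k hk
  exact (hk.2.2.ratioFun hk.1 hk.2.1).symm

variable {d : α → τ.Edge' → ℝ} {r : α → τ.Level → ℝ} {S : α → ℝ}

theorem tendsto_quot (h : ∀ᶠ k in F, 0 < S k ∧ (∀ a, 0 < r k a) ∧
    τ.Represents (u k) (d k) fun a => S k * τ.scale (r k) a) (hd : Tendsto d F (𝓝 c))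
    (hr : Tendsto r F (𝓝 τ.rootRatio)) {a : τ.Level} {B : Bool} {p q : Mark n l}
    (hdiv : τ.Divisible a B p q) :
    Tendsto (fun k => (pos φ (u k) B p - pos φ (u k) B q) / (S k * τ.scale (r k) a)) F
      (𝓝 (τ.quot a c τ.rootRatio B p q)) := by
  refine ((contDiff_quot a B p q).continuous.continuousAt.tendsto.comp
    (hd.prodMk_nhds hr)).congr' ?_
  filter_upwards [h] with k hk
  rw [hk.2.2.pos_sub hdiv, mul_div_cancel_left₀ _ (mul_pos hk.1 (scale_pos hk.2.1 _)).ne']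
  rfl

theorem tendsto_scale_div (h : ∀ᶠ k in F, 0 < S k ∧ ∀ a, 0 < r k a)
    (hr : Tendsto r F (𝓝 τ.rootRatio)) {a a' : τ.Level} (ha : τ.LevelLt a a') :
    Tendsto (fun k => S k * τ.scale (r k) a' / (S k * τ.scale (r k) a)) F (𝓝 0) := by
  have hcont : Continuous fun r : τ.Level → ℝ => τ.scaleQuot r a a' := by
    unfold scaleQuot
    fun_prop
  have := (hcont.continuousAt (x := τ.rootRatio)).tendsto.comp hr
  rw [scaleQuot_eq_zero ha (rootRatio_eq_zero _ (ne_rootLevel_of_lt ha))] at this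
  refine this.congr' ?_
  filter_upwards [h] with k hk
  rw [← scale_mul_scaleQuot _ (.inr ha), ← mul_assoc,
    mul_div_cancel_left₀ _ (mul_pos hk.1 (scale_pos hk.2 _)).ne']
  rfl

theorem Approximates.exists_tendsto_quot (h : τ.Approximates F u c) {a : τ.Level} {B : Bool}
    {p q : Mark n l} (hd : τ.Divisible a B p q) : ∃ s : α → ℝ, (∀ᶠ k in F, 0 < s k) ∧
      Tendsto (fun k => (pos φ (u k) B p - pos φ (u k) B q) / s k) F
        (𝓝 (τ.quot a c τ.rootRatio B p q)) := by
  obtain ⟨d, r, S, h, hdc, hr⟩ := h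
  refine ⟨fun k => S k * τ.scale (r k) a, ?_, tendsto_quot h hdc hr hd⟩
  filter_upwards [h] with k hk using mul_pos hk.1 (scale_pos hk.2.1 _)

/-- With the base point at `0`, the coordinate of `e` can be measured from any mark beyond `e`, not
only from its first one. -/
theorem quot_minMark {c : τ.Edge' → ℝ} (hn : τ.Normalized c) (e : τ.Edge') {a : Mark n l}
    (ha : anchor φ (decide (IsDisc e.1)) a ∈ e.1) :
    τ.quot (τ.vertexLevel (τ.parent e)) c τ.rootRatio (decide (IsDisc e.1)) a
      (minMark (τ.parent e).1) = c e := by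
  have hA := anchor_minMark (v := τ.parent e) (B := decide (IsDisc e.1))
    fun h => (of_decide_eq_true h).mono (τ.ssubset_parent e).1
  have hb : anchor φ (decide (IsDisc e.1)) (minMark (τ.parent e).1) ∈ (τ.parent e).1 := by
    rw [hA]
    exact τ.minMark_mem_vertex _
  rw [quot_eq ((τ.ssubset_parent e).1 ha) hb c rootRatio_eq_zero,
    ← τ.eq_child rfl ha, lineCoord_pos (by simp)]
  have : τ.child (τ.parent e) ⟨_, hb⟩ = τ.base (τ.parent e) := by
    unfold StableTree.base
    congr 2
  rw [this, lineCoord, hn.base]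
  simp

/-- Each of the finitely many open conditions on a popsicle concerns two marks, or a sprinkle and
the boundary. After rescaling at the component where these separate, the condition holds in the
limit, hence eventually. -/
theorem Approximates.eventually_mem (h : τ.Approximates F u c) (hc : c ∈ τ.edgeConf)
    (hn : τ.Normalized c) : ∀ᶠ k in F, u k ∈ planarPopsicles φ := by
  have h1 : ∀ i j : Fin n, i < j → ∀ᶠ k in F, (u k).1 i < (u k).1 j := by
    intro i j hij
    have hne : (.inl i : Mark n l) ≠ .inl j := by simpa using hij.ne
    obtain ⟨s, hs, hlim⟩ := h.exists_tendsto_quot (divisible_of_mem (v := τ.join hne) (B := true)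
      (p := .inl j) (q := .inl i) (τ.right_mem_join hne) (τ.left_mem_join hne) (LevelLe.refl _))
    rw [quot_disc (p := .inl j) (q := .inl i) (τ.right_mem_join hne) (τ.left_mem_join hne) c
      rootRatio_eq_zero] at hlim
    have := coord_lt hc (by rw [τ.parent_child, τ.parent_child]) (τ.child_join_ne hne)
      (τ.mem_child _ ⟨_, τ.left_mem_join hne⟩) (τ.mem_child _ ⟨_, τ.right_mem_join hne⟩) hij
    filter_upwards [hlim.eventually_const_lt (sub_pos.2 this), hs] with k hk hsk
    exact sub_pos.1 ((div_pos_iff_of_pos_right hsk).1 hk)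
  have h2 : ∀ f, ∀ᶠ k in F, 0 < (u k).2 f := by
    intro f
    obtain ⟨e, he, hv, hf⟩ := τ.exists_discParent f
    have hf' : anchor φ (decide (IsDisc e.1)) (.inr f) ∈ e.1 := by simpa [anchor, he] using hf
    obtain ⟨s, hs, hlim⟩ := h.exists_tendsto_quot (divisible_minMark e hf')
    rw [quot_minMark hn e hf'] at hlim
    obtain ⟨j, hj⟩ := hv.exists_minMark
    filter_upwards [hlim.eventually_const_lt (coord_pos hc he hv), hs] with k hk hsk
    have := (div_pos_iff_of_pos_right hsk).1 hk
    simpa [pos, he, hj] using this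
  have h3 : ∀ f g : Fin l, f ≠ g → φ f = φ g → ∀ᶠ k in F, (u k).2 f ≠ (u k).2 g := by
    intro f g hfg hφ
    have hne : (.inr f : Mark n l) ≠ .inr g := by simpa using hfg
    obtain ⟨s, hs, hlim⟩ := h.exists_tendsto_quot (divisible_of_mem (v := τ.join hne) (B := false)
      (p := .inr f) (q := .inr g) (τ.left_mem_join hne) (τ.right_mem_join hne) (LevelLe.refl _))
    -- For two sprinkles of one color the horizontal offsets from the boundary point of that color
    -- vanish identically, so `quot_ne_zero` separates the heights.
    have hz : ∀ x : Fin l, φ x = φ f → τ.quot (τ.vertexLevel (τ.join hne)) c τ.rootRatio true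
        (.inr x) (.inl (φ f)) = 0 := by
      intro x hx
      unfold quot coeff
      simp [anchor, markColor, hx]
    have := quot_ne_zero hc rootRatio_eq_zero _ _ (τ.child_join_ne hne)
      (τ.color_mem_levelSet _ (τ.left_mem_join hne)) (hz f rfl) (hz g hφ.symm)
    filter_upwards [hlim.eventually_ne this] with k hk
    contrapose! hk
    simp [pos, hk]
  have h1 := eventually_all.2 fun i => eventually_all.2 fun j => eventually_all.2 (h1 i j)
  have h2 := eventually_all.2 h2
  have h3 := eventually_all.2 fun f => eventually_all.2 fun g => eventually_all.2 fun hne =>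
    eventually_all.2 (h3 f g hne)
  filter_upwards [h1, h2, h3] with k h1 h2 h3 using ⟨fun i j => h1 i j, h2, h3⟩

end

theorem Approximates.gromovConverges {u : ℕ → (Fin n → ℝ) × (Fin l → ℝ)} {c : τ.Edge' → ℝ}
    (h : τ.Approximates atTop u c) (hc : c ∈ τ.edgeConf) (hn : τ.Normalized c) :
    τ.GromovConverges u (toConf c hc) := by
  classical
  obtain ⟨d, r, S, h, hdc, hr⟩ := h
  -- The scales are positive only eventually, whereas `GromovConverges` wants them positive for all
  -- `k`; the default value `1` changes no limit.
  have hs : ∀ a, ∀ᶠ k in atTop, (if 0 < S k * τ.scale (r k) a then S k * τ.scale (r k) a else 1) =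
      S k * τ.scale (r k) a := fun a => by
    filter_upwards [h] with k hk
    rw [if_pos (mul_pos hk.1 (scale_pos hk.2.1 _))]
  have key : ∀ (e : τ.Edge') (a : Mark n l), anchor φ (decide (IsDisc e.1)) a ∈ e.1 →
      Tendsto (fun k => (pos φ (u k) (decide (IsDisc e.1)) a -
        pos φ (u k) (decide (IsDisc e.1)) (minMark (τ.parent e).1)) /
        (if 0 < S k * τ.scale (r k) (τ.vertexLevel (τ.parent e)) then
          S k * τ.scale (r k) (τ.vertexLevel (τ.parent e)) else 1)) atTop (𝓝 (c e)) := by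
    intro e a ha
    rw [← quot_minMark hn e ha]
    refine (tendsto_quot h hdc hr (divisible_minMark e ha)).congr' ?_
    filter_upwards [hs (τ.vertexLevel (τ.parent e))] with k hsk
    rw [hsk]
  refine ⟨fun a k => if 0 < S k * τ.scale (r k) a then S k * τ.scale (r k) a else 1,
    fun v k => pos φ (u k) true (minMark v.1), fun w k => pos φ (u k) false (minMark w.1),
    fun a k => ?_, fun a a' ha => ?_, fun v e he i hi => ?_, fun v e he f hf => ?_,
    fun w e he f hf => ?_⟩
  · beta_reduce
    split_ifs with h
    · exact h
    · exact one_pos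
  · refine (tendsto_scale_div (h.mono fun k hk => ⟨hk.1, hk.2.1⟩) hr ha).congr' ?_
    filter_upwards [hs a, hs a'] with k h1 h2
    rw [h1, h2]
  · have hp := parent_eq_iff (v := ⟨v.1, v.2.1, v.2.2.1⟩) (e := ⟨e.1, e.2.1, e.2.2.1⟩) |>.2 he
    have := key ⟨e.1, e.2.1, e.2.2.1⟩ (.inl i) (by simpa [e.2.2.2, anchor, markColor] using hi)
    rw [hp, τ.vertexLevel_disc] at this
    change Tendsto _ _ (𝓝 (c ⟨e.1, e.2.1, e.2.2.1⟩))
    simpa [e.2.2.2, pos, markColor] using this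
  · have hp := parent_eq_iff (v := ⟨v.1, v.2.1, v.2.2.1⟩)
      (e := ⟨e.1, e.2.1, ne_univ_of_not_isDisc e.2.2⟩) |>.2 he
    have := key ⟨e.1, e.2.1, ne_univ_of_not_isDisc e.2.2⟩ (.inr f)
      (by rw [anchor, if_neg (by simp [e.2.2])]; exact hf)
    obtain ⟨j, hj⟩ := v.2.2.2.exists_minMark
    rw [hp, τ.vertexLevel_disc] at this
    simp only [e.2.2, pos, decide_false, hj] at this
    change Tendsto _ _ (𝓝 (c ⟨e.1, e.2.1, ne_univ_of_not_isDisc e.2.2⟩))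
    simpa using this
  · have hp := parent_eq_iff (v := ⟨w.1, w.2.1, w.2.2.1⟩)
      (e := ⟨e.1, e.2.1, ne_univ_of_not_isDisc e.2.2⟩) |>.2 he
    have := key ⟨e.1, e.2.1, ne_univ_of_not_isDisc e.2.2⟩ (.inr f)
      (by rw [anchor, if_neg (by simp [e.2.2])]; exact hf)
    rw [hp, τ.vertexLevel_sphere] at this
    simp only [e.2.2, decide_false] at this
    exact this

end PopsicleType

/-! ## Types from orders of magnitude -/

/-- Orders of magnitude for the distances of the marked points. -/
structure Magnitude {n l : ℕ} (φ : Fin l → Fin n) where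
  ord : Mark n l → Mark n l → ℕ
  self : ∀ a, ord a a = 0
  pos : ∀ a b, a ≠ b → 0 < ord a b
  symm : ∀ a b, ord a b = ord b a
  ultra : ∀ a b c, ord a c ≤ max (ord a b) (ord b c)
  color : ∀ a b, ord (.inl (markColor φ a)) (.inl (markColor φ b)) ≤ ord a b
  convex : ∀ i j k : Fin n, i ≤ j → j ≤ k → ord (.inl i) (.inl j) ≤ ord (.inl i) (.inl k)

namespace Magnitude

variable {n l : ℕ} {φ : Fin l → Fin n} (ℓ : Magnitude φ)

/-- A set of marks that are closer to each other than to the other marks. -/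
def IsCluster (Q : Finset (Mark n l)) : Prop :=
  Q.Nonempty ∧ ∀ a ∈ Q, ∀ b ∈ Q, ∀ c ∉ Q, ℓ.ord a b < ℓ.ord a c

/-- The order of magnitude of a set. -/
def diam (Q : Finset (Mark n l)) : ℕ := Q.sup fun a => Q.sup fun b => ℓ.ord a b

variable {ℓ}

theorem ord_le_diam {Q : Finset (Mark n l)} {a b : Mark n l} (ha : a ∈ Q) (hb : b ∈ Q) :
    ℓ.ord a b ≤ ℓ.diam Q :=
  (Finset.le_sup (f := fun b => ℓ.ord a b) hb).trans
    (Finset.le_sup (f := fun a => Q.sup fun b => ℓ.ord a b) ha)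

/-- In an ultrametric every point of a set realizes the diameter: one of two points at maximal
distance is at that distance from `a`. -/
theorem exists_ord_eq_diam {Q : Finset (Mark n l)} {a : Mark n l} (ha : a ∈ Q) :
    ∃ b ∈ Q, ℓ.ord a b = ℓ.diam Q := by
  obtain ⟨x, hx, hx'⟩ := Q.exists_mem_eq_sup ⟨a, ha⟩ fun a => Q.sup fun b => ℓ.ord a b
  obtain ⟨y, hy, hy'⟩ := Q.exists_mem_eq_sup ⟨a, ha⟩ fun b => ℓ.ord x b
  have h : ℓ.ord x y = ℓ.diam Q := by rw [diam, hx', hy']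
  have h1 := ord_le_diam (ℓ := ℓ) ha hx
  have h2 := ord_le_diam (ℓ := ℓ) ha hy
  have h3 := ℓ.ultra x a y
  rw [ℓ.symm x a] at h3
  rcases le_max_iff.1 h3 with h4 | h4
  · exact ⟨x, hx, by omega⟩
  · exact ⟨y, hy, by omega⟩

theorem diam_lt_iff {Q : Finset (Mark n l)} {N : ℕ} {a : Mark n l} (ha : a ∈ Q) :
    ℓ.diam Q < N ↔ ∀ b ∈ Q, ℓ.ord a b < N := by
  constructor
  · exact fun h b hb => (ord_le_diam ha hb).trans_lt h
  · intro h
    obtain ⟨b, hb, hb'⟩ := exists_ord_eq_diam (ℓ := ℓ) ha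
    exact hb' ▸ h b hb

theorem IsCluster.mem_iff {Q : Finset (Mark n l)} (hQ : ℓ.IsCluster Q) {a b : Mark n l}
    (ha : a ∈ Q) : b ∈ Q ↔ ℓ.ord a b ≤ ℓ.diam Q := by
  refine ⟨fun hb => ord_le_diam ha hb, fun h => ?_⟩
  by_contra hb
  obtain ⟨c, hc, hc'⟩ := exists_ord_eq_diam (ℓ := ℓ) ha
  exact absurd (hQ.2 a ha c hc b hb) (by omega)

theorem IsCluster.diam_lt {P Q : Finset (Mark n l)} (hP : ℓ.IsCluster P) (h : P ⊂ Q) :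
    ℓ.diam P < ℓ.diam Q := by
  obtain ⟨a, ha⟩ := hP.1
  obtain ⟨b, hb, hb'⟩ := exists_ord_eq_diam (ℓ := ℓ) ha
  obtain ⟨c, hc, hc'⟩ := Finset.exists_of_ssubset h
  rw [← hb']
  exact (hP.2 a ha b hb c hc').trans_le (ord_le_diam (h.1 ha) hc)

variable (ℓ)

/-- The marks at distance of order less than `N` from `a`. -/
def ball (a : Mark n l) (N : ℕ) : Finset (Mark n l) := Finset.univ.filter fun b => ℓ.ord a b < N

variable {ℓ}

theorem mem_ball {a b : Mark n l} {N : ℕ} : b ∈ ℓ.ball a N ↔ ℓ.ord a b < N := by simp [ball]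

/-- Two points of an ultrametric ball are closer to each other than to any point outside. Conversely
every cluster is a ball around each of its points, by `IsCluster.eq_ball`. -/
theorem isCluster_ball {a : Mark n l} {N : ℕ} (hN : 0 < N) : ℓ.IsCluster (ℓ.ball a N) := by
  refine ⟨⟨a, by simpa [mem_ball, ℓ.self] using hN⟩, fun x hx y hy z hz => ?_⟩
  rw [mem_ball] at *
  have h1 := ℓ.ultra x a y
  have h2 := ℓ.ultra a x z
  rw [ℓ.symm x a] at h1
  rcases le_max_iff.1 h1 with h1 | h1 <;> rcases le_max_iff.1 h2 with h2 | h2 <;> omega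

theorem mem_ball_self {a : Mark n l} {N : ℕ} (hN : 0 < N) : a ∈ ℓ.ball a N := by
  simpa [mem_ball, ℓ.self] using hN

theorem diam_ball_lt {a : Mark n l} {N : ℕ} (hN : 0 < N) : ℓ.diam (ℓ.ball a N) < N :=
  (diam_lt_iff (mem_ball_self hN)).2 fun _ => mem_ball.1

theorem ball_congr {a b : Mark n l} {N : ℕ} (h : ℓ.ord a b < N) : ℓ.ball a N = ℓ.ball b N := by
  ext c
  rw [mem_ball, mem_ball]
  have h1 := ℓ.ultra a b c
  have h2 := ℓ.ultra b a c
  rw [ℓ.symm b a] at h2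
  rcases le_max_iff.1 h1 with h1 | h1 <;> rcases le_max_iff.1 h2 with h2 | h2 <;> omega

theorem IsCluster.eq_ball {Q : Finset (Mark n l)} (hQ : ℓ.IsCluster Q) {a : Mark n l} (ha : a ∈ Q) :
    Q = ℓ.ball a (ℓ.diam Q + 1) := by
  ext b
  rw [mem_ball, hQ.mem_iff ha, Nat.lt_succ_iff]

theorem ball_mono {a : Mark n l} {N M : ℕ} (h : N ≤ M) : ℓ.ball a N ⊆ ℓ.ball a M := fun b hb => by
  rw [mem_ball] at *
  omega

variable (ℓ)

open Classical in
/-- The tree of clusters. -/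
noncomputable def tree [NeZero n] : StableTree n l where
  edges := Finset.univ.filter ℓ.IsCluster
  univ_mem := by simp [IsCluster]
  singleton_mem a := by
    simp only [Finset.mem_filter, Finset.mem_univ, true_and]
    refine ⟨by simp, fun x hx y hy z hz => ?_⟩
    simp only [Finset.mem_singleton] at hx hy hz
    subst hx; subst hy
    rw [ℓ.self]
    exact ℓ.pos _ _ (Ne.symm hz)
  nonempty_of_mem Q hQ := by
    simp only [Finset.mem_filter, Finset.mem_univ, true_and] at hQ
    exact hQ.1
  laminar P hP Q hQ := by
    simp only [Finset.mem_filter, Finset.mem_univ, true_and] at hP hQ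
    by_contra! h
    obtain ⟨b, hb, hbQ⟩ := Finset.not_subset.1 h.1
    obtain ⟨c, hc, hcP⟩ := Finset.not_subset.1 h.2.1
    obtain ⟨a, haP, haQ⟩ := Finset.not_disjoint_iff.1 h.2.2
    exact lt_asymm (hP.2 a haP b hb c hcP) (hQ.2 a haQ c hc b hbQ)

variable {ℓ}

theorem diam_pos {Q : Finset (Mark n l)} (h : 2 ≤ Q.card) : 0 < ℓ.diam Q := by
  obtain ⟨a, ha, b, hb, hab⟩ := Finset.one_lt_card.1 h
  exact (ℓ.pos a b hab).trans_le (ord_le_diam ha hb)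

variable [NeZero n]

theorem mem_tree {Q : Finset (Mark n l)} : Q ∈ ℓ.tree.edges ↔ ℓ.IsCluster Q := by simp [tree]

theorem ord_lt_of_mem_out {v e : Finset (Mark n l)} (he : e ∈ ℓ.tree.out v) {a b : Mark n l}
    (ha : a ∈ e) (hb : b ∈ e) : ℓ.ord a b < ℓ.diam v := by
  have h := ℓ.tree.mem_out.1 he
  exact (ord_le_diam ha hb).trans_lt ((mem_tree.1 h.1).diam_lt h.2.1)

/-- The open ball of radius `ℓ.diam v` around a mark of `e` is an edge strictly inside `v`, hence
contained in the outgoing edge `e`. -/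
theorem mem_of_mem_out {v e : Finset (Mark n l)} (he : e ∈ ℓ.tree.out v) (hv : 2 ≤ v.card)
    (hve : v ∈ ℓ.tree.edges) {a b : Mark n l} (ha : a ∈ e) (h : ℓ.ord a b < ℓ.diam v) : b ∈ e := by
  have hav := (ℓ.tree.mem_out.1 he).2.1.1 ha
  have hs : ℓ.ball a (ℓ.diam v) ⊂ v := by
    obtain ⟨c, hc, hc'⟩ := exists_ord_eq_diam (ℓ := ℓ) hav
    refine ⟨?_, fun h' => ?_⟩
    · conv_rhs => rw [(mem_tree.1 hve).eq_ball hav]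
      exact ball_mono (Nat.le_succ _)
    · have := mem_ball.1 (h' hc)
      omega
  exact ℓ.tree.subset_child (mem_tree.2 (isCluster_ball (diam_pos hv))) hs he
    (mem_ball_self (diam_pos hv)) ha (mem_ball.2 h)

theorem color_mem {v : Finset (Mark n l)} (hv : v ∈ ℓ.tree.edges) (hd : IsDisc v) {a : Mark n l}
    (ha : a ∈ v) : .inl (markColor φ a) ∈ v := by
  obtain ⟨i, hi⟩ := hd
  rw [(mem_tree.1 hv).mem_iff hi]
  have h1 := ℓ.color (.inl i) a
  exact h1.trans (ord_le_diam hi ha)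

/-- Colors are at most as far apart as the marks (the field `color`). Marks closer than `ℓ.diam v`
thus have their colors in one outgoing edge of `v`. This serves both `flavored` and `alignable`. -/
theorem exists_onLine {v e : Finset (Mark n l)} (hv : v ∈ ℓ.tree.edges) (hc : 2 ≤ v.card)
    (he : e.Nonempty) (hd : ¬ IsDisc e) (hcol : ∀ f, .inr f ∈ e → .inl (φ f) ∈ v)
    (hlt : ∀ a ∈ e, ∀ b ∈ e, ℓ.ord a b < ℓ.diam v) : ∃ d, ℓ.tree.OnLine φ v e d := by
  obtain ⟨i | f, hf⟩ := he
  · exact absurd ⟨i, hf⟩ hd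
  obtain ⟨d, hdo, hfd⟩ := ℓ.tree.exists_child hc (hcol f hf)
  refine ⟨d, hdo, ⟨_, hfd⟩, fun j hj => ?_⟩
  simp only [inducedColor, Finset.mem_image, Finset.mem_filter, Finset.mem_univ, true_and] at hj
  obtain ⟨g, hg, rfl⟩ := hj
  simp only [canonicalColor, Finset.mem_filter, Finset.mem_univ, true_and]
  exact mem_of_mem_out hdo hc hv hfd ((ℓ.color (.inr f) (.inr g)).trans_lt (hlt _ hf _ hg))

/-- A boundary point on a line of a sphere. -/
noncomputable def center (_ : Magnitude φ) (Q : Finset (Mark n l)) : Mark n l :=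
  .inl (markColor φ (minMark Q))

theorem center_ord {Q : Finset (Mark n l)} {a : Mark n l} (ha : a ∈ Q) :
    ℓ.ord (ℓ.center Q) (.inl (markColor φ a)) ≤ ℓ.diam Q :=
  (ℓ.color _ _).trans (ord_le_diam (minMark_mem ⟨a, ha⟩) ha)

variable (ℓ)

open Classical in
/-- The vertex or edge of the tree of discs with which a sphere is aligned. -/
noncomputable def cell (w : ℓ.tree.SphereVertex) : ℓ.tree.Cell :=
  -- If some mark is at distance exactly the order of `w` from a color of `w`, then the closed ball
  -- of that radius is a disc vertex of the same order as `w`. Otherwise open and closed balls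
  -- agree, no disc on the path has this order, and `w` belongs to the edge given by the ball.
  if h : ∃ b, ℓ.ord (ℓ.center w.1) b = ℓ.diam w.1 then
    .inl ⟨ℓ.ball (ℓ.center w.1) (ℓ.diam w.1 + 1), mem_tree.2 (isCluster_ball (Nat.succ_pos _)), by
      obtain ⟨b, hb⟩ := h
      refine Finset.one_lt_card.2 ⟨_, mem_ball_self (Nat.succ_pos _), b, mem_ball.2 (by omega), ?_⟩
      intro h'
      rw [← h', ℓ.self] at hb
      exact absurd (diam_pos (ℓ := ℓ) w.2.2.1) (by omega), ⟨_, mem_ball_self (Nat.succ_pos _)⟩⟩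
  else .inr ⟨ℓ.ball (ℓ.center w.1) (ℓ.diam w.1),
    mem_tree.2 (isCluster_ball (diam_pos w.2.2.1)), ⟨_, mem_ball_self (diam_pos w.2.2.1)⟩⟩

variable {ℓ}

theorem cell_inl {w : ℓ.tree.SphereVertex} {v : ℓ.tree.DiscVertex} (h : ℓ.cell w = .inl v) :
    v.1 = ℓ.ball (ℓ.center w.1) (ℓ.diam w.1 + 1) ∧ ℓ.diam v.1 = ℓ.diam w.1 := by
  unfold cell at h
  split_ifs at h with hb
  obtain ⟨b, hb⟩ := hb
  obtain rfl := Sum.inl.inj h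
  refine ⟨rfl, le_antisymm (Nat.lt_succ_iff.1 (diam_ball_lt (Nat.succ_pos _))) ?_⟩
  exact hb.ge.trans (ord_le_diam (mem_ball_self (Nat.succ_pos _)) (mem_ball.2 (by omega)))

theorem cell_inr {w : ℓ.tree.SphereVertex} {e : ℓ.tree.DiscEdge} (h : ℓ.cell w = .inr e) :
    e.1 = ℓ.ball (ℓ.center w.1) (ℓ.diam w.1) ∧
      ∀ b, ℓ.ord (ℓ.center w.1) b ≠ ℓ.diam w.1 := by
  unfold cell at h
  split_ifs at h with hb
  obtain rfl := Sum.inr.inj h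
  exact ⟨rfl, fun b hb' => hb ⟨b, hb'⟩⟩

/-- The cell of a sphere, described from any of its colors. -/
theorem cell_eq {w : ℓ.tree.SphereVertex} {x : Mark n l}
    (hx : ℓ.ord (ℓ.center w.1) x ≤ ℓ.diam w.1) :
    (∃ v, ℓ.cell w = .inl v ∧ v.1 = ℓ.ball x (ℓ.diam w.1 + 1) ∧ ℓ.diam v.1 = ℓ.diam w.1) ∨
      ∃ e, ℓ.cell w = .inr e ∧ e.1 = ℓ.ball x (ℓ.diam w.1) ∧
        ∀ b, ℓ.ord x b ≠ ℓ.diam w.1 := by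
  rcases h : ℓ.cell w with v | e
  · refine .inl ⟨v, rfl, ?_, (cell_inl h).2⟩
    rw [(cell_inl h).1, ball_congr (Nat.lt_succ_iff.2 hx)]
  · have h' := cell_inr h
    have hx' := lt_of_le_of_ne hx (h'.2 x)
    refine .inr ⟨e, rfl, by rw [h'.1, ball_congr hx'], fun b hb => ?_⟩
    have h1 := ℓ.ultra (ℓ.center w.1) x b
    have h2 := ℓ.ultra x (ℓ.center w.1) b
    rw [ℓ.symm x (ℓ.center w.1)] at h2
    refine h'.2 b ?_
    rcases le_max_iff.1 h1 with h1 | h1 <;> rcases le_max_iff.1 h2 with h2 | h2 <;> omega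

/-- The center of `w'` is also a center for `w`, so both cells are balls around one point, and the
smaller diameter gives the smaller ball. The balls can coincide as cells only on an edge. -/
theorem cell_lt {w w' : ℓ.tree.SphereVertex} (h : w'.1 ⊂ w.1) :
    (ℓ.cell w = ℓ.cell w' ∧ ∃ e, ℓ.cell w = .inr e) ∨
      ℓ.tree.CellLt (ℓ.cell w) (ℓ.cell w') := by
  have hlt := (mem_tree.1 w'.2.1).diam_lt h
  have hx : ℓ.ord (ℓ.center w.1) (ℓ.center w'.1) ≤ ℓ.diam w.1 :=
    center_ord (h.1 (minMark_mem (ℓ.tree.nonempty_of_mem _ w'.2.1)))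
  have hx' : ℓ.ord (ℓ.center w'.1) (ℓ.center w'.1) ≤ ℓ.diam w'.1 := by
    rw [ℓ.self]; exact Nat.zero_le _
  have hss : ∀ {P Q : Finset (Mark n l)}, P ⊆ Q → ℓ.diam P < ℓ.diam Q → P ⊂ Q :=
    fun hPQ hd => Finset.ssubset_iff_subset_ne.2 ⟨hPQ, fun h => by rw [h] at hd; omega⟩
  rcases cell_eq hx with ⟨v, hv, hv1, hv2⟩ | ⟨e, he, he1, he2⟩ <;>
    rcases cell_eq hx' with ⟨v', hv', hv1', hv2'⟩ | ⟨e', he', he1', he2'⟩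
  · right
    rw [hv, hv']
    refine hss ?_ (by omega)
    rw [hv1, hv1']
    exact ball_mono (by omega)
  · right
    rw [hv, he']
    refine hss ?_ ?_
    · rw [hv1, he1']
      exact ball_mono (by omega)
    · rw [he1', hv2]
      exact (diam_ball_lt (diam_pos w'.2.2.1)).trans hlt
  · right
    rw [he, hv']
    change v'.1 ⊆ e.1
    rw [he1, hv1']
    exact ball_mono (by omega)
  · rw [he, he']
    have hsub : e'.1 ⊆ e.1 := by
      rw [he1, he1']
      exact ball_mono hlt.le
    by_cases heq : e'.1 = e.1
    · exact .inl ⟨congrArg _ (Subtype.ext heq.symm), e, rfl⟩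
    · exact .inr (Finset.ssubset_iff_subset_ne.2 ⟨hsub, heq⟩)

variable (ℓ)

/-- The orders of magnitude of the spheres aligned with an edge. -/
noncomputable def edgeOrds (e : ℓ.tree.DiscEdge) : Finset ℕ :=
  (Finset.univ.filter fun w => ℓ.cell w = .inr e).image fun w => ℓ.diam w.1

variable {ℓ}

theorem mem_edgeOrds {e : ℓ.tree.DiscEdge} {N : ℕ} :
    N ∈ ℓ.edgeOrds e ↔ ∃ w, ℓ.cell w = .inr e ∧ ℓ.diam w.1 = N := by
  simp [edgeOrds]

variable (ℓ)

/-- The combinatorial type for given orders of magnitude. -/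
noncomputable def type : PopsicleType φ where
  toStableTree := ℓ.tree
  planar e he := by
    refine ⟨fun i hi k hk j hj => ?_⟩
    exact ((mem_tree.1 he).mem_iff hi).2 ((ℓ.convex i j k hj.1 hj.2).trans (ord_le_diam hi hk))
  flavored v e he hd := by
    have hout := ℓ.tree.mem_out.1 he
    exact exists_onLine v.2.1 v.2.2.1 (ℓ.tree.nonempty_of_mem _ hout.1) hd
      (fun f hf => color_mem v.2.1 v.2.2.2 (hout.2.1.1 hf))
      fun a ha b hb => ord_lt_of_mem_out he ha hb
  Φ := ℓ.cell
  alignable w := by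
    rcases h : ℓ.cell w with v | e
    · intro e he
      have hout := ℓ.tree.mem_out.1 he
      have hv := cell_inl h
      refine exists_onLine v.2.1 v.2.2.1 (ℓ.tree.nonempty_of_mem _ hout.1)
        (fun h => w.2.2.2 (h.mono hout.2.1.1)) (fun f hf => ?_) fun a ha b hb => ?_
      · rw [hv.1, mem_ball, Nat.lt_succ_iff]
        exact center_ord (hout.2.1.1 hf)
      · rw [hv.2]
        exact ord_lt_of_mem_out he ha hb
    · intro j hj
      simp only [inducedColor, Finset.mem_image, Finset.mem_filter, Finset.mem_univ,
        true_and] at hj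
      obtain ⟨f, hf, rfl⟩ := hj
      have he := cell_inr h
      simp only [canonicalColor, Finset.mem_filter, Finset.mem_univ, true_and]
      rw [he.1, mem_ball]
      exact lt_of_le_of_ne (center_ord hf) (he.2 _)
  beyond w v hwv := by
    have hlt := (mem_tree.1 w.2.1).diam_lt hwv
    have hm := minMark_mem (ℓ.tree.nonempty_of_mem _ w.2.1)
    have hc : ℓ.center w.1 ∈ v.1 := color_mem v.2.1 v.2.2.2 (hwv.1 hm)
    have hb := (mem_tree.1 v.2.1).eq_ball hc
    rcases h : ℓ.cell w with v' | e
    · have h' := cell_inl h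
      refine Finset.ssubset_iff_subset_ne.2 ⟨?_, fun heq => ?_⟩
      · rw [hb, h'.1]
        exact ball_mono (by omega)
      · have := h'.2
        rw [heq] at this
        omega
    · have h' := cell_inr h
      refine Finset.ssubset_iff_subset_ne.2 ⟨?_, fun heq => ?_⟩
      · rw [hb, h'.1]
        exact ball_mono (by omega)
      · have := diam_ball_lt (ℓ := ℓ) (a := ℓ.center w.1) (diam_pos (ℓ := ℓ) w.2.2.1)
        rw [← h'.1, heq] at this
        omega
  monotone w w' h := (cell_lt h).imp And.left id
  strict w w' v v' h hv hv' := by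
    rcases cell_lt h with ⟨-, e, he⟩ | h'
    · rw [hv] at he
      cases he
    · rwa [hv, hv'] at h'
  m e := (ℓ.edgeOrds e).card
  -- Levels farther from the root have smaller orders, while `orderIsoOfFin` is increasing; hence
  -- `Fin.rev`.
  Ψ e w := Fin.rev (((ℓ.edgeOrds e).orderIsoOfFin rfl).symm
    ⟨ℓ.diam w.1.1, mem_edgeOrds.2 ⟨w.1, w.2, rfl⟩⟩)
  Ψ_surjective e k := by
    obtain ⟨w, hw, hw'⟩ := mem_edgeOrds.1 ((ℓ.edgeOrds e).orderIsoOfFin rfl (Fin.rev k)).2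
    refine ⟨⟨w, hw⟩, ?_⟩
    rw [← Fin.rev_rev k, Fin.rev_inj, OrderIso.symm_apply_eq]
    exact Subtype.ext hw'
  Ψ_strict e w w' h := by
    rw [Fin.rev_lt_rev, OrderIso.lt_iff_lt]
    exact (mem_tree.1 w'.1.2.1).diam_lt h

end Magnitude

namespace PopsicleType

variable {n l : ℕ} {φ : Fin l → Fin n} (τ : PopsicleType φ)

/-- Orders of magnitude of the levels, compatible with those for the distances. -/
structure IsOrd (ℓ : Magnitude φ) (L : τ.Level → ℕ) : Prop where
  lt : ∀ a b, τ.LevelLt a b → L b < L a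
  join : ∀ {a b} (h : a ≠ b), ℓ.ord a b = L (τ.vertexLevel (τ.join h))

end PopsicleType

namespace Magnitude

variable {n l : ℕ} {φ : Fin l → Fin n} [NeZero n] (ℓ : Magnitude φ)

/-- The order of a disc is its diameter, and the order of a level on an edge is the diameter of the
spheres aligned there. By construction of `cell` and `Ψ`, every component has the order of its own
diameter. -/
theorem exists_isOrd : ∃ L, ℓ.type.IsOrd ℓ L := by
  let L : ℓ.type.Level → ℕ := fun a => match a with
    | .inl v => ℓ.diam v.1
    | .inr a => (ℓ.edgeOrds a.1).orderIsoOfFin rfl (Fin.rev a.2)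
  have hL : ∀ w, L (ℓ.type.level w) = ℓ.diam w.1 := by
    intro w
    rcases h : ℓ.type.Φ w with v | e
    · rw [ℓ.type.level_eq_inl h]
      exact (cell_inl h).2
    · rw [ℓ.type.level_eq_inr h]
      change (((ℓ.edgeOrds e).orderIsoOfFin rfl (Fin.rev (Fin.rev _))) : ℕ) = _
      rw [Fin.rev_rev, OrderIso.apply_symm_apply]
  have hV : ∀ v : ℓ.type.Vertex, L (ℓ.type.vertexLevel v) = ℓ.diam v.1 := by
    intro v
    unfold PopsicleType.vertexLevel
    split_ifs with h
    · rfl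
    · exact hL _
  -- a level on an edge is that of a sphere
  have hE : ∀ (e : ℓ.tree.DiscEdge) (k : Fin (ℓ.type.m e)), ∃ w, ℓ.cell w = .inr e ∧
      L (.inr ⟨e, k⟩) = ℓ.diam w.1 := by
    intro e k
    obtain ⟨w, hw⟩ := ℓ.type.Ψ_surjective e k
    refine ⟨w.1, w.2, ?_⟩
    rw [← hL w.1, ℓ.type.level_eq_inr w.2]
    rw [← hw]
  refine ⟨L, ?_, ?_⟩
  · rintro a b (h | ⟨e, k, k', hk, rfl, rfl⟩)
    · rcases a with u | ⟨e, k⟩ <;> rcases b with v | ⟨e', k'⟩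
      · exact (mem_tree.1 v.2.1).diam_lt h
      · obtain ⟨w, hw, hLw⟩ := hE e' k'
        have he := cell_inr hw
        have h : e'.1 ⊂ u.1 := h
        rw [hLw]
        change _ < ℓ.diam u.1
        have hcu : ℓ.center w.1 ∈ u.1 := h.1 (he.1 ▸ mem_ball_self (diam_pos w.2.2.1))
        obtain ⟨b, hb, hb'⟩ := Finset.exists_of_ssubset h
        rw [he.1, mem_ball, not_lt] at hb'
        -- No mark is at distance exactly `ℓ.diam w.1` from the center, so a mark outside the ball
        -- is strictly farther away.
        exact (lt_of_le_of_ne hb' (he.2 b).symm).trans_le (ord_le_diam hcu hb)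
      · obtain ⟨w, hw, hLw⟩ := hE e k
        have he := cell_inr hw
        have h : v.1 ⊆ e.1 := h
        rw [hLw]
        change ℓ.diam v.1 < _
        have hd := diam_ball_lt (ℓ := ℓ) (a := ℓ.center w.1) (diam_pos (ℓ := ℓ) w.2.2.1)
        rw [← he.1] at hd
        obtain ⟨x, hx⟩ := v.2.2.2
        exact (diam_lt_iff hx).2 fun b hb => (ord_le_diam (h hx) (h hb)).trans_lt hd
      · obtain ⟨w, hw, hLw⟩ := hE e k
        obtain ⟨w', hw', hLw'⟩ := hE e' k'
        have he := cell_inr hw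
        have he' := cell_inr hw'
        have h : e'.1 ⊂ e.1 := h
        rw [hLw, hLw']
        have hd := diam_ball_lt (ℓ := ℓ) (a := ℓ.center w.1) (diam_pos (ℓ := ℓ) w.2.2.1)
        rw [← he.1] at hd
        have hc : ℓ.center w'.1 ∈ e.1 := h.1 (he'.1 ▸ mem_ball_self (diam_pos w'.2.2.1))
        obtain ⟨b, hb, hb'⟩ := Finset.exists_of_ssubset h
        rw [he'.1, mem_ball, not_lt] at hb'
        exact (hb'.trans (ord_le_diam hc hb)).trans_lt hd
    · exact (OrderIso.lt_iff_lt ((ℓ.edgeOrds e).orderIsoOfFin rfl)).2 (Fin.rev_lt_rev.2 hk)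
  · intro a b h
    rw [hV]
    have hj := ℓ.type.join h
    refine le_antisymm (ord_le_diam (ℓ.type.left_mem_join h) (ℓ.type.right_mem_join h)) ?_
    by_contra! hlt
    refine ℓ.type.child_join_ne h (Subtype.ext (ℓ.type.child_unique (ℓ.type.child_mem_out _ _)
      (ℓ.type.child_mem_out _ _) ?_ (ℓ.type.mem_child _ ⟨b, _⟩)))
    exact mem_of_mem_out (ℓ.type.child_mem_out _ _) (ℓ.type.join h).2.2 (ℓ.type.join h).2.1
      (ℓ.type.mem_child _ ⟨a, _⟩) hlt

end Magnitude

/-! ## Uniqueness of the type -/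

/-- A decreasing enumeration of a set of natural numbers is determined by the set. -/
theorem StrictAnti.fin_val_eq {m : ℕ} {g : Fin m → ℕ} (hg : StrictAnti g) (k : Fin m) :
    (k : ℕ) = {x | x ∈ Set.range g ∧ g k < x}.ncard := by
  have : {x | x ∈ Set.range g ∧ g k < x} = g '' Set.Iio k := by
    ext x
    constructor
    · rintro ⟨⟨j, rfl⟩, h⟩
      exact ⟨j, hg.lt_iff_gt.1 h, rfl⟩
    · rintro ⟨j, hj, rfl⟩
      exact ⟨⟨j, rfl⟩, hg hj⟩
  rw [this, Set.ncard_image_of_injective _ hg.injective, ← Finset.coe_Iio, Set.ncard_coe_finset]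
  simp

theorem StrictAnti.fin_card_eq {m : ℕ} {g : Fin m → ℕ} (hg : StrictAnti g) :
    m = (Set.range g).ncard := by
  rw [← Set.image_univ, Set.ncard_image_of_injective _ hg.injective, Set.ncard_univ]
  simp

namespace PopsicleType

variable {n l : ℕ} {φ : Fin l → Fin n}

/-- The set of marks beyond a vertex or edge, and which of the two it is. -/
def cellCode {T : StableTree n l} : T.Cell → Bool × Finset (Mark n l)
  | .inl v => (true, v.1)
  | .inr e => (false, e.1)

theorem cellCode_injective {T : StableTree n l} : Function.Injective (cellCode (T := T)) := by
  rintro (v | e) (v' | e') h <;> simp only [cellCode, Prod.mk.injEq] at h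
  · exact congrArg _ (Subtype.ext h.2)
  · exact absurd h.1 (by decide)
  · exact absurd h.1 (by decide)
  · exact congrArg _ (Subtype.ext h.2)

/-- The fields after `edges` live in types that depend on it. The hypotheses compare them through
underlying sets and numbers, so that no transport is needed. -/
theorem type_ext {τ τ' : PopsicleType φ} (he : τ.edges = τ'.edges)
    (hΦ : ∀ (w : τ.SphereVertex) (w' : τ'.SphereVertex), w.1 = w'.1 →
      cellCode (τ.Φ w) = cellCode (τ'.Φ w'))
    (hm : ∀ (e : τ.DiscEdge) (e' : τ'.DiscEdge), e.1 = e'.1 → τ.m e = τ'.m e')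
    (hΨ : ∀ (e : τ.DiscEdge) (e' : τ'.DiscEdge) (w : τ.SphereVertex) (w' : τ'.SphereVertex)
      (h : τ.Φ w = .inr e) (h' : τ'.Φ w' = .inr e'), e.1 = e'.1 → w.1 = w'.1 →
      (τ.Ψ e ⟨w, h⟩ : ℕ) = τ'.Ψ e' ⟨w', h'⟩) : τ = τ' := by
  obtain ⟨⟨E, _, _, _, _⟩, _, _, Φ, _, _, _, _, m, Ψ, _, _⟩ := τ
  obtain ⟨⟨E', _, _, _, _⟩, _, _, Φ', _, _, _, _, m', Ψ', _, _⟩ := τ'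
  obtain rfl : E = E' := he
  obtain rfl : Φ = Φ' := funext fun w => cellCode_injective (hΦ w w rfl)
  obtain rfl : m = m' := funext fun e => hm e e rfl
  obtain rfl : Ψ = Ψ' := funext fun e => funext fun w => Fin.ext (hΨ e e w.1 w.1 w.2 w.2 rfl rfl)
  rfl

variable {ℓ : Magnitude φ} {τ τ' : PopsicleType φ} {L : τ.Level → ℕ}
  {L' : τ'.Level → ℕ}

theorem IsOrd.le (h : τ.IsOrd ℓ L) {a b : τ.Level} (hab : τ.LevelLe a b) : L b ≤ L a := by
  rcases hab with rfl | hab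
  · exact le_rfl
  · exact (h.lt _ _ hab).le

/-- Two marks of an edge separate inside it, a mark of it and an outside mark separate strictly
before it; so edges are clusters. The tree can thus be recovered from the orders. -/
theorem IsOrd.mem_edges_iff (h : τ.IsOrd ℓ L) {Q : Finset (Mark n l)} :
    Q ∈ τ.edges ↔ ℓ.IsCluster Q := by
  constructor
  · refine fun hQ => ⟨τ.nonempty_of_mem Q hQ, fun a ha b hb c hc => ?_⟩
    have hac : a ≠ c := fun h' => hc (h' ▸ ha)
    by_cases hab : a = b
    · subst hab
      rw [ℓ.self]
      exact ℓ.pos _ _ hac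
    · rw [h.join hab, h.join hac]
      refine h.lt _ _ (vertexLevel_lt ?_)
      have h1 := τ.join_subset hab hQ ha hb
      have hn : ¬ (τ.join hac).1 ⊆ Q := fun h' => hc (h' (τ.right_mem_join hac))
      rcases τ.le_or_le (τ.join hac).2.1 hQ (τ.left_mem_join hac) ha with h2 | h2
      · exact absurd h2 hn
      · exact ⟨h1.trans h2, fun h3 => hn (h3.trans h1)⟩
  · rintro ⟨hne, hcl⟩
    obtain ⟨P, hP, hQP, hmin⟩ := τ.exists_least hne
    -- If the cluster `Q` is not an edge, the least edge `P` around it contains a mark `c` outside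
    -- `Q`, and two marks `a`, `b` of `Q` separate at `P`. Then `a` and `c` separate at `P` or
    -- later, against the cluster property.
    by_contra hQ
    obtain ⟨a, ha⟩ := hne
    have hs : Q ⊂ P := Finset.ssubset_iff_subset_ne.2 ⟨hQP, fun h' => hQ (h' ▸ hP)⟩
    obtain ⟨c, hc, hcQ⟩ := Finset.exists_of_ssubset hs
    have hac : a ≠ c := fun h' => hcQ (h' ▸ ha)
    have hcard : 2 ≤ P.card := Finset.one_lt_card.2 ⟨a, hQP ha, c, hc, hac⟩
    obtain ⟨e, he, hae⟩ := τ.exists_child hcard (hQP ha)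
    have hout := τ.mem_out.1 he
    obtain ⟨b, hb, hbe⟩ := Finset.not_subset.1 fun h' => hout.2.1.2 (hmin e hout.1 h')
    have hab : a ≠ b := fun h' => hbe (h' ▸ hae)
    have hlt := hcl a ha b hb c hcQ
    rw [h.join hab, h.join hac, τ.join_eq hab (v := ⟨P, hP, hcard⟩) he hae (hQP hb) hbe] at hlt
    exact absurd (h.le (vertexLevel_le (u := τ.join hac) (v := ⟨P, hP, hcard⟩)
      (τ.join_subset hac hP (hQP ha) hc))) (not_le.2 hlt)

theorem IsOrd.eq_of_mem (h : τ.IsOrd ℓ L) {a b : τ.Level} {x : Mark n l} (ha : x ∈ τ.levelSet a)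
    (hb : x ∈ τ.levelSet b) (hab : L a = L b) : a = b := by
  rcases levelLt_trichotomy ha hb with h1 | h1 | h1
  · exact absurd (h.lt _ _ h1) (by omega)
  · exact h1
  · exact absurd (h.lt _ _ h1) (by omega)

theorem exists_color (w : τ.SphereVertex) : ∃ f, .inr f ∈ w.1 := by
  obtain ⟨i | f, hf⟩ := τ.nonempty_of_mem _ w.2.1
  · exact absurd ⟨i, hf⟩ w.2.2.2
  · exact ⟨f, hf⟩

theorem color_mem_level (w : τ.SphereVertex) {f : Fin l} (hf : .inr f ∈ w.1) :
    .inl (φ f) ∈ τ.levelSet (τ.level w) := by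
  rw [← τ.vertexLevel_sphere]
  exact τ.color_mem_levelSet ⟨w.1, _⟩ (a := .inr f) hf

variable [NeZero n]

theorem exists_join_eq (v : τ.Vertex) : ∃ (a b : Mark n l) (h : a ≠ b), τ.join h = v := by
  have hb := τ.minMark_mem_edge (τ.base v)
  have hs := τ.ssubset_parent (τ.base v)
  rw [τ.parent_base] at hs
  obtain ⟨c, hc, hc'⟩ := Finset.exists_of_ssubset hs
  exact ⟨_, c, fun h => hc' (h ▸ hb), τ.join_eq _ (parent_eq_iff.1 (τ.parent_base v)) hb hc hc'⟩

theorem IsOrd.vertexLevel_eq (h : τ.IsOrd ℓ L) (h' : τ'.IsOrd ℓ L') {v : τ.Vertex}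
    {v' : τ'.Vertex} (hv : v.1 = v'.1) : L (τ.vertexLevel v) = L' (τ'.vertexLevel v') := by
  obtain ⟨a, b, hab, rfl⟩ := τ.exists_join_eq v
  rw [← h.join, h'.join hab]
  congr 2
  refine Subtype.ext (Finset.Subset.antisymm ?_ ?_)
  · exact τ'.join_subset hab v'.2.1 (hv ▸ τ.left_mem_join hab) (hv ▸ τ.right_mem_join hab)
  · rw [← hv]
    refine τ.join_subset hab ?_ (τ'.left_mem_join hab) (τ'.right_mem_join hab)
    rw [h.mem_edges_iff, ← h'.mem_edges_iff]
    exact (τ'.join hab).2.1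

theorem IsOrd.level_eq (h : τ.IsOrd ℓ L) (h' : τ'.IsOrd ℓ L') {w : τ.SphereVertex}
    {w' : τ'.SphereVertex} (hw : w.1 = w'.1) : L (τ.level w) = L' (τ'.level w') := by
  rw [← τ.vertexLevel_sphere, ← τ'.vertexLevel_sphere]
  exact h.vertexLevel_eq h' hw

/-- In `τ'`, the disc `v` and the level of `w'` have the same order and a color in common, so they
are the same level. But a level on an edge is not a disc. -/
theorem IsOrd.not_inl_inr (h : τ.IsOrd ℓ L) (h' : τ'.IsOrd ℓ L') {w : τ.SphereVertex}
    {w' : τ'.SphereVertex} (hw : w.1 = w'.1) {v : τ.DiscVertex} {e : τ'.DiscEdge}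
    (hv : τ.Φ w = .inl v) (he : τ'.Φ w' = .inr e) : False := by
  obtain ⟨f, hf⟩ := exists_color w
  have h1 := color_mem_level w hf
  have h2 := color_mem_level w' (hw ▸ hf)
  have h3 := h.level_eq h' hw
  have hvv : v.1 ∈ τ'.edges := by
    rw [h'.mem_edges_iff, ← h.mem_edges_iff]
    exact v.2.1
  have h4 := h.vertexLevel_eq h' (v := ⟨v.1, v.2.1, v.2.2.1⟩) (v' := ⟨v.1, hvv, v.2.2.1⟩) rfl
  rw [τ.vertexLevel_disc, τ'.vertexLevel_disc ⟨v.1, hvv, v.2.2⟩] at h4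
  rw [τ.level_eq_inl hv] at h1 h3
  have := h'.eq_of_mem (a := .inl ⟨v.1, hvv, v.2.2⟩) h1 h2 (by omega)
  rw [τ'.level_eq_inr he] at this
  cases this

/-- If `e` were strictly beyond `e'`, then `e'` would end in a disc that comes before the level of
`w` in `τ` and after the level of `w'` in `τ'`, giving opposite inequalities of orders. -/
theorem IsOrd.inr_subset (h : τ.IsOrd ℓ L) (h' : τ'.IsOrd ℓ L') {w : τ.SphereVertex}
    {w' : τ'.SphereVertex} (hw : w.1 = w'.1) {e : τ.DiscEdge} {e' : τ'.DiscEdge}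
    (he : τ.Φ w = .inr e) (he' : τ'.Φ w' = .inr e') : ¬ e.1 ⊂ e'.1 := by
  intro hs
  have h3 := h.level_eq h' hw
  have hc : 2 ≤ e'.1.card := by
    have h1 := Finset.card_lt_card hs
    have h2 := (τ.nonempty_of_mem _ e.2.1).card_pos
    omega
  have hee : e'.1 ∈ τ.edges := by
    rw [h.mem_edges_iff, ← h'.mem_edges_iff]
    exact e'.2.1
  have h4 := h.vertexLevel_eq h' (v := ⟨e'.1, hee, hc⟩) (v' := ⟨e'.1, e'.2.1, hc⟩) rfl
  rw [τ.vertexLevel_disc ⟨e'.1, hee, hc, e'.2.2⟩,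
    τ'.vertexLevel_disc ⟨e'.1, e'.2.1, hc, e'.2.2⟩] at h4
  have h5 : τ'.LevelLt (τ'.level w') (.inl ⟨e'.1, e'.2.1, hc, e'.2.2⟩) := by
    rw [τ'.level_eq_inr he']
    exact .inl (subset_rfl : e'.1 ⊆ e'.1)
  have h6 : τ.LevelLt (.inl ⟨e'.1, hee, hc, e'.2.2⟩) (τ.level w) := by
    rw [τ.level_eq_inr he]
    exact .inl hs
  have := h.lt _ _ h6
  have := h'.lt _ _ h5
  omega

/-- The type of a stable popsicle is determined by the orders of magnitude. -/
theorem IsOrd.type_eq (h : τ.IsOrd ℓ L) (h' : τ'.IsOrd ℓ L') : τ = τ' := by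
  have hedges : ∀ Q, Q ∈ τ.edges ↔ Q ∈ τ'.edges := fun Q => by
    rw [h.mem_edges_iff, h'.mem_edges_iff]
  have hΦ : ∀ (w : τ.SphereVertex) (w' : τ'.SphereVertex), w.1 = w'.1 →
      cellCode (τ.Φ w) = cellCode (τ'.Φ w') := by
    intro w w' hw
    obtain ⟨f, hf⟩ := exists_color w
    have h1 := color_mem_level w hf
    have h2 := color_mem_level w' (hw ▸ hf)
    have h3 := h.level_eq h' hw
    rcases hv : τ.Φ w with v | e <;> rcases hv' : τ'.Φ w' with v' | e'
    · have hvv : v.1 ∈ τ'.edges := (hedges _).1 v.2.1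
      have h4 := h.vertexLevel_eq h' (v := ⟨v.1, v.2.1, v.2.2.1⟩) (v' := ⟨v.1, hvv, v.2.2.1⟩) rfl
      rw [τ.vertexLevel_disc, τ'.vertexLevel_disc ⟨v.1, hvv, v.2.2⟩] at h4
      rw [τ.level_eq_inl hv] at h1 h3
      have := h'.eq_of_mem (a := .inl ⟨v.1, hvv, v.2.2⟩) h1 h2 (by omega)
      rw [τ'.level_eq_inl hv'] at this
      have := Sum.inl.inj this
      rw [← this]
      rfl
    · exact (h.not_inl_inr h' hw hv hv').elim
    · exact (h'.not_inl_inr h hw.symm hv' hv).elim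
    · rw [τ.level_eq_inr hv] at h1
      rw [τ'.level_eq_inr hv'] at h2
      have : e.1 = e'.1 := by
        by_contra hne
        rcases τ.le_or_le e.2.1 ((hedges _).2 e'.2.1) h1 h2 with hs | hs
        · exact h.inr_subset h' hw hv hv' (Finset.ssubset_iff_subset_ne.2 ⟨hs, hne⟩)
        · exact h'.inr_subset h hw.symm hv' hv
            (Finset.ssubset_iff_subset_ne.2 ⟨hs, Ne.symm hne⟩)
      simp [cellCode, this]
  -- the enumerations of the levels on an edge
  have hanti : ∀ {τ : PopsicleType φ} {L : τ.Level → ℕ}, τ.IsOrd ℓ L → ∀ e : τ.DiscEdge,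
      StrictAnti fun k : Fin (τ.m e) => L (.inr ⟨e, k⟩) := fun h e k k' hk =>
    h.lt _ _ (.inr ⟨e, k, k', hk, rfl, rfl⟩)
  -- Since `Ψ` is surjective, the orders on a string are the orders of the spheres aligned with the
  -- edge, and these agree for both types. A strictly decreasing enumeration is determined by its
  -- range.
  have hrange : ∀ {τ τ' : PopsicleType φ} {L : τ.Level → ℕ} {L' : τ'.Level → ℕ},
      τ.IsOrd ℓ L → τ'.IsOrd ℓ L' → (∀ (w : τ.SphereVertex) (w' : τ'.SphereVertex), w.1 = w'.1 →
        cellCode (τ.Φ w) = cellCode (τ'.Φ w')) → ∀ (e : τ.DiscEdge) (e' : τ'.DiscEdge),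
      e.1 = e'.1 → Set.range (fun k : Fin (τ.m e) => L (.inr ⟨e, k⟩)) ⊆
        Set.range (fun k : Fin (τ'.m e') => L' (.inr ⟨e', k⟩)) := by
    rintro τ τ' L L' h h' hΦ e e' hee _ ⟨k, rfl⟩
    obtain ⟨w, hw⟩ := τ.Ψ_surjective e k
    have hww : w.1.1 ∈ τ'.edges := by
      rw [h'.mem_edges_iff, ← h.mem_edges_iff]
      exact w.1.2.1
    have h1 := hΦ w.1 ⟨w.1.1, hww, w.1.2.2⟩ rfl
    have h2 := h.level_eq h' (w := w.1) (w' := ⟨w.1.1, hww, w.1.2.2⟩) rfl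
    rw [w.2] at h1
    have h3 : τ'.Φ ⟨w.1.1, hww, w.1.2.2⟩ = .inr e' := cellCode_injective (by
      rw [← h1]; simp [cellCode, hee])
    rw [τ.level_eq_inr w.2, τ'.level_eq_inr h3] at h2
    exact ⟨_, by rw [← hw]; exact h2.symm⟩
  have hrange' : ∀ (e : τ.DiscEdge) (e' : τ'.DiscEdge), e.1 = e'.1 →
      Set.range (fun k : Fin (τ.m e) => L (.inr ⟨e, k⟩)) =
        Set.range (fun k : Fin (τ'.m e') => L' (.inr ⟨e', k⟩)) := fun e e' hee =>
    (hrange h h' hΦ e e' hee).antisymm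
      (hrange h' h (fun w w' hw => (hΦ w' w hw.symm).symm) e' e hee.symm)
  refine type_ext (Finset.ext hedges) hΦ (fun e e' hee => ?_) fun e e' w w' hw hw' hee hww => ?_
  · rw [(hanti h e).fin_card_eq, (hanti h' e').fin_card_eq, hrange' e e' hee]
  · have h3 := h.level_eq h' hww
    rw [τ.level_eq_inr hw, τ'.level_eq_inr hw'] at h3
    rw [(hanti h e).fin_val_eq, (hanti h' e').fin_val_eq, hrange' e e' hee, h3]

end PopsicleType

/-! ## Orders of magnitude of sequences -/

section Order

variable {P : Type*} [Finite P] (D : P → ℕ → ℝ)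

/-- After passing to a subsequence, finitely many positive sequences are comparable. -/
theorem exists_order_subseq (hD : ∀ p k, 0 < D p k) : ∃ (ι : ℕ → ℕ) (ord : P → ℕ),
    StrictMono ι ∧ ∀ p q, (ord p < ord q → Tendsto (fun k => D p (ι k) / D q (ι k)) atTop (𝓝 0)) ∧
      (ord p = ord q → ∃ κ > 0, Tendsto (fun k => D p (ι k) / D q (ι k)) atTop (𝓝 κ)) := by
  classical
  have := Fintype.ofFinite P
  -- The quotients `D p / D q` may be unbounded. The fractions `D p / (D p + D q)` lie in `[0, 1]`,
  -- and a limit `1` means that `D q` is negligible against `D p`.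
  obtain ⟨z, -, ι, hι, hz⟩ := (isCompact_Icc (a := (0 : P × P → ℝ)) (b := 1)).tendsto_subseq
    (x := fun k pq => D pq.1 k / (D pq.1 k + D pq.2 k)) fun k =>
      ⟨fun pq => (div_pos (hD _ _) (add_pos (hD _ _) (hD _ _))).le,
        fun pq => (div_le_one (add_pos (hD _ _) (hD _ _))).2 (by
          have := hD pq.2 k
          linarith)⟩
  have hz' : ∀ p q, Tendsto (fun k => D p (ι k) / (D p (ι k) + D q (ι k))) atTop (𝓝 (z (p, q))) :=
    fun p q => (tendsto_pi_nhds.1 hz) (p, q)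
  let R : P → P → ℝ → Prop := fun p q x => Tendsto (fun k => D p (ι k) / D q (ι k)) atTop (𝓝 x)
  have hR : ∀ p q, z (p, q) ≠ 1 → R p q (z (p, q) / (1 - z (p, q))) := by
    intro p q hne
    refine ((hz' p q).div ((hz' p q).const_sub 1) (sub_ne_zero.2 hne.symm)).congr fun k => ?_
    have := hD p (ι k); have := hD q (ι k)
    have h1 : D p (ι k) + D q (ι k) ≠ 0 := by positivity
    have h2 : (1 : ℝ) - D p (ι k) / (D p (ι k) + D q (ι k)) =
        D q (ι k) / (D p (ι k) + D q (ι k)) := by field_simp; ring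
    simp only [Pi.div_apply]
    rw [h2, div_div_div_cancel_right₀ h1]
  have hsum : ∀ p q, z (p, q) + z (q, p) = 1 := by
    intro p q
    refine tendsto_nhds_unique ((hz' p q).add (hz' q p)) ?_
    refine tendsto_const_nhds.congr fun k => ?_
    have := hD p (ι k); have := hD q (ι k)
    have h1 : D p (ι k) + D q (ι k) ≠ 0 := by positivity
    rw [add_comm (D q (ι k)), ← add_div, div_self h1]
  have hnn : ∀ p q, 0 ≤ z (p, q) := fun p q => ge_of_tendsto' (hz' p q) fun k =>
    (div_pos (hD _ _) (add_pos (hD _ _) (hD _ _))).le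
  have htri : ∀ p q, R p q 0 ∨ R q p 0 ∨ ∃ κ > 0, R p q κ := by
    intro p q
    by_cases h0 : z (p, q) = 0
    · left
      have := hR p q (by rw [h0]; norm_num)
      rwa [h0, zero_div] at this
    by_cases h1 : z (p, q) = 1
    · right; left
      have h2 : z (q, p) = 0 := by have := hsum p q; linarith
      have := hR q p (by rw [h2]; norm_num)
      rwa [h2, zero_div] at this
    · right; right
      refine ⟨_, ?_, hR p q h1⟩
      have h2 := hsum p q
      have h3 := hnn q p
      have h4 : 0 < z (p, q) := lt_of_le_of_ne (hnn p q) (Ne.symm h0)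
      have h5 : z (p, q) < 1 := lt_of_le_of_ne (by linarith) h1
      exact div_pos h4 (by linarith)
  have hmul : ∀ {p q r x y}, R p q x → R q r y → R p r (x * y) := by
    intro p q r x y h h'
    refine (h.mul h').congr fun k => ?_
    have := (hD q (ι k)).ne'
    field_simp
  have hinv : ∀ {p q x}, x ≠ 0 → R p q x → R q p x⁻¹ := by
    intro p q x hx h
    refine (h.inv₀ hx).congr fun k => inv_div _ _
  have hself : ∀ p, R p p 1 := fun p => tendsto_const_nhds.congr fun k =>
    (div_self (hD p (ι k)).ne').symm
  -- The order of `p` is the number of sequences that are negligible against it.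
  let ord : P → ℕ := fun p => (Finset.univ.filter fun q => R q p 0).card
  have hlt : ∀ {p q}, R p q 0 → ord p < ord q := by
    intro p q h
    refine Finset.card_lt_card (Finset.ssubset_iff_of_subset ?_ |>.2 ⟨p, by simpa using h, ?_⟩)
    · intro r hr
      simp only [Finset.mem_filter, Finset.mem_univ, true_and] at hr ⊢
      have := hmul hr h
      rwa [zero_mul] at this
    · simp only [Finset.mem_filter, Finset.mem_univ, true_and]
      exact fun h' => zero_ne_one (tendsto_nhds_unique h' (hself p))
  have heq : ∀ {p q κ}, 0 < κ → R p q κ → ord p = ord q := by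
    intro p q κ hκ h
    refine congrArg Finset.card (Finset.filter_congr fun r _ => ⟨fun hr => ?_, fun hr => ?_⟩)
    · have := hmul hr h
      rwa [zero_mul] at this
    · have := hmul hr (hinv hκ.ne' h)
      rwa [zero_mul] at this
  refine ⟨ι, ord, hι, fun p q => ⟨fun h => ?_, fun h => ?_⟩⟩
  · rcases htri p q with h' | h' | ⟨κ, hκ, h'⟩
    · exact h'
    · exact absurd (hlt h') (by omega)
    · exact absurd (heq hκ h') (by omega)
  · rcases htri p q with h' | h' | h'
    · exact absurd (hlt h') (by omega)
    · exact absurd (hlt h') (by omega)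
    · exact h'

end Order

section MarkDist

variable {n l : ℕ} (φ : Fin l → Fin n)

/-- The distance of two marked points. -/
noncomputable def markDist (u : (Fin n → ℝ) × (Fin l → ℝ)) (a b : Mark n l) : ℝ :=
  |PopsicleType.pos φ u true a - PopsicleType.pos φ u true b| +
    |PopsicleType.pos φ u false a - PopsicleType.pos φ u false b|

variable {φ} {u : (Fin n → ℝ) × (Fin l → ℝ)}

theorem markDist_self (a : Mark n l) : markDist φ u a a = 0 := by simp [markDist]

theorem markDist_comm (a b : Mark n l) : markDist φ u a b = markDist φ u b a := by
  rw [markDist, markDist, abs_sub_comm, abs_sub_comm (PopsicleType.pos φ u false a)]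

theorem markDist_triangle (a b c : Mark n l) :
    markDist φ u a c ≤ markDist φ u a b + markDist φ u b c := by
  unfold markDist
  have h1 := abs_sub_le (PopsicleType.pos φ u true a) (PopsicleType.pos φ u true b)
    (PopsicleType.pos φ u true c)
  have h2 := abs_sub_le (PopsicleType.pos φ u false a) (PopsicleType.pos φ u false b)
    (PopsicleType.pos φ u false c)
  linarith

theorem markDist_color (a b : Mark n l) :
    markDist φ u (.inl (markColor φ a)) (.inl (markColor φ b)) ≤ markDist φ u a b := by
  simp [markDist, PopsicleType.pos, markColor]

theorem markDist_inl (i j : Fin n) :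
    markDist φ u (.inl i) (.inl j) = |u.1 i - u.1 j| := by
  simp [markDist, PopsicleType.pos, markColor]

theorem markDist_pos (hu : u ∈ planarPopsicles φ) {a b : Mark n l} (h : a ≠ b) :
    0 < markDist φ u a b := by
  obtain ⟨h1, h2, h3⟩ := hu
  have hx : 0 ≤ |PopsicleType.pos φ u true a - PopsicleType.pos φ u true b| := abs_nonneg _
  have hy : 0 ≤ |PopsicleType.pos φ u false a - PopsicleType.pos φ u false b| := abs_nonneg _
  rcases a with i | f <;> rcases b with j | g
  · rw [markDist_inl, abs_pos, sub_ne_zero]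
    exact fun h' => h (congrArg _ (h1.injective h'))
  · refine add_pos_of_nonneg_of_pos hx (abs_pos.2 ?_)
    simpa [PopsicleType.pos] using (h2 g).ne'
  · refine add_pos_of_nonneg_of_pos hx (abs_pos.2 ?_)
    simpa [PopsicleType.pos] using (h2 f).ne'
  · by_cases hφ : φ f = φ g
    · refine add_pos_of_nonneg_of_pos hx (abs_pos.2 (sub_ne_zero.2 ?_))
      exact h3 f g (fun h' => h (congrArg _ h')) hφ
    · refine add_pos_of_pos_of_nonneg (abs_pos.2 (sub_ne_zero.2 ?_)) hy
      exact fun h' => hφ (h1.injective h')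

/-- The orders of magnitude are those of the distances in a sequence. -/
structure Adapted (ℓ : Magnitude φ) (u : ℕ → (Fin n → ℝ) × (Fin l → ℝ)) : Prop where
  lt : ∀ a b c d, ℓ.ord a b < ℓ.ord c d →
    Tendsto (fun k => markDist φ (u k) a b / markDist φ (u k) c d) atTop (𝓝 0)
  eq : ∀ a b c d, a ≠ b → ℓ.ord a b = ℓ.ord c d → ∃ κ > 0,
    Tendsto (fun k => markDist φ (u k) a b / markDist φ (u k) c d) atTop (𝓝 κ)

/-- An inequality between two distances that holds for all popsicles passes to their orders
(`hmono`); this gives all the axioms of `Magnitude` except the ultrametric inequality and the two on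
the diagonal. -/
theorem exists_adapted {u : ℕ → (Fin n → ℝ) × (Fin l → ℝ)} (hu : ∀ k, u k ∈ planarPopsicles φ) :
    ∃ (ι : ℕ → ℕ) (ℓ : Magnitude φ), StrictMono ι ∧ Adapted ℓ (u ∘ ι) := by
  obtain ⟨ι, ord, hι, h⟩ := exists_order_subseq
    (P := {q : Mark n l × Mark n l // q.1 ≠ q.2}) (fun q k => markDist φ (u k) q.1.1 q.1.2)
    fun q k => markDist_pos (hu k) q.2
  -- The shift by one reserves the order `0` for equal marks.
  obtain ⟨o, ho, ho'⟩ : ∃ o : Mark n l → Mark n l → ℕ,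
      (∀ a b, ∀ h : a ≠ b, o a b = ord ⟨(a, b), h⟩ + 1) ∧ ∀ a, o a a = 0 :=
    ⟨fun a b => if h : a ≠ b then ord ⟨(a, b), h⟩ + 1 else 0, fun a b h => dif_pos h,
      fun a => dif_neg (by simp)⟩
  have hne : ∀ {a b}, 0 < o a b → a ≠ b := by
    rintro a b h rfl
    rw [ho'] at h
    omega
  have hlt : ∀ a b c d, o a b < o c d → Tendsto (fun k => markDist φ (u (ι k)) a b /
      markDist φ (u (ι k)) c d) atTop (𝓝 0) := by
    intro a b c d hlt
    have hcd := hne ((Nat.zero_le _).trans_lt hlt)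
    by_cases hab : a = b
    · subst hab
      simp [markDist_self]
    · rw [ho a b hab, ho c d hcd] at hlt
      exact (h ⟨(a, b), hab⟩ ⟨(c, d), hcd⟩).1 (Nat.lt_of_succ_lt_succ hlt)
  have hdiv : ∀ {a b} (k) (_ : a ≠ b) {x : ℝ}, markDist φ (u (ι k)) a b ≤ x →
      1 ≤ x / markDist φ (u (ι k)) a b := fun k hab _ hx =>
    (one_le_div (markDist_pos (hu _) hab)).2 hx
  have hmono : ∀ a b c d, (∀ k, markDist φ (u k) a b ≤ markDist φ (u k) c d) →
      o a b ≤ o c d := by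
    intro a b c d hle
    by_contra! hlt'
    have hab := hne ((Nat.zero_le _).trans_lt hlt')
    have := ge_of_tendsto' (hlt _ _ _ _ hlt') fun k => hdiv k hab (hle _)
    norm_num at this
  refine ⟨ι, ⟨o, ho', fun a b hab => by rw [ho a b hab]; omega, fun a b => ?_, fun a b c => ?_,
    fun a b => hmono _ _ _ _ fun k => markDist_color a b, fun i j m hij hjm => ?_⟩, hι,
    ⟨hlt, fun a b c d hab hord => ?_⟩⟩
  · exact le_antisymm (hmono _ _ _ _ fun k => (markDist_comm _ _).le)
      (hmono _ _ _ _ fun k => (markDist_comm _ _).le)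
  · by_contra! hlt'
    rw [max_lt_iff] at hlt'
    have hac := hne ((Nat.zero_le _).trans_lt hlt'.1)
    -- If both distances to `b` were negligible against that of `a` and `c`, the triangle inequality
    -- divided by the latter would give `1 ≤ 0` in the limit.
    have h1 := (hlt _ _ _ _ hlt'.1).add (hlt _ _ _ _ hlt'.2)
    have := ge_of_tendsto' h1 fun k => (hdiv k hac (markDist_triangle a b c)).trans_eq (add_div _ _ _)
    norm_num at this
  · refine hmono _ _ _ _ fun k => ?_
    rw [markDist_inl, markDist_inl]
    have h1 := (hu k).1.monotone hij
    have h2 := (hu k).1.monotone hjm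
    rw [abs_sub_comm, abs_of_nonneg (by linarith), abs_sub_comm, abs_of_nonneg (by linarith)]
    linarith
  · change o a b = o c d at hord
    have hcd : c ≠ d := hne (by rw [← hord, ho a b hab]; omega)
    rw [ho a b hab, ho c d hcd] at hord
    exact (h ⟨(a, b), hab⟩ ⟨(c, d), hcd⟩).2 (Nat.succ_injective hord)

end MarkDist

section Adapted

variable {n l : ℕ} {φ : Fin l → Fin n} {ℓ : Magnitude φ} {u : ℕ → (Fin n → ℝ) × (Fin l → ℝ)}

theorem Adapted.eq_of_tendsto (h : Adapted ℓ u) (hu : ∀ k, u k ∈ planarPopsicles φ)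
    {a b c d : Mark n l} (hab : a ≠ b) (hcd : c ≠ d) {κ : ℝ} (hκ : 0 < κ)
    (hlim : Tendsto (fun k => markDist φ (u k) a b / markDist φ (u k) c d) atTop (𝓝 κ)) :
    ℓ.ord a b = ℓ.ord c d := by
  rcases lt_trichotomy (ℓ.ord a b) (ℓ.ord c d) with hlt | heq | hlt
  · exact absurd (tendsto_nhds_unique (h.lt _ _ _ _ hlt) hlim) hκ.ne
  · exact heq
  · have := (h.lt _ _ _ _ hlt).mul hlim
    rw [zero_mul] at this
    refine absurd (tendsto_nhds_unique (tendsto_const_nhds.congr fun k => ?_) this) one_ne_zero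
    have := (markDist_pos (hu k) hab).ne'; have := (markDist_pos (hu k) hcd).ne'
    field_simp

theorem Adapted.lt_of_tendsto (h : Adapted ℓ u) (hu : ∀ k, u k ∈ planarPopsicles φ)
    {a b c d : Mark n l} (hab : a ≠ b) (hcd : c ≠ d)
    (hlim : Tendsto (fun k => markDist φ (u k) a b / markDist φ (u k) c d) atTop (𝓝 0)) :
    ℓ.ord a b < ℓ.ord c d := by
  rcases lt_trichotomy (ℓ.ord a b) (ℓ.ord c d) with hlt | heq | hlt
  · exact hlt
  · obtain ⟨κ, hκ, hlim'⟩ := h.eq _ _ _ _ hab heq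
    exact absurd (tendsto_nhds_unique hlim' hlim) hκ.ne'
  · have := (h.lt _ _ _ _ hlt).mul hlim
    rw [zero_mul] at this
    refine absurd (tendsto_nhds_unique (tendsto_const_nhds.congr fun k => ?_) this) one_ne_zero
    have := (markDist_pos (hu k) hab).ne'; have := (markDist_pos (hu k) hcd).ne'
    field_simp

end Adapted

/-! ### Uniqueness of limits -/

namespace PopsicleType

variable {n l : ℕ} {φ : Fin l → Fin n} {τ : PopsicleType φ}

theorem exists_vertexLevel (a : τ.Level) : ∃ v, τ.vertexLevel v = a := by
  rcases a with v | ⟨e, k⟩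
  · exact ⟨_, τ.vertexLevel_disc v⟩
  · obtain ⟨w, rfl⟩ := τ.Ψ_surjective e k
    exact ⟨_, (τ.vertexLevel_sphere w.1).trans (τ.level_eq_inr w.2)⟩

/-- Two marks on different outgoing edges of a vertex are separated there. -/
theorem join_eq_parent {e e' : τ.Edge'} (hp : τ.parent e = τ.parent e') (hne : e ≠ e')
    {a b : Mark n l} (ha : a ∈ e.1) (hb : b ∈ e'.1) : ∃ h : a ≠ b, τ.join h = τ.parent e := by
  have hbe : b ∉ e.1 := fun h => hne (Subtype.ext (τ.child_unique (mem_out_parent e)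
    (parent_eq_iff.1 hp.symm) h hb))
  refine ⟨fun h => hbe (h ▸ ha), τ.join_eq _ (mem_out_parent e) ha ?_ hbe⟩
  rw [hp]
  exact (τ.ssubset_parent e').1 hb

theorem divisible_join {a b : Mark n l} (h : a ≠ b) (B : Bool) :
    τ.Divisible (τ.vertexLevel (τ.join h)) B a b := by
  rcases B with _ | _
  · exact divisible_of_mem (B := false) (τ.left_mem_join h) (τ.right_mem_join h) (LevelLe.refl _)
  · exact divisible_of_mem_levelSet (τ.color_mem_levelSet _ (τ.left_mem_join h))
      (τ.color_mem_levelSet _ (τ.right_mem_join h))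

variable [NeZero n]

theorem exists_join_level (a : τ.Level) :
    ∃ q : {q : Mark n l × Mark n l // q.1 ≠ q.2}, τ.vertexLevel (τ.join q.2) = a := by
  obtain ⟨v, rfl⟩ := exists_vertexLevel a
  obtain ⟨p, q, h, rfl⟩ := exists_join_eq v
  exact ⟨⟨(p, q), h⟩, rfl⟩

theorem anchor_minMark_mem (e : τ.Edge') :
    anchor φ (decide (IsDisc e.1)) (minMark e.1) ∈ e.1 := by
  have he := τ.minMark_mem_edge e
  by_cases h : IsDisc e.1
  · obtain ⟨i, hi⟩ := h.exists_minMark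
    rw [hi] at he ⊢
    simpa [anchor, h, markColor] using he
  · simpa [anchor, h] using he

theorem iso_toConf {c c' : τ.Edge' → ℝ} (hc : c ∈ τ.edgeConf) (hc' : c' ∈ τ.edgeConf)
    {s : τ.Level → ℝ} (hs : ∀ a, 0 < s a)
    (h : ∀ e, c' e = s (τ.vertexLevel (τ.parent e)) * c e) :
    τ.Iso (toConf c hc) (toConf c' hc') := by
  refine ⟨s, 0, 0, hs, fun v d hd => ?_, fun v e he => ?_, fun w e he => ?_⟩
  · have hp := parent_eq_iff (v := ⟨v.1, v.2.1, v.2.2.1⟩) (e := ⟨d.1, d.2.1, d.2.2.1⟩) |>.2 hd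
    have := h ⟨d.1, d.2.1, d.2.2.1⟩
    rw [hp, τ.vertexLevel_disc] at this
    exact this.trans (add_zero _).symm
  · have hp := parent_eq_iff (v := ⟨v.1, v.2.1, v.2.2.1⟩)
      (e := ⟨e.1, e.2.1, ne_univ_of_not_isDisc e.2.2⟩) |>.2 he
    have := h ⟨e.1, e.2.1, ne_univ_of_not_isDisc e.2.2⟩
    rwa [hp, τ.vertexLevel_disc] at this
  · have hp := parent_eq_iff (v := ⟨w.1, w.2.1, w.2.2.1⟩)
      (e := ⟨e.1, e.2.1, ne_univ_of_not_isDisc e.2.2⟩) |>.2 he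
    have := h ⟨e.1, e.2.1, ne_univ_of_not_isDisc e.2.2⟩
    rw [hp, τ.vertexLevel_sphere] at this
    exact this.trans (add_zero _).symm

variable [Fact (2 ≤ n + l)]

variable (τ) in
/-- The limit of the distance of two marks, divided by the scale of the level at which they
separate. -/
noncomputable def limitDist (c : τ.Edge' → ℝ) (q : {q : Mark n l × Mark n l // q.1 ≠ q.2}) : ℝ :=
  |τ.quot (τ.vertexLevel (τ.join q.2)) c τ.rootRatio true q.1.1 q.1.2| +
    |τ.quot (τ.vertexLevel (τ.join q.2)) c τ.rootRatio false q.1.1 q.1.2|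

theorem limitDist_pos {c : τ.Edge' → ℝ} (hc : c ∈ τ.edgeConf)
    (q : {q : Mark n l × Mark n l // q.1 ≠ q.2}) : 0 < τ.limitDist c q := by
  obtain ⟨⟨a, b⟩, h⟩ := q
  unfold limitDist
  by_contra! hle
  have h1 := abs_nonneg (τ.quot (τ.vertexLevel (τ.join h)) c τ.rootRatio true a b)
  have h2 := abs_nonneg (τ.quot (τ.vertexLevel (τ.join h)) c τ.rootRatio false a b)
  have h3 : τ.quot (τ.vertexLevel (τ.join h)) c τ.rootRatio true a b = 0 :=
    abs_eq_zero.1 (by linarith)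
  have h4 : τ.quot (τ.vertexLevel (τ.join h)) c τ.rootRatio false a b = 0 :=
    abs_eq_zero.1 (by linarith)
  -- The boundary point used for comparison is the color of `b`: the offset of `b` from it is zero,
  -- and that of `a` is the horizontal difference of `a` and `b`.
  refine quot_ne_zero hc rootRatio_eq_zero _ _ (τ.child_join_ne h)
    (τ.color_mem_levelSet _ (τ.right_mem_join h)) ?_ ?_ h4
  · rw [← h3]
    simp [quot, coeff, anchor, markColor]
  · simp [quot, coeff, anchor, markColor]

section

variable {α : Type*} {F : Filter α} {u : α → (Fin n → ℝ) × (Fin l → ℝ)} {c : τ.Edge' → ℝ}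
  {d : α → τ.Edge' → ℝ} {r : α → τ.Level → ℝ} {S : α → ℝ}

theorem tendsto_markDist (h : ∀ᶠ k in F, 0 < S k ∧ (∀ a, 0 < r k a) ∧
    τ.Represents (u k) (d k) fun a => S k * τ.scale (r k) a) (hd : Tendsto d F (𝓝 c))
    (hr : Tendsto r F (𝓝 τ.rootRatio)) (q : {q : Mark n l × Mark n l // q.1 ≠ q.2}) :
    Tendsto (fun k => markDist φ (u k) q.1.1 q.1.2 /
      (S k * τ.scale (r k) (τ.vertexLevel (τ.join q.2)))) F (𝓝 (τ.limitDist c q)) := by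
  refine ((tendsto_quot h hd hr (divisible_join q.2 true)).abs.add
    (tendsto_quot h hd hr (divisible_join q.2 false)).abs).congr' ?_
  filter_upwards [h] with k hk
  rw [abs_div, abs_div, ← add_div, abs_of_pos (mul_pos hk.1 (scale_pos hk.2.1 _))]
  rfl

end

variable {u : ℕ → (Fin n → ℝ) × (Fin l → ℝ)}

/-- The scale of a level is comparable to the distance of any two marks that separate there, by
`limitDist_pos`. So the observed order of one such pair is the order of the level, whichever pair is
chosen. -/
theorem Approximates.exists_isOrd {c : τ.Edge' → ℝ} (h : τ.Approximates atTop u c)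
    (hc : c ∈ τ.edgeConf) (hu : ∀ k, u k ∈ planarPopsicles φ) {ℓ : Magnitude φ}
    (hℓ : Adapted ℓ u) : ∃ L, τ.IsOrd ℓ L := by
  obtain ⟨d, r, S, h, hd, hr⟩ := h
  choose P hP using exists_join_level (τ := τ)
  have hpos : ∀ a : τ.Level, ∀ᶠ k in atTop, 0 < S k * τ.scale (r k) a := fun a => by
    filter_upwards [h] with k hk using mul_pos hk.1 (scale_pos hk.2.1 _)
  refine ⟨fun a => ℓ.ord (P a).1.1 (P a).1.2, fun a b hab => ?_, fun {a b} hab => ?_⟩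
  · refine hℓ.lt_of_tendsto hu (P b).2 (P a).2 ?_
    have h1 := tendsto_markDist h hd hr (P a)
    have h2 := tendsto_markDist h hd hr (P b)
    have h3 := tendsto_scale_div (h.mono fun k hk => ⟨hk.1, hk.2.1⟩) hr hab
    rw [hP] at h1 h2
    have := (h2.mul h3).div h1 (limitDist_pos hc _).ne'
    rw [mul_zero, zero_div] at this
    refine this.congr' ?_
    filter_upwards [hpos a, hpos b] with k ha hb
    have := markDist_pos (hu k) (P a).2
    simp only [Pi.div_apply]
    generalize S k * τ.scale (r k) a = x at *
    generalize S k * τ.scale (r k) b = y at *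
    field_simp
  · refine hℓ.eq_of_tendsto hu hab (P _).2 (div_pos (limitDist_pos hc ⟨(a, b), hab⟩)
      (limitDist_pos hc (P (τ.vertexLevel (τ.join hab))))) ?_
    have h1 := tendsto_markDist h hd hr ⟨(a, b), hab⟩
    have h2 := tendsto_markDist h hd hr (P (τ.vertexLevel (τ.join hab)))
    rw [hP] at h2
    refine (h1.div h2 (limitDist_pos hc _).ne').congr' ?_
    filter_upwards [hpos (τ.vertexLevel (τ.join hab))] with k ha
    simp only [Pi.div_apply]
    rw [div_div_div_cancel_right₀ ha.ne']

/-- The limit coordinates are unique up to rescaling the levels. -/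
theorem Approximates.exists_smul {c c' : τ.Edge' → ℝ} (h : τ.Approximates atTop u c)
    (h' : τ.Approximates atTop u c') (hc : c ∈ τ.edgeConf) (hc' : c' ∈ τ.edgeConf)
    (hn : τ.Normalized c) (hn' : τ.Normalized c') (hu : ∀ k, u k ∈ planarPopsicles φ) :
    ∃ s : τ.Level → ℝ, (∀ a, 0 < s a) ∧ ∀ e, c' e = s (τ.vertexLevel (τ.parent e)) * c e := by
  obtain ⟨d, r, S, h, hd, hr⟩ := h
  obtain ⟨d', r', S', h', hd', hr'⟩ := h'
  choose P hP using exists_join_level (τ := τ)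
  have hpos : ∀ a : τ.Level, ∀ᶠ k in atTop, 0 < S k * τ.scale (r k) a := fun a => by
    filter_upwards [h] with k hk using mul_pos hk.1 (scale_pos hk.2.1 _)
  have hpos' : ∀ a : τ.Level, ∀ᶠ k in atTop, 0 < S' k * τ.scale (r' k) a := fun a => by
    filter_upwards [h'] with k hk using mul_pos hk.1 (scale_pos hk.2.1 _)
  -- Both scales of a level are comparable to the distance of one and the same pair of marks. The
  -- limit of their quotient is the rescaling factor.
  have hs : ∀ a : τ.Level, Tendsto (fun k => (S k * τ.scale (r k) a) / (S' k * τ.scale (r' k) a))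
      atTop (𝓝 (τ.limitDist c' (P a) / τ.limitDist c (P a))) := by
    intro a
    have h1 := tendsto_markDist h hd hr (P a)
    have h2 := tendsto_markDist h' hd' hr' (P a)
    rw [hP] at h1 h2
    refine (h2.div h1 (limitDist_pos hc _).ne').congr' ?_
    filter_upwards [hpos a, hpos' a] with k ha hb
    have := markDist_pos (hu k) (P a).2
    simp only [Pi.div_apply]
    generalize S k * τ.scale (r k) a = x at *
    generalize S' k * τ.scale (r' k) a = y at *
    field_simp
  refine ⟨fun a => τ.limitDist c' (P a) / τ.limitDist c (P a),
    fun a => div_pos (limitDist_pos hc' _) (limitDist_pos hc _), fun e => ?_⟩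
  have he := anchor_minMark_mem e
  have h1 := tendsto_quot h hd hr (divisible_minMark e he)
  have h2 := tendsto_quot h' hd' hr' (divisible_minMark e he)
  rw [quot_minMark hn e he] at h1
  rw [quot_minMark hn' e he] at h2
  refine tendsto_nhds_unique h2 (((hs _).mul h1).congr' ?_)
  filter_upwards [hpos (τ.vertexLevel (τ.parent e)), hpos' (τ.vertexLevel (τ.parent e))]
    with k ha hb
  generalize S k * τ.scale (r k) (τ.vertexLevel (τ.parent e)) = x at *
  generalize S' k * τ.scale (r' k) (τ.vertexLevel (τ.parent e)) = y at *
  field_simp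

end PopsicleType

namespace StablePopsicle

open PopsicleType

variable {n l : ℕ} {φ : Fin l → Fin n} {u : ℕ → (Fin n → ℝ) × (Fin l → ℝ)}

theorem IsLimit.comp {p : StablePopsicle φ} (h : IsLimit u p) {ι : ℕ → ℕ}
    (hι : Tendsto ι atTop atTop) : IsLimit (u ∘ ι) p :=
  h.imp fun _ hc => ⟨hc.1, hc.2.comp hι⟩

theorem IsLimit.exists_conf {p : StablePopsicle φ} (h : IsLimit u p) :
    ∃ c : p.type.Conf, p = p.type.toStablePopsicle c ∧ p.type.GromovConverges u c := by
  obtain ⟨c, hc, h⟩ := h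
  refine ⟨c, ?_, h⟩
  unfold toStablePopsicle
  rw [hc]

variable [NeZero n] [Fact (2 ≤ n + l)]

/-- Both types carry the orders of magnitude of the sequence, so they are equal by `IsOrd.type_eq`;
then the normalized limit coordinates differ by a rescaling of the levels, which is an isomorphism.
-/
theorem toStablePopsicle_eq_of_adapted {τ τ' : PopsicleType φ} {c : τ.Conf} {c' : τ'.Conf}
    (hc : τ.GromovConverges u c) (hc' : τ'.GromovConverges u c')
    (hu : ∀ k, u k ∈ planarPopsicles φ) {ℓ : Magnitude φ} (hℓ : Adapted ℓ u) :
    τ.toStablePopsicle c = τ'.toStablePopsicle c' := by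
  have hm := normal_mem (coordEquiv_mem c.2)
  have hm' := normal_mem (coordEquiv_mem c'.2)
  obtain ⟨L, hL⟩ := hc.approximates.exists_isOrd hm hu hℓ
  obtain ⟨L', hL'⟩ := hc'.approximates.exists_isOrd hm' hu hℓ
  obtain rfl := hL.type_eq hL'
  obtain ⟨s, hs, h⟩ := hc.approximates.exists_smul hc'.approximates hm hm' (normalized_normal _)
    (normalized_normal _) hu
  refine congrArg (StablePopsicle.mk τ) (Quotient.sound ?_)
  exact τ.iso_equivalence.trans (iso_normal c) (τ.iso_equivalence.trans (iso_toConf hm hm' hs h)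
    (τ.iso_equivalence.symm (iso_normal c')))

theorem IsLimit.unique {p q : StablePopsicle φ} (hu : ∀ k, u k ∈ planarPopsicles φ)
    (hp : IsLimit u p) (hq : IsLimit u q) : p = q := by
  obtain ⟨ι, ℓ, hι, hℓ⟩ := exists_adapted hu
  obtain ⟨c, hpc, hc⟩ := (hp.comp hι.tendsto_atTop).exists_conf
  obtain ⟨c', hqc, hc'⟩ := (hq.comp hι.tendsto_atTop).exists_conf
  rw [hpc, hqc]
  exact toStablePopsicle_eq_of_adapted hc hc' (fun k => hu _) hℓ

end StablePopsicle

/-! ### Existence of limits -/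

namespace PopsicleType

variable {n l : ℕ} {φ : Fin l → Fin n} {τ : PopsicleType φ}

/-- Scales that are comparable to the distances of marks. -/
structure Comparable (τ : PopsicleType φ) (u : ℕ → (Fin n → ℝ) × (Fin l → ℝ))
    (s : τ.Level → ℕ → ℝ) : Prop where
  positive : ∀ a k, 0 < s a k
  lt : ∀ a a', τ.LevelLt a a' → Tendsto (fun k => s a' k / s a k) atTop (𝓝 0)
  dist : ∀ q : {q : Mark n l × Mark n l // q.1 ≠ q.2}, ∃ κ > 0,
    Tendsto (fun k => markDist φ (u k) q.1.1 q.1.2 / s (τ.vertexLevel (τ.join q.2)) k)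
      atTop (𝓝 κ)

variable {u : ℕ → (Fin n → ℝ) × (Fin l → ℝ)} {s : τ.Level → ℕ → ℝ}

theorem Comparable.comp (h : τ.Comparable u s) {ι : ℕ → ℕ} (hι : Tendsto ι atTop atTop) :
    τ.Comparable (u ∘ ι) fun a => s a ∘ ι :=
  ⟨fun a _ => h.positive a _, fun a a' ha => (h.lt a a' ha).comp hι, fun q =>
    (h.dist q).imp fun _ hκ => ⟨hκ.1, hκ.2.comp hι⟩⟩

/-- The distances of marks that separate at a later level are small. -/
theorem Comparable.tendsto_zero (h : τ.Comparable u s) {a : τ.Level}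
    {q : {q : Mark n l × Mark n l // q.1 ≠ q.2}}
    (hq : τ.LevelLt a (τ.vertexLevel (τ.join q.2))) :
    Tendsto (fun k => markDist φ (u k) q.1.1 q.1.2 / s a k) atTop (𝓝 0) := by
  obtain ⟨κ, -, hκ⟩ := h.dist q
  have := hκ.mul (h.lt _ _ hq)
  rw [mul_zero] at this
  refine this.congr fun k => ?_
  have := (h.positive (τ.vertexLevel (τ.join q.2)) k).ne'
  field_simp

variable [NeZero n]

theorem abs_gap_le (u : (Fin n → ℝ) × (Fin l → ℝ)) (e : τ.Edge') :
    |τ.gap u e| ≤ markDist φ u (minMark e.1) (minMark (τ.parent e).1) := by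
  unfold gap markDist
  rcases decide (IsDisc e.1) with _ | _
  · exact le_add_of_nonneg_left (abs_nonneg _)
  · exact le_add_of_nonneg_right (abs_nonneg _)

/-- The distance of one chosen pair of marks that separates at a level serves as its scale. -/
theorem IsOrd.comparable {ℓ : Magnitude φ} {L : τ.Level → ℕ} (hL : τ.IsOrd ℓ L)
    (hℓ : Adapted ℓ u) (hu : ∀ k, u k ∈ planarPopsicles φ) : ∃ s, τ.Comparable u s := by
  choose P hP using exists_join_level (τ := τ)
  have hord : ∀ a, ℓ.ord (P a).1.1 (P a).1.2 = L a := fun a => by rw [hL.join (P a).2, hP]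
  refine ⟨fun a k => markDist φ (u k) (P a).1.1 (P a).1.2, fun a k => markDist_pos (hu k) (P a).2,
    fun a a' ha => hℓ.lt _ _ _ _ ?_, fun q => hℓ.eq _ _ _ _ q.2 ?_⟩
  · rw [hord, hord]
    exact hL.lt _ _ ha
  · rw [hord, hL.join q.2]

theorem Comparable.exists_bound (h : τ.Comparable u s) :
    ∃ M : ℝ, ∀ k e, |τ.gap (u k) e / s (τ.vertexLevel (τ.parent e)) k| ≤ M := by
  have : ∀ e : τ.Edge', ∃ M, ∀ k, |τ.gap (u k) e / s (τ.vertexLevel (τ.parent e)) k| ≤ M := by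
    intro e
    by_cases hb : minMark e.1 = minMark (τ.parent e).1
    · refine ⟨0, fun k => ?_⟩
      rw [gap, hb]
      simp
    · have hj : τ.join hb = τ.parent e := τ.join_eq hb (mem_out_parent e) (τ.minMark_mem_edge e)
        (τ.minMark_mem_vertex _) fun h' => hb (minMark_eq_of_subset (τ.ssubset_parent e).1 h')
      obtain ⟨κ, -, hκ⟩ := h.dist ⟨(_, _), hb⟩
      obtain ⟨M, hM⟩ := hκ.bddAbove_range
      refine ⟨M, fun k => ?_⟩
      rw [abs_div, abs_of_pos (h.positive _ _)]
      have : markDist φ (u k) (minMark e.1) (minMark (τ.parent e).1) /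
          s (τ.vertexLevel (τ.join hb)) k ≤ M := hM ⟨k, rfl⟩
      rw [hj] at this
      exact (div_le_div_of_nonneg_right (abs_gap_le _ _) (h.positive _ _).le).trans this
  choose M hM using this
  obtain ⟨M', hM'⟩ := (Set.finite_range M).bddAbove
  exact ⟨M', fun k e => (hM e k).trans (hM' ⟨e, rfl⟩)⟩

theorem Comparable.exists_tendsto (h : τ.Comparable u s) : ∃ (ι : ℕ → ℕ) (c : τ.Edge' → ℝ),
    StrictMono ι ∧ Tendsto (fun k e => τ.gap (u (ι k)) e / s (τ.vertexLevel (τ.parent e)) (ι k))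
      atTop (𝓝 c) := by
  obtain ⟨M, hM⟩ := h.exists_bound
  obtain ⟨c, -, ι, hι, hc⟩ := (isCompact_Icc (a := fun _ : τ.Edge' => -M)
    (b := fun _ => M)).tendsto_subseq (x := fun k e => τ.gap (u k) e /
      s (τ.vertexLevel (τ.parent e)) k) fun k =>
      ⟨fun e => (abs_le.1 (hM k e)).1, fun e => (abs_le.1 (hM k e)).2⟩
  exact ⟨ι, c, hι, hc⟩

variable [Fact (2 ≤ n + l)]

/-- Limits of coordinates could violate the strict conditions of `confSet`. They do not, because the
distance of two marks, divided by the scale of the level where they separate, has a positive limit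
`κ`, and in each condition `κ` is the quantity that must not vanish. -/
theorem Comparable.mem_edgeConf (h : τ.Comparable u s) (hu : ∀ k, u k ∈ planarPopsicles φ)
    {c : τ.Edge' → ℝ}
    (hc : Tendsto (fun k e => τ.gap (u k) e / s (τ.vertexLevel (τ.parent e)) k) atTop (𝓝 c)) :
    c ∈ τ.edgeConf ∧ τ.Normalized c ∧ τ.Approximates atTop u c := by
  have hn : τ.Normalized c := fun e he => by
    refine tendsto_nhds_unique (tendsto_pi_nhds.1 hc e) (tendsto_const_nhds.congr fun k => ?_)
    rw [gap, he]
    simp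
  have hrep : ∀ᶠ k in atTop, 0 < s τ.rootLevel k ∧ (∀ a, 0 < τ.ratio (fun a => s a k) a) ∧
      τ.Represents (u k) (fun e => τ.gap (u k) e / s (τ.vertexLevel (τ.parent e)) k)
        fun a => s τ.rootLevel k * τ.scale (τ.ratio fun a => s a k) a :=
    Eventually.of_forall fun k =>
      ⟨h.positive _ _, ratio_pos fun a => h.positive a k, represents_div fun a => h.positive a k⟩
  have hr := tendsto_ratio h.lt
  have hscale : ∀ a k, s τ.rootLevel k * τ.scale (τ.ratio fun a => s a k) a = s a k :=
    fun a k => scale_ratio (s := fun a => s a k) (fun a => h.positive a k) a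
  -- limits of differences of positions at a vertex
  have hq : ∀ (e : τ.Edge') (a : Mark n l), anchor φ (decide (IsDisc e.1)) a ∈ e.1 →
      Tendsto (fun k => (pos φ (u k) (decide (IsDisc e.1)) a -
        pos φ (u k) (decide (IsDisc e.1)) (minMark (τ.parent e).1)) /
          s (τ.vertexLevel (τ.parent e)) k) atTop (𝓝 (c e)) := by
    intro e a ha
    have := tendsto_quot hrep hc hr (divisible_minMark e ha)
    simp only [hscale] at this
    rwa [quot_minMark hn e ha] at this
  have hint : ∀ (e : τ.Edge') (f : Fin l), ¬ IsDisc e.1 → .inr f ∈ e.1 →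
      Tendsto (fun k => ((u k).2 f - pos φ (u k) false (minMark (τ.parent e).1)) /
          s (τ.vertexLevel (τ.parent e)) k) atTop (𝓝 (c e)) := by
    intro e f he hf
    have := hq e (.inr f) (by simpa [anchor, he] using hf)
    simpa [he, pos] using this
  -- Two points are on the same line when their colors agree or separate only at a later level. Then
  -- the horizontal part of the rescaled distance tends to `0`, and `κ = |c e - c e'|`.
  have hline : ∀ (e e' : τ.Edge') (f g : Fin l), ¬ IsDisc e.1 → ¬ IsDisc e'.1 →
      τ.parent e = τ.parent e' → e ≠ e' → .inr f ∈ e.1 → .inr g ∈ e'.1 →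
      (∀ hfg : (.inl (φ f) : Mark n l) ≠ .inl (φ g),
        τ.LevelLt (τ.vertexLevel (τ.parent e)) (τ.vertexLevel (τ.join hfg))) → c e ≠ c e' := by
    intro e e' f g he he' hp hne hf hg hlt
    obtain ⟨hfg, hj⟩ := join_eq_parent hp hne hf hg
    obtain ⟨κ, hκ, hlim⟩ := h.dist ⟨(_, _), hfg⟩
    have h0 : Tendsto (fun k => |(u k).1 (φ f) - (u k).1 (φ g)| / s (τ.vertexLevel (τ.parent e)) k)
        atTop (𝓝 0) := by
      by_cases hφ : φ f = φ g
      · simp [hφ]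
      · have hφ' : (.inl (φ f) : Mark n l) ≠ .inl (φ g) := by simpa using hφ
        have := h.tendsto_zero (q := ⟨(_, _), hφ'⟩) (hlt hφ')
        simpa only [markDist_inl] using this
    have h1 := hint e f he hf
    have h2 := hint e' g he' hg
    rw [← hp] at h2
    have h3 := h0.add (h1.sub h2).abs
    simp only [hj] at hlim
    have : κ = 0 + |c e - c e'| := tendsto_nhds_unique hlim (h3.congr fun k => by
      have := h.positive (τ.vertexLevel (τ.parent e)) k
      rw [← sub_div, sub_sub_sub_cancel_right, abs_div, abs_of_pos this, ← add_div]
      rfl)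
    intro heq
    rw [heq] at this
    simp at this
    exact hκ.ne' this
  refine ⟨⟨fun v d d' hd hd' hlt => ?_, fun v e he => ?_, fun v e e' he he' hne hl => ?_,
    fun w e e' he he' hne hl => ?_⟩, hn, _, _, _, hrep, hc, hr⟩
  · rw [coordEquiv_symm_fst, coordEquiv_symm_fst]
    have hp := parent_eq_iff (v := ⟨v.1, v.2.1, v.2.2.1⟩) (e := ⟨d.1, d.2.1, d.2.2.1⟩) |>.2 hd
    have hp' := parent_eq_iff (v := ⟨v.1, v.2.1, v.2.2.1⟩) (e := ⟨d'.1, d'.2.1, d'.2.2.1⟩) |>.2 hd'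
    obtain ⟨i, hi⟩ := d.2.2.2
    obtain ⟨j, hj⟩ := d'.2.2.2
    have hij := hlt i j hi hj
    obtain ⟨hne, hjoin⟩ := join_eq_parent (hp.trans hp'.symm) (fun h => by
      have h : d.1 = d'.1 := congrArg (fun x : τ.Edge' => x.1) h
      exact lt_irrefl _ (hlt i i hi (h ▸ hi))) hi hj
    obtain ⟨κ, hκ, hlim⟩ := h.dist ⟨(_, _), hne⟩
    have h1 := hq ⟨d.1, d.2.1, d.2.2.1⟩ (.inl i) (by simpa [d.2.2.2, anchor, markColor] using hi)
    have h2 := hq ⟨d'.1, d'.2.1, d'.2.2.1⟩ (.inl j)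
      (by simpa [d'.2.2.2, anchor, markColor] using hj)
    simp only [hjoin, hp] at hlim
    simp only [hp, d.2.2.2, decide_true] at h1
    simp only [hp', d'.2.2.2, decide_true] at h2
    have : κ = c ⟨d'.1, d'.2.1, d'.2.2.1⟩ - c ⟨d.1, d.2.1, d.2.2.1⟩ :=
      tendsto_nhds_unique hlim ((h2.sub h1).congr fun k => by
        rw [← sub_div, sub_sub_sub_cancel_right, markDist_inl, abs_sub_comm,
          abs_of_pos (sub_pos.2 ((hu k).1 hij))]
        rfl)
    linarith
  · rw [coordEquiv_symm_snd]
    have hp := parent_eq_iff (v := ⟨v.1, v.2.1, v.2.2.1⟩)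
      (e := ⟨e.1, e.2.1, ne_univ_of_not_isDisc e.2.2⟩) |>.2 he
    obtain ⟨i | f, hf⟩ := τ.nonempty_of_mem _ e.2.1
    · exact absurd ⟨i, hf⟩ e.2.2
    -- The sprinkle `f` is compared with the boundary point of its color: their distance is exactly
    -- the height of `f`.
    have hv : .inl (φ f) ∈ v.1 := τ.color_mem_of_isDisc v.2.1 v.2.2.2
      ((τ.mem_out.1 he).2.1.1 hf)
    obtain ⟨d, hd⟩ : ∃ d, d = τ.child ⟨v.1, v.2.1, v.2.2.1⟩ ⟨_, hv⟩ := ⟨_, rfl⟩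
    have hfd : .inl (φ f) ∈ d.1 := hd ▸ τ.mem_child ⟨v.1, v.2.1, v.2.2.1⟩ ⟨_, hv⟩
    have hpd : τ.parent d = ⟨v.1, v.2.1, v.2.2.1⟩ := hd ▸ τ.parent_child _ _
    obtain ⟨hne, hjoin⟩ := join_eq_parent (hp.trans hpd.symm) (fun h => e.2.2 ⟨φ f, by
      have h : e.1 = d.1 := congrArg (fun x : τ.Edge' => x.1) h
      exact h ▸ hfd⟩) hf hfd
    obtain ⟨κ, hκ, hlim⟩ := h.dist ⟨(_, _), hne⟩
    have h1 := hint ⟨e.1, e.2.1, ne_univ_of_not_isDisc e.2.2⟩ f e.2.2 hf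
    obtain ⟨j, hj⟩ := v.2.2.2.exists_minMark
    simp only [hjoin] at hlim
    have : κ = c ⟨e.1, e.2.1, ne_univ_of_not_isDisc e.2.2⟩ :=
      tendsto_nhds_unique hlim (h1.congr fun k => by
        rw [hp]
        simp [hj, pos, markDist, markColor, abs_of_pos ((hu k).2.1 f)])
    exact this ▸ hκ
  · rw [coordEquiv_symm_snd, coordEquiv_symm_snd]
    have hp := parent_eq_iff (v := ⟨v.1, v.2.1, v.2.2.1⟩)
      (e := ⟨e.1, e.2.1, ne_univ_of_not_isDisc e.2.2⟩) |>.2 he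
    have hp' := parent_eq_iff (v := ⟨v.1, v.2.1, v.2.2.1⟩)
      (e := ⟨e'.1, e'.2.1, ne_univ_of_not_isDisc e'.2.2⟩) |>.2 he'
    obtain ⟨d, hd, hd'⟩ := hl
    obtain ⟨i | f, hf⟩ := τ.nonempty_of_mem _ e.2.1
    · exact absurd ⟨i, hf⟩ e.2.2
    obtain ⟨i | g, hg⟩ := τ.nonempty_of_mem _ e'.2.1
    · exact absurd ⟨i, hg⟩ e'.2.2
    refine hline _ _ f g e.2.2 e'.2.2 (hp.trans hp'.symm) (fun h => hne (Subtype.ext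
      (congrArg (fun x : τ.Edge' => x.1) h))) hf hg fun hfg => ?_
    rw [hp]
    refine vertexLevel_lt ?_
    have h1 := τ.mem_out.1 hd.1
    exact lt_of_le_of_lt (τ.join_subset hfg h1.1 (OnLine.mem τ hd hf) (OnLine.mem τ hd' hg)) h1.2.1
  · rw [coordEquiv_symm_snd, coordEquiv_symm_snd]
    have hp := parent_eq_iff (v := ⟨w.1, w.2.1, w.2.2.1⟩)
      (e := ⟨e.1, e.2.1, ne_univ_of_not_isDisc e.2.2⟩) |>.2 he
    have hp' := parent_eq_iff (v := ⟨w.1, w.2.1, w.2.2.1⟩)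
      (e := ⟨e'.1, e'.2.1, ne_univ_of_not_isDisc e'.2.2⟩) |>.2 he'
    obtain ⟨i | f, hf⟩ := τ.nonempty_of_mem _ e.2.1
    · exact absurd ⟨i, hf⟩ e.2.2
    obtain ⟨i | g, hg⟩ := τ.nonempty_of_mem _ e'.2.1
    · exact absurd ⟨i, hg⟩ e'.2.2
    refine hline _ _ f g e.2.2 e'.2.2 (hp.trans hp'.symm) (fun h => hne (Subtype.ext
      (congrArg (fun x : τ.Edge' => x.1) h))) hf hg fun hfg => ?_
    rw [hp, τ.vertexLevel_sphere]
    have hdisc : IsDisc (τ.join hfg).1 := ⟨_, τ.left_mem_join hfg⟩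
    rw [τ.vertexLevel_disc ⟨(τ.join hfg).1, (τ.join hfg).2.1, (τ.join hfg).2.2, hdisc⟩]
    rcases hΦ : τ.Φ w with v | e₀
    · unfold SameLayer at hl
      rw [hΦ] at hl
      obtain ⟨d, hd, hd'⟩ := hl
      rw [τ.level_eq_inl hΦ]
      have h1 := τ.mem_out.1 hd.1
      exact .inl (lt_of_le_of_lt (τ.join_subset hfg h1.1 (OnLine.mem τ hd hf)
        (OnLine.mem τ hd' hg)) h1.2.1)
    · rw [τ.level_eq_inr hΦ]
      have hal := τ.alignable w
      rw [hΦ] at hal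
      exact .inl (τ.join_subset hfg e₀.2.1
        (mem_canonicalColor.1 (hal (mem_inducedColor ((τ.mem_out.1 he).2.1.1 hf))))
        (mem_canonicalColor.1 (hal (mem_inducedColor ((τ.mem_out.1 he').2.1.1 hg)))))

end PopsicleType

namespace StablePopsicle

open PopsicleType

variable {n l : ℕ} {φ : Fin l → Fin n} [NeZero n] [Fact (2 ≤ n + l)]

/-- Each sequence of popsicles has a Gromov convergent subsequence. -/
theorem exists_isLimit_subseq {u : ℕ → (Fin n → ℝ) × (Fin l → ℝ)}
    (hu : ∀ k, u k ∈ planarPopsicles φ) :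
    ∃ (ι : ℕ → ℕ) (p : StablePopsicle φ), StrictMono ι ∧ IsLimit (u ∘ ι) p := by
  obtain ⟨ι, ℓ, hι, hℓ⟩ := exists_adapted hu
  obtain ⟨L, hL⟩ := ℓ.exists_isOrd
  obtain ⟨s, hs⟩ := hL.comparable hℓ fun k => hu _
  obtain ⟨ι', c, hι', hc⟩ := hs.exists_tendsto
  obtain ⟨hc', hn, happ⟩ := (hs.comp hι'.tendsto_atTop).mem_edgeConf (fun k => hu _) hc
  exact ⟨ι ∘ ι', ⟨_, Quotient.mk _ (toConf c hc')⟩, hι.comp hι', _, rfl,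
    happ.gromovConverges hc' hn⟩

end StablePopsicle

namespace PopsicleType

variable {n l : ℕ} {φ : Fin l → Fin n} (τ : PopsicleType φ)

theorem radicand_pos {u : (Fin n → ℝ) × (Fin l → ℝ)} (hu : u ∈ planarPopsicles φ) (i : Fin n)
    {q : Mark n l × Mark n l} (hq : q.1 ≠ q.2) : 0 < radicand φ u i q := by
  refine lt_of_le_of_ne (radicand_nonneg _ _ _ _) fun h => ?_
  unfold radicand at h
  have h1 := sq_nonneg (pos φ u true q.1 - pos φ u true (.inl i))
  have h2 := sq_nonneg (pos φ u true q.2 - pos φ u true (.inl i))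
  have h3 := sq_nonneg (pos φ u false q.1 - pos φ u false q.2)
  have h1' := sq_eq_zero_iff.1 (by linarith : (pos φ u true q.1 - pos φ u true (.inl i)) ^ 2 = 0)
  have h2' := sq_eq_zero_iff.1 (by linarith : (pos φ u true q.2 - pos φ u true (.inl i)) ^ 2 = 0)
  have h3' := sq_eq_zero_iff.1 (by linarith : (pos φ u false q.1 - pos φ u false q.2) ^ 2 = 0)
  refine (markDist_pos hu hq).ne' ?_
  rw [markDist, h3', show pos φ u true q.1 - pos φ u true q.2 = 0 by linarith]
  simp

variable {τ} in
/-- A boundary point of a level. -/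
noncomputable def levelPoint (a : τ.Level) : Fin n := (τ.levelSet_disc a).choose

variable {τ} in
theorem levelPoint_mem (a : τ.Level) : .inl (levelPoint a) ∈ τ.levelSet a :=
  (τ.levelSet_disc a).choose_spec

variable [NeZero n]

/-! ## Reference edges of the levels -/

variable {τ} in
theorem coord_ne_zero_of_disc {c : τ.Edge' → ℝ} (hc : c ∈ τ.edgeConf) (hn : τ.Normalized c)
    (e : τ.FreeEdge) (hv : IsDisc (τ.parent e.1).1) : c e.1 ≠ 0 := by
  by_cases he : IsDisc e.1.1
  · rw [← hn.base (τ.parent e.1)]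
    exact coord_ne_of_isDisc hc (τ.parent_base _).symm he (isDisc_base hv)
      fun h => e.2 ((τ.eq_base_iff e.1).1 h)
  · exact (coord_pos hc he hv).ne'

variable {τ} in
theorem exists_free_child (v : τ.Vertex) : ∃ e : τ.FreeEdge, τ.parent e.1 = v := by
  have hs := τ.ssubset_parent (τ.base v)
  rw [τ.parent_base] at hs
  obtain ⟨a, ha, hb⟩ := Finset.exists_of_ssubset hs
  refine ⟨⟨τ.child v ⟨a, ha⟩, fun h => hb ?_⟩, τ.parent_child _ _⟩
  rw [← τ.eq_base_iff, τ.parent_child] at h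
  rw [← h]
  exact τ.mem_child v ⟨a, ha⟩

/-- The scale of a level can be measured by a coordinate that never vanishes. On a disc every free
edge will do. On a level of a string, take a sphere aligned there: its points lie on one line, so a
free point and the base point have different heights. A sphere aligned with a disc would not do,
since points on different lines may have equal heights. -/
theorem exists_refEdge (a : τ.Level) : ∃ e : τ.FreeEdge, τ.vertexLevel (τ.parent e.1) = a ∧
    ∀ c ∈ τ.edgeConf, τ.Normalized c → c e.1 ≠ 0 := by
  rcases a with v | ⟨e₀, k⟩
  · obtain ⟨e, he⟩ := exists_free_child (τ := τ) ⟨v.1, v.2.1, v.2.2.1⟩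
    exact ⟨e, by rw [he, τ.vertexLevel_disc], fun c hc hn =>
      coord_ne_zero_of_disc hc hn e (by rw [he]; exact v.2.2.2)⟩
  · obtain ⟨w, rfl⟩ := τ.Ψ_surjective e₀ k
    obtain ⟨e, he⟩ := exists_free_child (τ := τ) ⟨w.1.1, w.1.2.1, w.1.2.2.1⟩
    refine ⟨e, by rw [he, τ.vertexLevel_sphere, τ.level_eq_inr w.2], fun c hc hn => ?_⟩
    rw [← hn.base (τ.parent e.1)]
    refine coord_ne_of_sphere hc (τ.parent_base _).symm (fun h => e.2 ((τ.eq_base_iff e.1).1 h))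
      (by rw [he]; exact w.1.2.2.2) fun v hv => ?_
    have hw := w.2
    simp only [he] at hv
    rw [hw] at hv
    cases hv

/-- A free edge at each level, whose coordinate measures the scale of the level. -/
noncomputable def refEdge (a : τ.Level) : τ.FreeEdge := (τ.exists_refEdge a).choose

variable {τ}

theorem level_refEdge (a : τ.Level) : τ.vertexLevel (τ.parent (τ.refEdge a).1) = a :=
  (τ.exists_refEdge a).choose_spec.1

theorem coord_refEdge_ne_zero {c : τ.Edge' → ℝ} (hc : c ∈ τ.edgeConf) (hn : τ.Normalized c)
    (a : τ.Level) : c (τ.refEdge a).1 ≠ 0 :=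
  (τ.exists_refEdge a).choose_spec.2 c hc hn

/-! ## Quotients of gaps -/

/-- The index for which `ratioFun` has the gap of `e` as its numerator. -/
noncomputable def gapIndex (e e' : τ.FreeEdge) (i : Fin n) : RatioIndex n l :=
  (decide (IsDisc e.1.1), ⟨(minMark e.1.1, minMark (τ.parent e.1).1), e.2⟩,
    ⟨(minMark e'.1.1, minMark (τ.parent e'.1).1), e'.2⟩, i)

theorem join_gap (e : τ.FreeEdge) : τ.join e.2 = τ.parent e.1 :=
  τ.join_eq e.2 (mem_out_parent e.1) (τ.minMark_mem_edge e.1) (τ.minMark_mem_vertex _)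
    fun h' => e.2 (minMark_eq_of_subset (τ.ssubset_parent e.1).1 h')

theorem pairLevel_gap {e : τ.FreeEdge} {i : Fin n}
    (hi : .inl i ∈ τ.levelSet (τ.vertexLevel (τ.parent e.1))) :
    τ.pairLevel i ⟨(minMark e.1.1, minMark (τ.parent e.1).1), e.2⟩ =
      τ.vertexLevel (τ.parent e.1) := by
  rw [pairLevel_of_mem (by rwa [join_gap]), join_gap]

/-- Exchanging the two pairs does not change the denominator, which is at the earlier of the two
levels. -/
theorem ratioLevel_gapIndex {e e' : τ.FreeEdge} {i : Fin n}
    (h : τ.LevelLe (τ.vertexLevel (τ.parent e.1)) (τ.vertexLevel (τ.parent e'.1)))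
    (hi : .inl i ∈ τ.levelSet (τ.vertexLevel (τ.parent e'.1))) :
    τ.ratioLevel (gapIndex e e' i) = τ.vertexLevel (τ.parent e.1) ∧
      τ.ratioLevel (gapIndex e' e i) = τ.vertexLevel (τ.parent e.1) := by
  have h1 := pairLevel_gap (h.subset hi)
  have h2 := pairLevel_gap hi
  unfold ratioLevel gapIndex
  dsimp only
  rw [h1, h2]
  refine ⟨if_pos h, ?_⟩
  split_ifs with h'
  · exact h'.antisymm h
  · rfl

theorem gap_glue (c : τ.Edge' → ℝ) (r : τ.Level → ℝ) (a : τ.Level) (e : τ.Edge') :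
    τ.gap (τ.glue c (τ.scaleQuot r a)) e =
      τ.quot a c r (decide (IsDisc e.1)) (minMark e.1) (minMark (τ.parent e).1) :=
  represents_glue c _ _ _ _

theorem quot_gap {c : τ.Edge' → ℝ} (hn : τ.Normalized c) (r : τ.Level → ℝ) (a : τ.Level)
    (e : τ.Edge') :
    τ.quot a c r (decide (IsDisc e.1)) (minMark e.1) (minMark (τ.parent e).1) =
      c e * τ.scaleQuot r a (τ.vertexLevel (τ.parent e)) := by
  rw [← gap_glue, gap_of_represents (represents_glue c _) hn]

/-- The common denominator `x` cancels in the quotient of the two values. So quotients of gaps are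
rational functions of the ambient coordinates, also at vanishing ratios. -/
theorem exists_ratioExt_gapIndex {c : τ.Edge' → ℝ} {r : τ.Level → ℝ} (hn : τ.Normalized c)
    (hs : (c, r) ∈ τ.smoothDomain) {e e' : τ.FreeEdge} {i : Fin n}
    (h : τ.LevelLe (τ.vertexLevel (τ.parent e.1)) (τ.vertexLevel (τ.parent e'.1)))
    (hi : .inl i ∈ τ.levelSet (τ.vertexLevel (τ.parent e'.1))) :
    ∃ x > 0, τ.ratioExt c r (gapIndex e e' i) = c e.1 / x ∧ τ.ratioExt c r (gapIndex e' e i) =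
      c e'.1 * τ.scaleQuot r (τ.vertexLevel (τ.parent e.1)) (τ.vertexLevel (τ.parent e'.1)) / x := by
  obtain ⟨h1, h2⟩ := ratioLevel_gapIndex h hi
  refine ⟨_, Real.sqrt_pos.2 (hs (gapIndex e e' i)), ?_, ?_⟩
  · rw [ratioExt]
    congr 1
    rw [h1]
    exact (quot_gap hn r _ e.1).trans (by rw [scaleQuot_self, mul_one])
  · rw [ratioExt, h1, h2, add_comm]
    exact congrArg (· / _) (quot_gap hn r _ e'.1)

theorem exists_ratioFun_gapIndex {u : (Fin n → ℝ) × (Fin l → ℝ)} (hu : u ∈ planarPopsicles φ)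
    (e e' : τ.FreeEdge) (i : Fin n) :
    ∃ x > 0, ratioFun φ u (gapIndex e e' i) = τ.gap u e.1 / x ∧
      ratioFun φ u (gapIndex e' e i) = τ.gap u e'.1 / x := by
  refine ⟨_, Real.sqrt_pos.2 (add_pos (radicand_pos hu i e.2) (radicand_pos hu i e'.2)), rfl, ?_⟩
  rw [add_comm]
  rfl

/-! ## Coordinates near a stable popsicle -/

variable [Fact (2 ≤ n + l)]

variable (τ) in
/-- The index set of the corner coordinates. -/
abbrev ChartIndex := {e : τ.FreeEdge // e ≠ τ.refEdge τ.rootLevel}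

open Classical in
/-- The ratios of scales with corner coordinates `θ`. -/
noncomputable def chartRatio (θ : τ.ChartIndex → ℝ) (a : τ.Level) : ℝ :=
  if h : τ.refEdge a ≠ τ.refEdge τ.rootLevel then θ ⟨τ.refEdge a, h⟩ else 1

open Classical in
/-- The coordinates on the components with corner coordinates `θ`. -/
noncomputable def chartCoord (c₀ : τ.Edge' → ℝ) (θ : τ.ChartIndex → ℝ) (e : τ.Edge') : ℝ :=
  if h : minMark e.1 = minMark (τ.parent e).1 then 0
  else if h' : ⟨e, h⟩ = τ.refEdge (τ.vertexLevel (τ.parent e)) then c₀ e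
  -- The shift puts the center at `θ = 1`, inside the open half-line. The reference coordinates
  -- above are frozen at `c₀`, which uses up the rescaling of each level.
  else θ ⟨⟨e, h⟩, fun h'' => h' (by
    have := congrArg (fun x : τ.FreeEdge => τ.vertexLevel (τ.parent x.1)) h''
    simp only [level_refEdge] at this
    rw [this, ← h''])⟩ + c₀ e - 1

open Classical in
/-- The edge whose gap is compared with the gap of `j`. -/
noncomputable def prevEdge (j : τ.FreeEdge) : τ.FreeEdge :=
  if j = τ.refEdge (τ.vertexLevel (τ.parent j.1)) then
    τ.refEdge (τ.pred (τ.vertexLevel (τ.parent j.1)))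
  else τ.refEdge (τ.vertexLevel (τ.parent j.1))

open Classical in
/-- The corner coordinates, as functions of the values of `ratioFun`. -/
noncomputable def cornerCoord (c₀ : τ.Edge' → ℝ) (z : RatioIndex n l → ℝ) (j : τ.ChartIndex) : ℝ :=
  let e := j.1
  let i := levelPoint (τ.vertexLevel (τ.parent e.1))
  let x := z (gapIndex e (prevEdge e) i) / z (gapIndex (prevEdge e) e i)
  -- Here `x` is the quotient of the gaps of `e` and `prevEdge e`. The constants undo the frozen
  -- reference coordinates and the shift in `chartCoord`.
  if e = τ.refEdge (τ.vertexLevel (τ.parent e.1)) then c₀ (prevEdge e).1 / c₀ e.1 * x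
  else c₀ (prevEdge e).1 * x + (1 - c₀ e.1)

theorem ChartIndex.ne_rootLevel {j : τ.ChartIndex}
    (h : j.1 = τ.refEdge (τ.vertexLevel (τ.parent j.1.1))) :
    τ.vertexLevel (τ.parent j.1.1) ≠ τ.rootLevel := fun h' => j.2 (by rw [h, h'])

theorem level_prevEdge_ref {j : τ.FreeEdge} (h : j = τ.refEdge (τ.vertexLevel (τ.parent j.1))) :
    prevEdge j = τ.refEdge (τ.pred (τ.vertexLevel (τ.parent j.1))) := if_pos h

theorem level_prevEdge {j : τ.FreeEdge} (h : j ≠ τ.refEdge (τ.vertexLevel (τ.parent j.1))) :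
    prevEdge j = τ.refEdge (τ.vertexLevel (τ.parent j.1)) := if_neg h

theorem level_prevEdge_le (j : τ.ChartIndex) :
    τ.LevelLe (τ.vertexLevel (τ.parent (prevEdge j.1).1)) (τ.vertexLevel (τ.parent j.1.1)) := by
  by_cases h : j.1 = τ.refEdge (τ.vertexLevel (τ.parent j.1.1))
  · rw [level_prevEdge_ref h, level_refEdge]
    exact .inr (pred_lt (ChartIndex.ne_rootLevel h))
  · rw [level_prevEdge h, level_refEdge]
    exact LevelLe.refl _

theorem exists_prevEdge (j : τ.FreeEdge) : ∃ a, prevEdge j = τ.refEdge a := by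
  unfold prevEdge
  split_ifs <;> exact ⟨_, rfl⟩

theorem scaleQuot_pred (r : τ.Level → ℝ) {a : τ.Level} (ha : a ≠ τ.rootLevel) :
    τ.scaleQuot r (τ.pred a) a = r a := by
  classical
  rw [scaleQuot, Finset.prod_eq_single a]
  · intro b hb hne
    simp only [Finset.mem_filter, Finset.mem_univ, true_and] at hb
    exact absurd (le_pred (hb.1.lt_or_eq.resolve_right hne)) hb.2
  · intro h
    simp only [Finset.mem_filter, Finset.mem_univ, true_and, not_and_not_right] at h
    have := (pred_lt ha)
    rcases h (LevelLe.refl a) with h' | h'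
    · rw [← h'] at this
      exact absurd this (LevelLt.irrefl _)
    · exact absurd h' this.asymm

theorem cornerCoord_ratioExt {c₀ c : τ.Edge' → ℝ} {r : τ.Level → ℝ} (hn : τ.Normalized c)
    (hs : (c, r) ∈ τ.smoothDomain) (j : τ.ChartIndex) (hj : c (prevEdge j.1).1 ≠ 0) :
    (j.1 = τ.refEdge (τ.vertexLevel (τ.parent j.1.1)) → cornerCoord c₀ (τ.ratioExt c r) j =
      c₀ (prevEdge j.1).1 / c₀ j.1.1 * (c j.1.1 * r (τ.vertexLevel (τ.parent j.1.1)) /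
        c (prevEdge j.1).1)) ∧
    (j.1 ≠ τ.refEdge (τ.vertexLevel (τ.parent j.1.1)) → cornerCoord c₀ (τ.ratioExt c r) j =
      c₀ (prevEdge j.1).1 * (c j.1.1 / c (prevEdge j.1).1) + (1 - c₀ j.1.1)) := by
  obtain ⟨x, hx, h1, h2⟩ := exists_ratioExt_gapIndex hn hs (level_prevEdge_le j)
    (levelPoint_mem (τ.vertexLevel (τ.parent j.1.1)))
  have h3 : ∀ y, y / x / (c (prevEdge j.1).1 / x) = y / c (prevEdge j.1).1 := fun y => by
    field_simp
  constructor
  · intro h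
    simp only [cornerCoord]
    rw [if_pos h, h1, h2, h3]
    congr 3
    rw [level_prevEdge_ref h, level_refEdge, scaleQuot_pred _ (ChartIndex.ne_rootLevel h)]
  · intro h
    simp only [cornerCoord]
    rw [if_neg h, h1, h2, h3]
    congr 3
    rw [level_prevEdge h, level_refEdge, scaleQuot_self, mul_one]

theorem normalized_chartCoord (c₀ : τ.Edge' → ℝ) (θ : τ.ChartIndex → ℝ) :
    τ.Normalized (chartCoord c₀ θ) := fun _ he => dif_pos he

theorem chartCoord_refEdge (c₀ : τ.Edge' → ℝ) (θ : τ.ChartIndex → ℝ) (a : τ.Level) :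
    chartCoord c₀ θ (τ.refEdge a).1 = c₀ (τ.refEdge a).1 := by
  rw [chartCoord, dif_neg (τ.refEdge a).2, dif_pos]
  rw [level_refEdge]

theorem chartCoord_of_ne (c₀ : τ.Edge' → ℝ) (θ : τ.ChartIndex → ℝ) {j : τ.ChartIndex}
    (h : j.1 ≠ τ.refEdge (τ.vertexLevel (τ.parent j.1.1))) :
    chartCoord c₀ θ j.1.1 = θ j + c₀ j.1.1 - 1 := by
  rw [chartCoord, dif_neg j.1.2, dif_neg h]

theorem chartRatio_root (θ : τ.ChartIndex → ℝ) : chartRatio θ τ.rootLevel = 1 :=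
  dif_neg (by simp)

theorem chartRatio_of_eq (θ : τ.ChartIndex → ℝ) {j : τ.ChartIndex} {a : τ.Level}
    (h : j.1 = τ.refEdge a) : chartRatio θ a = θ j := by
  have := j.2
  rw [h] at this
  rw [chartRatio, dif_pos this]
  exact congrArg θ (Subtype.ext h.symm)

theorem refEdge_ne {a : τ.Level} (ha : a ≠ τ.rootLevel) : τ.refEdge a ≠ τ.refEdge τ.rootLevel := by
  intro h
  have := congrArg (fun x : τ.FreeEdge => τ.vertexLevel (τ.parent x.1)) h
  simp only [level_refEdge] at this
  exact ha this

/-- The index of the ratio of scales at a level. -/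
noncomputable def ratioIndex {a : τ.Level} (ha : a ≠ τ.rootLevel) : τ.ChartIndex :=
  ⟨τ.refEdge a, refEdge_ne ha⟩

theorem ratioIndex_eq {a : τ.Level} (ha : a ≠ τ.rootLevel) :
    (ratioIndex ha).1 = τ.refEdge (τ.vertexLevel (τ.parent (ratioIndex ha).1.1)) := by
  rw [ratioIndex, level_refEdge]

theorem eq_ratioIndex {j : τ.ChartIndex} (h : j.1 = τ.refEdge (τ.vertexLevel (τ.parent j.1.1))) :
    j = ratioIndex (ChartIndex.ne_rootLevel h) := Subtype.ext h

theorem chartRatio_ratioIndex (θ : τ.ChartIndex → ℝ) {a : τ.Level} (ha : a ≠ τ.rootLevel) :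
    chartRatio θ a = θ (ratioIndex ha) := chartRatio_of_eq θ rfl

/-- One half of the inversion of the chart, valid also at vanishing ratios. The other half is proved
on popsicles in `chart_of_gap` and extended by continuity in `cornerCoord_of_mem_closure`. -/
theorem cornerCoord_chart {c₀ : τ.Edge' → ℝ} (h₀ : ∀ a, c₀ (τ.refEdge a).1 ≠ 0)
    {θ : τ.ChartIndex → ℝ} (hs : (chartCoord c₀ θ, chartRatio θ) ∈ τ.smoothDomain) :
    cornerCoord c₀ (τ.ratioExt (chartCoord c₀ θ) (chartRatio θ)) = θ := by
  funext j
  obtain ⟨b, hb⟩ := exists_prevEdge j.1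
  have hj : chartCoord c₀ θ (prevEdge j.1).1 = c₀ (prevEdge j.1).1 := by
    rw [hb, chartCoord_refEdge]
  have hne : c₀ (prevEdge j.1).1 ≠ 0 := hb ▸ h₀ b
  obtain ⟨h1, h2⟩ := cornerCoord_ratioExt (c₀ := c₀) (normalized_chartCoord c₀ θ) hs j (hj ▸ hne)
  by_cases h : j.1 = τ.refEdge (τ.vertexLevel (τ.parent j.1.1))
  · rw [h1 h, hj, chartRatio_of_eq θ h]
    have h3 : chartCoord c₀ θ j.1.1 = c₀ j.1.1 := by rw [h, chartCoord_refEdge]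
    have h4 : c₀ j.1.1 ≠ 0 := h ▸ h₀ _
    rw [h3]
    field_simp
  · rw [h2 h, hj, chartCoord_of_ne _ _ h]
    field_simp
    ring

open Classical in
variable (τ) in
/-- The corner coordinates of the center of the chart. -/
noncomputable def cornerPoint (j : τ.ChartIndex) : ℝ :=
  if j.1 = τ.refEdge (τ.vertexLevel (τ.parent j.1.1)) then 0 else 1

theorem chartRatio_cornerPoint : chartRatio τ.cornerPoint = τ.rootRatio := by
  funext a
  by_cases ha : a = τ.rootLevel
  · rw [ha, chartRatio_root, rootRatio, if_pos rfl]
  · rw [chartRatio_ratioIndex _ ha, rootRatio, if_neg ha, cornerPoint, if_pos (ratioIndex_eq ha)]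

theorem chartCoord_cornerPoint {c₀ : τ.Edge' → ℝ} (hn : τ.Normalized c₀) :
    chartCoord c₀ τ.cornerPoint = c₀ := by
  funext e
  by_cases he : minMark e.1 = minMark (τ.parent e).1
  · rw [normalized_chartCoord _ _ _ he, hn _ he]
  by_cases h' : ⟨e, he⟩ = τ.refEdge (τ.vertexLevel (τ.parent e))
  · rw [chartCoord, dif_neg he, dif_pos h']
  · rw [chartCoord, dif_neg he, dif_neg h', cornerPoint, if_neg h']
    ring

/-- Popsicles near the center are glued from their corner coordinates. -/
theorem chart_of_gap {c₀ : τ.Edge' → ℝ} {u : (Fin n → ℝ) × (Fin l → ℝ)}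
    (hu : u ∈ planarPopsicles φ) {s : τ.Level → ℝ} (hpos : ∀ a, 0 < s a)
    (h₀ : ∀ a, c₀ (τ.refEdge a).1 ≠ 0) (hs : ∀ a, τ.gap u (τ.refEdge a).1 = c₀ (τ.refEdge a).1 * s a) :
    (chartCoord c₀ (cornerCoord c₀ (ratioFun φ u)) =
      fun e => τ.gap u e / s (τ.vertexLevel (τ.parent e))) ∧
    chartRatio (cornerCoord c₀ (ratioFun φ u)) = τ.ratio s := by
  have key : ∀ (j : τ.ChartIndex),
      ratioFun φ u (gapIndex j.1 (prevEdge j.1) (levelPoint (τ.vertexLevel (τ.parent j.1.1)))) /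
        ratioFun φ u (gapIndex (prevEdge j.1) j.1 (levelPoint (τ.vertexLevel (τ.parent j.1.1)))) =
      τ.gap u j.1.1 / τ.gap u (prevEdge j.1).1 := by
    intro j
    obtain ⟨x, hx, h1, h2⟩ := exists_ratioFun_gapIndex hu j.1 (prevEdge j.1)
      (levelPoint (τ.vertexLevel (τ.parent j.1.1)))
    rw [h1, h2]
    field_simp
  constructor
  · funext e
    have hse := (hpos (τ.vertexLevel (τ.parent e))).ne'
    by_cases he : minMark e.1 = minMark (τ.parent e).1
    · rw [normalized_chartCoord _ _ _ he, gap, he, sub_self, zero_div]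
    by_cases h' : ⟨e, he⟩ = τ.refEdge (τ.vertexLevel (τ.parent e))
    · rw [chartCoord, dif_neg he, dif_pos h']
      have := hs (τ.vertexLevel (τ.parent e))
      rw [← h'] at this
      rw [this]
      field_simp
    · have hne : (⟨e, he⟩ : τ.FreeEdge) ≠ τ.refEdge τ.rootLevel := fun h'' => h' (by
        have := congrArg (fun x : τ.FreeEdge => τ.vertexLevel (τ.parent x.1)) h''
        simp only [level_refEdge] at this
        rw [this, ← h''])
      have hk := key ⟨⟨e, he⟩, hne⟩
      rw [chartCoord_of_ne (j := ⟨⟨e, he⟩, hne⟩) _ _ h', cornerCoord]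
      simp only at hk ⊢
      rw [if_neg h', hk, level_prevEdge h', hs]
      have := h₀ (τ.vertexLevel (τ.parent e))
      field_simp
      ring
  · funext a
    by_cases ha : a = τ.rootLevel
    · rw [ha, chartRatio_root, ratio, if_pos rfl]
    · have hk := key (ratioIndex ha)
      have hl : τ.vertexLevel (τ.parent (ratioIndex ha).1.1) = a := level_refEdge a
      rw [chartRatio_ratioIndex _ ha, ratio, if_neg ha, cornerCoord]
      rw [if_pos (ratioIndex_eq ha), hk, level_prevEdge_ref (ratioIndex_eq ha), hl, hs]
      change c₀ _ / c₀ (τ.refEdge a).1 * (τ.gap u (τ.refEdge a).1 / _) = _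
      rw [hs]
      have := h₀ a
      have := h₀ (τ.pred a)
      have := (hpos (τ.pred a)).ne'
      field_simp

end PopsicleType

/-! ### Smooth parametrization near a stable popsicle -/

namespace PopsicleType

variable {n l : ℕ} {φ : Fin l → Fin n} {τ : PopsicleType φ} [NeZero n] [Fact (2 ≤ n + l)]

/-- The values of `ratioFun` near a stable popsicle. -/
noncomputable def cornerDomain (c₀ : τ.Edge' → ℝ) : Set (RatioIndex n l → ℝ) :=
  {z | (∀ j : τ.ChartIndex, z (gapIndex (prevEdge j.1) j.1
      (levelPoint (τ.vertexLevel (τ.parent j.1.1)))) ≠ 0) ∧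
    -- The gap of each reference edge must have the sign of `c₀`, so that their quotient is positive
    -- and can serve as a scale.
    ∀ a, 0 < z (gapIndex (τ.refEdge a) (τ.refEdge a) (levelPoint a)) * c₀ (τ.refEdge a).1}

theorem isOpen_cornerDomain (c₀ : τ.Edge' → ℝ) : IsOpen (cornerDomain c₀) := by
  simp only [cornerDomain, Set.ofPred_and, Set.ofPred_forall]
  exact (isOpen_iInter_of_finite fun j => isOpen_ne_fun (by fun_prop) continuous_const).inter
    (isOpen_iInter_of_finite fun a => isOpen_lt continuous_const (by fun_prop))

theorem contDiffOn_cornerCoord (c₀ : τ.Edge' → ℝ) :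
    ContDiffOn ℝ ∞ (cornerCoord c₀) (cornerDomain c₀) := by
  rw [contDiffOn_pi]
  intro j
  have h : ContDiffOn ℝ ∞ (fun z : RatioIndex n l → ℝ =>
      z (gapIndex j.1 (prevEdge j.1) (levelPoint (τ.vertexLevel (τ.parent j.1.1)))) /
        z (gapIndex (prevEdge j.1) j.1 (levelPoint (τ.vertexLevel (τ.parent j.1.1)))))
      (cornerDomain c₀) :=
    ContDiffOn.div (contDiff_apply ℝ ℝ _).contDiffOn (contDiff_apply ℝ ℝ _).contDiffOn
      fun z hz => hz.1 j
  simp only [cornerCoord]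
  split_ifs
  · exact contDiffOn_const.mul h
  · exact (contDiffOn_const.mul h).add contDiffOn_const

theorem contDiff_chartCoord (c₀ : τ.Edge' → ℝ) : ContDiff ℝ ∞ (chartCoord c₀) := by
  rw [contDiff_pi]
  intro e
  unfold chartCoord
  split_ifs
  · exact contDiff_const
  · exact contDiff_const
  · fun_prop

theorem contDiff_chartRatio : ContDiff ℝ ∞ (chartRatio (τ := τ)) := by
  rw [contDiff_pi]
  intro a
  unfold chartRatio
  split_ifs
  · fun_prop
  · exact contDiff_const

/-- The values of `ratioFun` with given corner coordinates. -/
noncomputable def chartFun (c₀ : τ.Edge' → ℝ) (θ : τ.ChartIndex → ℝ) : RatioIndex n l → ℝ :=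
  τ.ratioExt (chartCoord c₀ θ) (chartRatio θ)

theorem contDiffOn_chartFun (c₀ : τ.Edge' → ℝ) : ContDiffOn ℝ ∞ (chartFun c₀)
    {θ | (chartCoord c₀ θ, chartRatio θ) ∈ τ.smoothDomain} :=
  contDiffOn_ratioExt.comp ((contDiff_chartCoord c₀).prodMk contDiff_chartRatio).contDiffOn
    fun _ hθ => hθ

theorem ratioExt_mem_cornerDomain {c₀ c : τ.Edge' → ℝ} {r : τ.Level → ℝ} (hn : τ.Normalized c)
    (hs : (c, r) ∈ τ.smoothDomain)
    (h : ∀ a, 0 < c (τ.refEdge a).1 * c₀ (τ.refEdge a).1) :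
    τ.ratioExt c r ∈ cornerDomain c₀ := by
  refine ⟨fun j => ?_, fun a => ?_⟩
  · obtain ⟨x, hx, h1, -⟩ := exists_ratioExt_gapIndex hn hs (level_prevEdge_le j)
      (levelPoint_mem (τ.vertexLevel (τ.parent j.1.1)))
    obtain ⟨b, hb⟩ := exists_prevEdge j.1
    rw [h1, hb]
    exact div_ne_zero (left_ne_zero_of_mul (h b).ne') hx.ne'
  · obtain ⟨x, hx, h1, -⟩ := exists_ratioExt_gapIndex hn hs
      (LevelLe.refl (τ.vertexLevel (τ.parent (τ.refEdge a).1)))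
      (levelPoint_mem (τ.vertexLevel (τ.parent (τ.refEdge a).1)))
    rw [level_refEdge] at h1
    rw [h1, div_mul_eq_mul_div]
    exact div_pos (h a) hx

/-- The scale of a level is the gap of its reference edge divided by the frozen coordinate `c₀` of
that edge. -/
theorem exists_scale_of_mem {c₀ : τ.Edge' → ℝ} {u : (Fin n → ℝ) × (Fin l → ℝ)}
    (hu : u ∈ planarPopsicles φ) (h : ratioFun φ u ∈ cornerDomain c₀) :
    ∃ s : τ.Level → ℝ, (∀ a, 0 < s a) ∧
      (chartCoord c₀ (cornerCoord c₀ (ratioFun φ u)) =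
        fun e => τ.gap u e / s (τ.vertexLevel (τ.parent e))) ∧
      chartRatio (cornerCoord c₀ (ratioFun φ u)) = τ.ratio s := by
  have hs : ∀ a, 0 < τ.gap u (τ.refEdge a).1 * c₀ (τ.refEdge a).1 := by
    intro a
    obtain ⟨x, hx, h1, -⟩ := exists_ratioFun_gapIndex hu (τ.refEdge a) (τ.refEdge a) (levelPoint a)
    have := h.2 a
    rw [h1, div_mul_eq_mul_div] at this
    exact (div_pos_iff_of_pos_right hx).1 this
  have h₀ : ∀ a, c₀ (τ.refEdge a).1 ≠ 0 := fun a => right_ne_zero_of_mul (hs a).ne'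
  have hpos : ∀ a, 0 < τ.gap u (τ.refEdge a).1 / c₀ (τ.refEdge a).1 := fun a => by
    rw [← mul_div_mul_right _ _ (h₀ a)]
    exact div_pos (hs a) (mul_self_pos.2 (h₀ a))
  exact ⟨_, hpos, chart_of_gap hu hpos h₀ fun a => (mul_div_cancel₀ _ (h₀ a)).symm⟩

theorem chartFun_cornerCoord {c₀ : τ.Edge' → ℝ} {u : (Fin n → ℝ) × (Fin l → ℝ)}
    (hu : u ∈ planarPopsicles φ) (h : ratioFun φ u ∈ cornerDomain c₀) :
    chartFun c₀ (cornerCoord c₀ (ratioFun φ u)) = ratioFun φ u ∧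
      ∀ {a} (ha : a ≠ τ.rootLevel), 0 < cornerCoord c₀ (ratioFun φ u) (ratioIndex ha) := by
  obtain ⟨s, hs, h1, h2⟩ := exists_scale_of_mem hu h
  constructor
  · rw [chartFun, h1, h2]
    exact ((represents_div hs).ratioFun (hs _) (ratio_pos hs)).symm
  · intro a ha
    rw [← chartRatio_ratioIndex (cornerCoord c₀ (ratioFun φ u)) ha, h2]
    exact ratio_pos hs a

theorem ratioExt_center_mem {c₀ : τ.Edge' → ℝ} (h₀ : c₀ ∈ τ.edgeConf) (hn : τ.Normalized c₀) :
    τ.ratioExt c₀ τ.rootRatio ∈ cornerDomain c₀ :=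
  ratioExt_mem_cornerDomain hn (mem_smoothDomain h₀ rootRatio_eq_zero)
    fun a => mul_self_pos.2 (coord_refEdge_ne_zero h₀ hn a)

theorem cornerCoord_center {c₀ : τ.Edge' → ℝ} (h₀ : c₀ ∈ τ.edgeConf) (hn : τ.Normalized c₀) :
    cornerCoord c₀ (τ.ratioExt c₀ τ.rootRatio) = τ.cornerPoint := by
  have := cornerCoord_chart (coord_refEdge_ne_zero h₀ hn) (θ := τ.cornerPoint)
  rw [chartCoord_cornerPoint hn, chartRatio_cornerPoint] at this
  exact this (mem_smoothDomain h₀ rootRatio_eq_zero)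

/-- A sequence of popsicles converges if the values of `ratioFun` do. -/
theorem approximates_of_tendsto {c₀ : τ.Edge' → ℝ} (h₀ : c₀ ∈ τ.edgeConf) (hn : τ.Normalized c₀)
    {u : ℕ → (Fin n → ℝ) × (Fin l → ℝ)} (hu : ∀ k, u k ∈ planarPopsicles φ)
    (h : Tendsto (fun k => ratioFun φ (u k)) atTop (𝓝 (τ.ratioExt c₀ τ.rootRatio))) :
    τ.Approximates atTop u c₀ := by
  have hmem := h.eventually ((isOpen_cornerDomain c₀).mem_nhds (ratioExt_center_mem h₀ hn))
  have hθ : Tendsto (fun k => cornerCoord c₀ (ratioFun φ (u k))) atTop (𝓝 τ.cornerPoint) := by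
    rw [← cornerCoord_center h₀ hn]
    exact ((contDiffOn_cornerCoord c₀).continuousOn.continuousAt
      ((isOpen_cornerDomain c₀).mem_nhds (ratioExt_center_mem h₀ hn))).tendsto.comp h
  have hex : ∀ k, ∃ s : τ.Level → ℝ, ratioFun φ (u k) ∈ cornerDomain c₀ → (∀ a, 0 < s a) ∧
      (chartCoord c₀ (cornerCoord c₀ (ratioFun φ (u k))) =
        fun e => τ.gap (u k) e / s (τ.vertexLevel (τ.parent e))) ∧
      chartRatio (cornerCoord c₀ (ratioFun φ (u k))) = τ.ratio s := fun k => by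
    by_cases hk : ratioFun φ (u k) ∈ cornerDomain c₀
    · obtain ⟨s, hs⟩ := exists_scale_of_mem (hu k) hk
      exact ⟨s, fun _ => hs⟩
    · exact ⟨0, fun h => absurd h hk⟩
  choose s hs using hex
  refine ⟨fun k => chartCoord c₀ (cornerCoord c₀ (ratioFun φ (u k))),
    fun k => chartRatio (cornerCoord c₀ (ratioFun φ (u k))), fun k => s k τ.rootLevel, ?_, ?_, ?_⟩
  · filter_upwards [hmem] with k hk
    obtain ⟨h1, h2, h3⟩ := hs k hk
    rw [h2, h3]
    exact ⟨h1 _, ratio_pos h1, represents_div h1⟩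
  · have := ((contDiff_chartCoord c₀).continuous.tendsto τ.cornerPoint).comp hθ
    rwa [chartCoord_cornerPoint hn] at this
  · have := ((contDiff_chartRatio (τ := τ)).continuous.tendsto τ.cornerPoint).comp hθ
    rwa [chartRatio_cornerPoint] at this

/-- Each stable popsicle is a limit of popsicles. -/
theorem exists_approximates {c₀ : τ.Edge' → ℝ} (h₀ : c₀ ∈ τ.edgeConf) (hn : τ.Normalized c₀) :
    ∃ u : ℕ → (Fin n → ℝ) × (Fin l → ℝ), (∀ k, u k ∈ planarPopsicles φ) ∧
      τ.Approximates atTop u c₀ := by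
  classical
  let r : ℕ → τ.Level → ℝ := fun k a => if a = τ.rootLevel then 1 else 1 / ((k : ℝ) + 1)
  have hr : ∀ k a, 0 < r k a := fun k a => by
    simp only [r]
    split_ifs
    · exact one_pos
    · positivity
  have hlim : Tendsto r atTop (𝓝 τ.rootRatio) := by
    rw [tendsto_pi_nhds]
    intro a
    simp only [r, rootRatio]
    split_ifs
    · exact tendsto_const_nhds
    · exact tendsto_one_div_add_atTop_nhds_zero_nat
  have happ : τ.Approximates atTop (fun k => τ.glue c₀ fun a => 1 * τ.scale (r k) a) c₀ :=
    ⟨fun _ => c₀, r, fun _ => 1, Eventually.of_forall fun k => ⟨one_pos, hr k,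
      represents_glue _ _⟩, tendsto_const_nhds, hlim⟩
  obtain ⟨N, hN⟩ := eventually_atTop.1 (happ.eventually_mem h₀ hn)
  refine ⟨fun k => τ.glue c₀ fun a => 1 * τ.scale (r (k + N)) a, fun k => hN _ (by omega),
    fun _ => c₀, fun k => r (k + N), fun _ => 1, Eventually.of_forall fun k => ⟨one_pos, hr _,
      represents_glue _ _⟩, tendsto_const_nhds, hlim.comp (tendsto_add_atTop_nat N)⟩

/-- Near the center of the chart, positive corner coordinates are those of popsicles. -/
theorem eventually_chartFun_mem {c₀ : τ.Edge' → ℝ} (h₀ : c₀ ∈ τ.edgeConf) (hn : τ.Normalized c₀) :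
    ∀ᶠ θ in 𝓝 τ.cornerPoint, (∀ j, 0 < θ j) → chartFun c₀ θ ∈ ratioFun φ '' planarPopsicles φ := by
  have hpos : ∀ θ : τ.ChartIndex → ℝ, (∀ j, 0 < θ j) → ∀ a, 0 < chartRatio θ a := fun θ hθ a => by
    unfold chartRatio
    split_ifs
    · exact hθ _
    · exact one_pos
  -- Gluing a popsicle needs positive ratios, while they are `0` at the center; hence the restricted
  -- neighborhood filter.
  have happ : τ.Approximates (𝓝[{θ | ∀ j, 0 < θ j}] τ.cornerPoint)
      (fun θ => τ.glue (chartCoord c₀ θ) fun a => 1 * τ.scale (chartRatio θ) a) c₀ := by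
    refine ⟨chartCoord c₀, chartRatio, fun _ => 1, ?_, ?_, ?_⟩
    · filter_upwards [self_mem_nhdsWithin] with θ hθ using
        ⟨one_pos, hpos θ hθ, represents_glue _ _⟩
    · have := (contDiff_chartCoord c₀).continuous.tendsto τ.cornerPoint
      rw [chartCoord_cornerPoint hn] at this
      exact this.mono_left nhdsWithin_le_nhds
    · have := (contDiff_chartRatio (τ := τ)).continuous.tendsto τ.cornerPoint
      rw [chartRatio_cornerPoint] at this
      exact this.mono_left nhdsWithin_le_nhds
  have := eventually_nhdsWithin_iff.1 (happ.eventually_mem h₀ hn)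
  filter_upwards [this] with θ h hθ
  exact ⟨_, h hθ, (represents_glue _ _).ratioFun one_pos (hpos θ hθ)⟩

end PopsicleType

/-! ### The embedding and compactness -/

namespace StablePopsicle

open PopsicleType

variable {n l : ℕ} {φ : Fin l → Fin n}

theorem toStablePopsicle_out (p : StablePopsicle φ) : p.type.toStablePopsicle p.cls.out = p := by
  unfold toStablePopsicle
  rw [Quotient.out_eq]

variable [NeZero n]

/-- Normalized coordinates of a stable popsicle. -/
noncomputable def coord (p : StablePopsicle φ) : p.type.Edge' → ℝ :=
  p.type.normal (p.type.coordEquiv p.cls.out.1)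

theorem coord_mem (p : StablePopsicle φ) : p.coord ∈ p.type.edgeConf :=
  normal_mem (coordEquiv_mem p.cls.out.2)

theorem normalized_coord (p : StablePopsicle φ) : p.type.Normalized p.coord := normalized_normal _

variable [Fact (2 ≤ n + l)]

/-- The extension of `ratioFun` to stable popsicles. -/
noncomputable def limitVal (p : StablePopsicle φ) : RatioIndex n l → ℝ :=
  p.type.ratioExt p.coord p.type.rootRatio

variable {u : ℕ → (Fin n → ℝ) × (Fin l → ℝ)}

theorem IsLimit.tendsto {p : StablePopsicle φ} (h : IsLimit u p) :
    Tendsto (fun k => ratioFun φ (u k)) atTop (𝓝 p.limitVal) := by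
  obtain ⟨c, hc, h⟩ := h
  have hi : p.type.Iso c p.cls.out := Quotient.exact (hc.trans (Quotient.out_eq _).symm)
  exact (h.iso hi).approximates.tendsto_ratioFun p.coord_mem

theorem isLimit_of_approximates {τ : PopsicleType φ} {c : τ.Conf}
    (h : τ.Approximates atTop u (τ.normal (τ.coordEquiv c.1))) :
    IsLimit u (τ.toStablePopsicle c) :=
  ⟨c, rfl, (h.gromovConverges (normal_mem (coordEquiv_mem c.2)) (normalized_normal _)).iso
    (τ.iso_equivalence.symm (iso_normal c))⟩

theorem isLimit_of_tendsto {p : StablePopsicle φ} (hu : ∀ k, u k ∈ planarPopsicles φ)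
    (h : Tendsto (fun k => ratioFun φ (u k)) atTop (𝓝 p.limitVal)) : IsLimit u p := by
  rw [← p.toStablePopsicle_out]
  exact isLimit_of_approximates (approximates_of_tendsto p.coord_mem p.normalized_coord hu h)

theorem exists_isLimit (p : StablePopsicle φ) :
    ∃ u : ℕ → (Fin n → ℝ) × (Fin l → ℝ), (∀ k, u k ∈ planarPopsicles φ) ∧ IsLimit u p := by
  obtain ⟨u, hu, h⟩ := exists_approximates p.coord_mem p.normalized_coord
  rw [← p.toStablePopsicle_out]
  exact ⟨u, hu, isLimit_of_approximates h⟩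

/-- Independence of the representative chosen in `coord`: both sides are the limit of `ratioFun`
along the same sequence of popsicles. -/
theorem limitVal_toStablePopsicle {τ : PopsicleType φ} (c : τ.Conf) :
    (τ.toStablePopsicle c).limitVal =
      τ.ratioExt (τ.normal (τ.coordEquiv c.1)) τ.rootRatio := by
  have hm := normal_mem (coordEquiv_mem c.2)
  obtain ⟨u, -, h⟩ := exists_approximates hm (normalized_normal _)
  exact tendsto_nhds_unique (isLimit_of_approximates h).tendsto (h.tendsto_ratioFun hm)

/-- Convergence to a stable popsicle is detected by `ratioFun`, so a sequence converging to `p` also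
converges to `q`, and limits are unique. -/
theorem limitVal_injective : Function.Injective (limitVal (φ := φ)) := by
  intro p q h
  obtain ⟨u, hu, hp⟩ := p.exists_isLimit
  exact hp.unique hu (isLimit_of_tendsto hu (h ▸ hp.tendsto))

/-- Every stable popsicle can be approximated by gluing; conversely a sequence with converging
values has a Gromov convergent subsequence. -/
theorem range_limitVal : Set.range (limitVal (φ := φ)) =
    closure (ratioFun φ '' planarPopsicles φ) := by
  ext z
  rw [mem_closure_iff_seq_limit]
  constructor
  · rintro ⟨p, rfl⟩
    obtain ⟨u, hu, hp⟩ := p.exists_isLimit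
    exact ⟨_, fun k => ⟨_, hu k, rfl⟩, hp.tendsto⟩
  · rintro ⟨z', hz', hz⟩
    choose u hu hz' using hz'
    obtain ⟨ι, p, hι, hp⟩ := exists_isLimit_subseq hu
    refine ⟨p, tendsto_nhds_unique hp.tendsto ((hz.comp hι.tendsto_atTop).congr fun k => ?_)⟩
    exact (hz' _).symm

theorem isInducing_limitVal : IsInducing (limitVal (φ := φ)) := by
  refine ⟨le_antisymm ?_ ?_⟩
  · rw [← continuous_iff_le_induced, continuous_iff_continuousAt]
    intro p
    rw [ContinuousAt, Metric.tendsto_nhds]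
    intro ε hε
    -- Any `q` in this hull is a limit of popsicles whose values are eventually in the closed ball.
    -- The radius `ε / 2` turns the weak inequality in the limit into a strict one.
    have hopen : IsOpen (hull φ {u | dist (ratioFun φ u) p.limitVal ≤ ε / 2}) :=
      TopologicalSpace.isOpen_generateFrom_of_mem ⟨_, rfl⟩
    filter_upwards [hopen.mem_nhds (fun u _ h => (h.tendsto.eventually
      (Metric.closedBall_mem_nhds _ (half_pos hε))))] with q hq
    obtain ⟨u, hu, h⟩ := q.exists_isLimit
    have := le_of_tendsto (h.tendsto.dist tendsto_const_nhds) (hq u hu h)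
    linarith
  · refine le_generateFrom ?_
    rintro _ ⟨U, rfl⟩
    let _ : TopologicalSpace (StablePopsicle φ) := .induced limitVal inferInstance
    rw [isOpen_iff_mem_nhds]
    intro p hp
    -- Otherwise there are popsicles outside `U` whose values tend to `p.limitVal`. They Gromov
    -- converge to `p`, against `p` being in the hull of `U`.
    have hex : ∃ ε > 0, ∀ u ∈ planarPopsicles φ, dist (ratioFun φ u) p.limitVal < ε → u ∈ U := by
      by_contra! hne
      choose u hu hlt hU using fun k : ℕ => hne (1 / ((k : ℝ) + 1)) (by positivity)
      have hlim : Tendsto (fun k => ratioFun φ (u k)) atTop (𝓝 p.limitVal) := by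
        rw [tendsto_iff_dist_tendsto_zero]
        exact squeeze_zero (fun _ => dist_nonneg) (fun k => (hlt k).le)
          tendsto_one_div_add_atTop_nhds_zero_nat
      obtain ⟨k, hk⟩ := (hp u hu (isLimit_of_tendsto hu hlim)).exists
      exact hU k hk
    obtain ⟨ε, hε, h⟩ := hex
    have hcont : Continuous (limitVal (φ := φ)) := continuous_induced_dom
    filter_upwards [hcont.continuousAt.preimage_mem_nhds (Metric.ball_mem_nhds p.limitVal hε)]
      with q hq u hu hlim
    filter_upwards [hlim.tendsto.eventually (Metric.isOpen_ball.mem_nhds hq)] with k hk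
    exact h _ (hu k) hk

theorem isEmbedding_limitVal : IsEmbedding (limitVal (φ := φ)) :=
  ⟨isInducing_limitVal, limitVal_injective⟩

theorem compactSpace : CompactSpace (StablePopsicle φ) := by
  rw [← isCompact_univ_iff, isInducing_limitVal.isCompact_iff, Set.image_univ, range_limitVal]
  refine Metric.isCompact_of_isClosed_isBounded isClosed_closure (Bornology.IsBounded.closure ?_)
  refine (Metric.isBounded_closedBall (x := 0) (r := 2)).subset ?_
  rintro _ ⟨u, -, rfl⟩
  rw [mem_closedBall_zero_iff, pi_norm_le_iff_of_nonneg (by norm_num)]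
  exact abs_ratioFun_le φ u

end StablePopsicle

/-! ## Charts with corners for an embedded space -/

section CornerChart

variable {M : Type*} {ι : Type*} [Fintype ι] {m : ℕ}

/-- Smooth maps between a neighborhood in a quadrant and a neighborhood in an embedded space. -/
structure CornerChart (E : M → ι → ℝ) (m : ℕ) where
  param : EuclideanSpace ℝ (Fin m) → ι → ℝ
  coord : (ι → ℝ) → EuclideanSpace ℝ (Fin m)
  U : Set (EuclideanSpace ℝ (Fin m))
  V : Set (ι → ℝ)
  isOpen_U : IsOpen U
  isOpen_V : IsOpen V
  contDiffOn_param : ContDiffOn ℝ ∞ param U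
  contDiffOn_coord : ContDiffOn ℝ ∞ coord V
  exists_eq : ∀ θ ∈ U, (∀ i, 0 ≤ θ i) → ∃ q, E q = param θ
  coord_param : ∀ θ ∈ U, param θ ∈ V → coord (param θ) = θ
  nonneg : ∀ q, E q ∈ V → coord (E q) ∈ U → ∀ i, 0 ≤ coord (E q) i
  param_coord : ∀ q, E q ∈ V → coord (E q) ∈ U → param (coord (E q)) = E q

theorem quadrant_symm_val {x : EuclideanSpace ℝ (Fin m)} (hx : ∀ i, 0 ≤ x i) :
    ((modelWithCornersEuclideanQuadrant m).symm x).1 = x :=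
  (modelWithCornersEuclideanQuadrant m).right_inv (by
    change x ∈ Set.range (Subtype.val : EuclideanQuadrant m → _)
    rw [range_euclideanQuadrant]
    exact hx)

namespace CornerChart

variable {E : M → ι → ℝ} (D D' : CornerChart E m)

/-- The points with coordinates. -/
def source : Set M := {q | E q ∈ D.V ∧ D.coord (E q) ∈ D.U}

variable {D} in
theorem symm_val {q : M} (hq : q ∈ D.source) :
    ((modelWithCornersEuclideanQuadrant m).symm (D.coord (E q))).1 = D.coord (E q) :=
  quadrant_symm_val (D.nonneg q hq.1 hq.2)

variable {D} in
theorem map_invFun [Nonempty M] {x : EuclideanQuadrant m} (hx : x.1 ∈ D.U) :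
    E (Function.invFun E (D.param x.1)) = D.param x.1 :=
  Function.invFun_eq (D.exists_eq _ hx x.2)

variable [TopologicalSpace M]

theorem isOpen_source (hE : IsEmbedding E) : IsOpen D.source :=
  (D.contDiffOn_coord.continuousOn.isOpen_inter_preimage D.isOpen_V D.isOpen_U).preimage
    hE.continuous

variable [Nonempty M] (hE : IsEmbedding E)

/-- The chart. -/
noncomputable def chart : OpenPartialHomeomorph M (EuclideanQuadrant m) where
  toFun q := (modelWithCornersEuclideanQuadrant m).symm (D.coord (E q))
  invFun x := Function.invFun E (D.param x.1)
  source := D.source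
  target := {x | x.1 ∈ D.U ∧ D.param x.1 ∈ D.V}
  map_source' q hq := by
    change _ ∈ D.U ∧ _ ∈ D.V
    rw [symm_val hq, D.param_coord q hq.1 hq.2]
    exact ⟨hq.2, hq.1⟩
  map_target' x hx := by
    change _ ∈ D.V ∧ _ ∈ D.U
    rw [map_invFun hx.1, D.coord_param _ hx.1 hx.2]
    exact ⟨hx.2, hx.1⟩
  left_inv' q hq := by
    rw [symm_val hq, D.param_coord q hq.1 hq.2]
    exact Function.leftInverse_invFun hE.injective q
  right_inv' x hx := by
    rw [map_invFun hx.1, D.coord_param _ hx.1 hx.2]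
    exact (modelWithCornersEuclideanQuadrant m).left_inv x
  open_source := isOpen_source D hE
  open_target := (D.contDiffOn_param.continuousOn.isOpen_inter_preimage D.isOpen_U
    D.isOpen_V).preimage continuous_subtype_val
  continuousOn_toFun := (modelWithCornersEuclideanQuadrant m).continuous_symm.comp_continuousOn
    (D.contDiffOn_coord.continuousOn.comp hE.continuous.continuousOn fun _ hq => hq.1)
  continuousOn_invFun := by
    rw [hE.isInducing.continuousOn_iff]
    refine (D.contDiffOn_param.continuousOn.comp continuous_subtype_val.continuousOn
      fun x hx => hx.1).congr fun x hx => map_invFun hx.1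

theorem chart_val {q : M} (hq : q ∈ D.source) : (D.chart hE q).1 = D.coord (E q) := symm_val hq

/-- A transition map is `D'.coord ∘ D.param`, and both factors are smooth on open sets of vector
spaces. Passing through the ambient space of `E` avoids any computation between different types. -/
theorem contDiffOn_transition :
    ContDiffOn ℝ ∞ (modelWithCornersEuclideanQuadrant m ∘ ((D.chart hE).symm.trans (D'.chart hE)) ∘
      (modelWithCornersEuclideanQuadrant m).symm) ((modelWithCornersEuclideanQuadrant m).symm ⁻¹'
        ((D.chart hE).symm.trans (D'.chart hE)).source ∩
          Set.range (modelWithCornersEuclideanQuadrant m)) := by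
  have key : ∀ y ∈ (modelWithCornersEuclideanQuadrant m).symm ⁻¹'
        ((D.chart hE).symm.trans (D'.chart hE)).source ∩
          Set.range (modelWithCornersEuclideanQuadrant m), y ∈ D.U ∧ D.param y ∈ D'.V ∧
      (modelWithCornersEuclideanQuadrant m ∘ ((D.chart hE).symm.trans (D'.chart hE)) ∘
      (modelWithCornersEuclideanQuadrant m).symm) y = D'.coord (D.param y) := by
    rintro _ ⟨hy, x, rfl⟩
    rw [Set.mem_preimage, ModelWithCorners.left_inv, OpenPartialHomeomorph.trans_source] at hy
    have h1 : x.1 ∈ D.U := hy.1.1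
    have h2 : Function.invFun E (D.param x.1) ∈ D'.source := hy.2
    have h3 := D'.chart_val hE h2
    rw [map_invFun h1] at h3
    refine ⟨h1, ?_, ?_⟩
    · have := h2.1
      rwa [map_invFun h1] at this
    · simp only [Function.comp_apply, ModelWithCorners.left_inv]
      exact h3
  exact (D'.contDiffOn_coord.comp (D.contDiffOn_param.mono fun y hy => (key y hy).1)
    fun y hy => (key y hy).2.1).congr fun y hy => (key y hy).2.2

variable (C : M → CornerChart E m) (hC : ∀ p, p ∈ (C p).source)

/-- The atlas of charts at all points. -/
noncomputable abbrev chartedSpace : ChartedSpace (EuclideanQuadrant m) M where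
  atlas := Set.range fun p => (C p).chart hE
  chartAt p := (C p).chart hE
  mem_chart_source := hC
  chart_mem_atlas p := ⟨p, rfl⟩

theorem isManifold : @IsManifold _ _ _ _ _ _ _ (modelWithCornersEuclideanQuadrant m) ∞ M _
    (chartedSpace hE C hC) := by
  let _ := chartedSpace hE C hC
  refine isManifold_of_contDiffOn _ _ _ ?_
  rintro _ _ ⟨p, rfl⟩ ⟨q, rfl⟩
  exact contDiffOn_transition _ _ hE

end CornerChart

/-! ### Smooth maps into a space with corner charts -/

namespace CornerChart

variable {E : M → ι → ℝ} (C : M → CornerChart E m) {F : Type*} [NormedAddCommGroup F]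
  [NormedSpace ℝ F] {N : TopologicalSpace.Opens F} {f : N → M} {g : F → ι → ℝ}

theorem contDiffAt_coord_comp (hC : ∀ p, p ∈ (C p).source) (hg : ContDiffOn ℝ ∞ g N)
    (h : ∀ x, E (f x) = g x.1) (x : N) :
    ContDiffAt ℝ ∞ (fun y => (C (f x)).coord (g y)) x.1 := by
  refine ContDiffAt.comp (x.1 : F) ((C (f x)).contDiffOn_coord.contDiffAt ?_)
    (hg.contDiffAt (N.2.mem_nhds x.2))
  rw [← h]
  exact (C (f x)).isOpen_V.mem_nhds (hC (f x)).1

variable [TopologicalSpace M] (hE : IsEmbedding E)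

theorem continuous_of_contDiffOn (hE : IsEmbedding E) (hg : ContDiffOn ℝ ∞ g N)
    (h : ∀ x, E (f x) = g x.1) : Continuous f := by
  rw [hE.isInducing.continuous_iff]
  exact (continuousOn_iff_continuous_domRestrict.1 hg.continuousOn).congr fun x => (h x).symm

variable [Nonempty M] [ChartedSpace (EuclideanQuadrant m) M]

theorem extChartAt_eq (hch : ∀ p, chartAt (EuclideanQuadrant m) p = (C p).chart hE) {p q : M}
    (hq : q ∈ (C p).source) :
    extChartAt (modelWithCornersEuclideanQuadrant m) p q = (C p).coord (E q) := by
  rw [extChartAt_coe, hch]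
  exact chart_val _ hE hq

theorem eventually_extChartAt_comp (hC : ∀ p, p ∈ (C p).source)
    (hch : ∀ p, chartAt (EuclideanQuadrant m) p = (C p).chart hE) (hg : ContDiffOn ℝ ∞ g N)
    (h : ∀ x, E (f x) = g x.1) (x : N) :
    ∀ᶠ y in 𝓝 x, extChartAt (modelWithCornersEuclideanQuadrant m) (f x) (f y) =
      (C (f x)).coord (g y.1) := by
  filter_upwards [(continuous_of_contDiffOn hE hg h).continuousAt.preimage_mem_nhds
    (((C (f x)).isOpen_source hE).mem_nhds (hC _))] with y hy
  rw [extChartAt_eq C hE hch hy, h]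

/-- In the chart at `f x` the map is locally `coord ∘ g`, a composite of smooth maps of vector
spaces. -/
theorem contMDiff_of_contDiffOn (hC : ∀ p, p ∈ (C p).source)
    (hch : ∀ p, chartAt (EuclideanQuadrant m) p = (C p).chart hE) (hg : ContDiffOn ℝ ∞ g N)
    (h : ∀ x, E (f x) = g x.1) :
    ContMDiff 𝓘(ℝ, F) (modelWithCornersEuclideanQuadrant m) ∞ f := by
  intro x
  rw [contMDiffAt_iff_target]
  refine ⟨(continuous_of_contDiffOn hE hg h).continuousAt, ?_⟩
  have h1 : ContMDiffAt 𝓘(ℝ, F) 𝓘(ℝ, EuclideanSpace ℝ (Fin m)) ∞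
      ((fun y => (C (f x)).coord (g y)) ∘ (Subtype.val : N → F)) x :=
    (contDiffAt_coord_comp C hC hg h x).contMDiffAt.comp x contMDiff_subtype_val.contMDiffAt
  exact h1.congr_of_eventuallyEq (eventually_extChartAt_comp C hE hC hch hg h x)

theorem mfderiv_eq (hC : ∀ p, p ∈ (C p).source)
    (hch : ∀ p, chartAt (EuclideanQuadrant m) p = (C p).chart hE) (hg : ContDiffOn ℝ ∞ g N)
    (h : ∀ x, E (f x) = g x.1) (x : N) :
    mfderiv 𝓘(ℝ, F) (modelWithCornersEuclideanQuadrant m) f x =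
      fderiv ℝ (fun y => (C (f x)).coord (g y)) x.1 := by
  have hd := (contMDiff_of_contDiffOn C hE hC hch hg h x).mdifferentiableAt (by simp)
  refine hd.mfderiv.trans ?_
  have h0 : extChartAt 𝓘(ℝ, F) x x = x.1 := rfl
  have hr : Set.range 𝓘(ℝ, F) = Set.univ := by simp
  rw [hr, fderivWithin_univ, h0]
  refine Filter.EventuallyEq.fderiv_eq ?_
  have hcont := continuousAt_extChartAt_symm (I := 𝓘(ℝ, F)) x
  -- The chart of the open set `N` is the inclusion into `F`; the local formula is transported to
  -- `F` through its inverse.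
  have h1 := hcont.eventually (by
    rw [extChartAt_to_inv]
    exact eventually_extChartAt_comp C hE hC hch hg h x)
  have h2 := extChartAt_target_mem_nhds (I := 𝓘(ℝ, F)) x
  rw [h0] at h1 h2
  filter_upwards [h1, h2] with y hy hy2
  have h3 : ((extChartAt 𝓘(ℝ, F) x).symm y).1 = y := (extChartAt 𝓘(ℝ, F) x).right_inv hy2
  rw [h3] at hy
  exact hy

end CornerChart

end CornerChart

namespace PopsicleType

variable {n l : ℕ} {φ : Fin l → Fin n} {τ : PopsicleType φ} [NeZero n]

theorem normal_of_normalized {c : τ.Edge' → ℝ} (hn : τ.Normalized c) : τ.normal c = c := by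
  funext e
  by_cases h : IsDisc (τ.parent e).1
  · by_cases he : IsDisc e.1
    · rw [normal_disc _ he, hn.base, sub_zero]
    · rw [normal_interior _ h he]
  · rw [normal_sphere _ h, hn.base, sub_zero]

theorem coordEquiv_toConf (c : τ.Edge' → ℝ) (hc : c ∈ τ.edgeConf) :
    τ.coordEquiv (toConf c hc).1 = c := τ.coordEquiv.apply_symm_apply c

variable [Fact (2 ≤ n + l)]

/-! ## Numbers of coordinates -/

variable (τ) in
theorem card_chartIndex : Fintype.card τ.ChartIndex = n + l - 2 := by
  classical
  rw [Fintype.card_subtype_compl, Fintype.card_subtype_eq, τ.card_freeEdge]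
  omega

variable (τ) in
-- The levels are the disc vertices and the members of all the strings; the root level, which has no
-- ratio, accounts for the `- 1`.
theorem card_level : Fintype.card τ.Level - 1 = τ.codim := by
  have : 0 < Fintype.card τ.DiscVertex := Fintype.card_pos_iff.2 ⟨τ.rootVertex⟩
  rw [codim, Fintype.card_sum, Fintype.card_sigma]
  simp only [Fintype.card_fin]
  omega

/-- The index belongs to a ratio of scales. -/
def IsRatio (j : τ.ChartIndex) : Prop := j.1 = τ.refEdge (τ.vertexLevel (τ.parent j.1.1))

theorem cornerPoint_of_not {j : τ.ChartIndex} (h : ¬ IsRatio j) : τ.cornerPoint j = 1 := if_neg h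

variable (τ) in
/-- The ratios of scales. -/
noncomputable def ratioIndexEquiv : {a : τ.Level // a ≠ τ.rootLevel} ≃
    {j : τ.ChartIndex // IsRatio j} where
  toFun a := ⟨ratioIndex a.2, ratioIndex_eq a.2⟩
  invFun j := ⟨_, ChartIndex.ne_rootLevel j.2⟩
  left_inv a := Subtype.ext (level_refEdge a.1)
  right_inv j := Subtype.ext (eq_ratioIndex j.2).symm

variable (τ) in
open Classical in
theorem card_isRatio : Fintype.card {j : τ.ChartIndex // IsRatio j} = τ.codim := by
  let _ : Fintype {a // a ≠ τ.rootLevel} := Subtype.fintype _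
  rw [← Fintype.card_congr τ.ratioIndexEquiv, ← card_level]
  exact (Fintype.card_subtype_compl _).trans (by rw [Fintype.card_subtype_eq])

/-! ## The corner chart at a stable popsicle -/

/-- The corner coordinates near a stable popsicle. -/
def chartNhd (c₀ : τ.Edge' → ℝ) : Set (τ.ChartIndex → ℝ) :=
  {θ | (chartCoord c₀ θ, chartRatio θ) ∈ τ.smoothDomain} ∩ {θ | chartCoord c₀ θ ∈ τ.edgeConf} ∩
    {θ | ∀ j, ¬ IsRatio j → 0 < θ j} ∩
    interior {θ | (∀ j, 0 < θ j) → chartFun c₀ θ ∈ ratioFun φ '' planarPopsicles φ}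

theorem isOpen_chart_smoothDomain (c₀ : τ.Edge' → ℝ) :
    IsOpen {θ | (chartCoord c₀ θ, chartRatio θ) ∈ τ.smoothDomain} :=
  τ.isOpen_smoothDomain.preimage
    ((contDiff_chartCoord c₀).prodMk contDiff_chartRatio).continuous

theorem isOpen_chartNhd (c₀ : τ.Edge' → ℝ) : IsOpen (chartNhd c₀) := by
  refine (((isOpen_chart_smoothDomain c₀).inter
    (τ.isOpen_edgeConf.preimage (contDiff_chartCoord c₀).continuous)).inter ?_).inter
    isOpen_interior
  simp only [Set.ofPred_forall]
  exact isOpen_iInter_of_finite fun j => isOpen_iInter_of_finite fun _ =>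
    isOpen_lt continuous_const (by fun_prop)

theorem cornerPoint_mem_chartNhd {c₀ : τ.Edge' → ℝ} (h₀ : c₀ ∈ τ.edgeConf)
    (hn : τ.Normalized c₀) : τ.cornerPoint ∈ chartNhd c₀ := by
  refine ⟨⟨⟨?_, ?_⟩, fun j hj => ?_⟩, mem_interior_iff_mem_nhds.2 (eventually_chartFun_mem h₀ hn)⟩
  · change (chartCoord c₀ τ.cornerPoint, chartRatio τ.cornerPoint) ∈ τ.smoothDomain
    rw [chartCoord_cornerPoint hn, chartRatio_cornerPoint]
    exact mem_smoothDomain h₀ rootRatio_eq_zero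
  · change chartCoord c₀ τ.cornerPoint ∈ τ.edgeConf
    rwa [chartCoord_cornerPoint hn]
  · rw [cornerPoint_of_not hj]
    exact one_pos

theorem continuousAt_chartFun {c₀ : τ.Edge' → ℝ} {θ : τ.ChartIndex → ℝ}
    (hθ : θ ∈ chartNhd c₀) : ContinuousAt (chartFun c₀) θ :=
  (contDiffOn_chartFun c₀).continuousOn.continuousAt
    ((isOpen_chart_smoothDomain c₀).mem_nhds hθ.1.1.1)

/-- Adding `1 / (k + 1)` to all coordinates moves `θ` into the open orthant, where the values are
those of popsicles. -/
theorem chartFun_mem_closure {c₀ : τ.Edge' → ℝ} {θ : τ.ChartIndex → ℝ} (hθ : θ ∈ chartNhd c₀)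
    (h : ∀ j, 0 ≤ θ j) : chartFun c₀ θ ∈ closure (ratioFun φ '' planarPopsicles φ) := by
  have hlim : Tendsto (fun (k : ℕ) j => θ j + 1 / ((k : ℝ) + 1)) atTop (𝓝 θ) := by
    rw [tendsto_pi_nhds]
    intro j
    simpa using tendsto_const_nhds.add (tendsto_one_div_add_atTop_nhds_zero_nat (𝕜 := ℝ))
  refine mem_closure_of_tendsto ((continuousAt_chartFun hθ).tendsto.comp hlim) ?_
  filter_upwards [hlim.eventually ((isOpen_chartNhd c₀).mem_nhds hθ)] with k hk
  exact interior_subset hk.2 fun j => add_pos_of_nonneg_of_pos (h j) (by positivity)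

/-- On values of popsicles the chart is inverted and the ratios are positive; both facts pass to the
closure, the second as a weak inequality. The other coordinates are positive by definition of
`chartNhd`. -/
theorem cornerCoord_of_mem_closure {c₀ : τ.Edge' → ℝ} {z : RatioIndex n l → ℝ}
    (hz : z ∈ closure (ratioFun φ '' planarPopsicles φ)) (hV : z ∈ cornerDomain c₀)
    (hU : cornerCoord c₀ z ∈ chartNhd c₀) :
    chartFun c₀ (cornerCoord c₀ z) = z ∧ ∀ j, 0 ≤ cornerCoord c₀ z j := by
  obtain ⟨z', hz', hlim⟩ := mem_closure_iff_seq_limit.1 hz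
  have hcoord : Tendsto (fun k => cornerCoord c₀ (z' k)) atTop (𝓝 (cornerCoord c₀ z)) :=
    ((contDiffOn_cornerCoord c₀).continuousOn.continuousAt
      ((isOpen_cornerDomain c₀).mem_nhds hV)).tendsto.comp hlim
  have hmem := hlim.eventually ((isOpen_cornerDomain c₀).mem_nhds hV)
  refine ⟨tendsto_nhds_unique ((continuousAt_chartFun hU).tendsto.comp hcoord)
    (hlim.congr' ?_), fun j => ?_⟩
  · filter_upwards [hmem] with k hk
    obtain ⟨u, hu, hk'⟩ := hz' k
    rw [← hk'] at hk
    simp only [Function.comp_apply, ← hk', (chartFun_cornerCoord hu hk).1]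
  · by_cases hj : IsRatio j
    · refine ge_of_tendsto ((tendsto_pi_nhds.1 hcoord) j) ?_
      filter_upwards [hmem] with k hk
      obtain ⟨u, hu, hk'⟩ := hz' k
      rw [← hk'] at hk ⊢
      rw [eq_ratioIndex hj]
      exact ((chartFun_cornerCoord hu hk).2 _).le
    · exact (hU.1.2 j hj).le

variable (τ) in
/-- A numbering of the corner coordinates. -/
noncomputable def chartIndexEquiv : τ.ChartIndex ≃ Fin (n + l - 2) :=
  Fintype.equivFinOfCardEq τ.card_chartIndex

variable (τ) in
/-- Renumbering of corner coordinates. -/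
noncomputable def chartEquiv : EuclideanSpace ℝ (Fin (n + l - 2)) ≃L[ℝ] (τ.ChartIndex → ℝ) :=
  (EuclideanSpace.equiv (Fin (n + l - 2)) ℝ).trans
    (LinearEquiv.funCongrLeft ℝ ℝ τ.chartIndexEquiv).toContinuousLinearEquiv

theorem chartEquiv_apply (x : EuclideanSpace ℝ (Fin (n + l - 2))) (j : τ.ChartIndex) :
    τ.chartEquiv x j = x (τ.chartIndexEquiv j) := rfl

theorem chartEquiv_symm_apply (θ : τ.ChartIndex → ℝ) (i : Fin (n + l - 2)) :
    τ.chartEquiv.symm θ i = θ (τ.chartIndexEquiv.symm i) := by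
  rw [← τ.chartEquiv.apply_symm_apply θ, chartEquiv_apply]
  simp

end PopsicleType

namespace StablePopsicle

open PopsicleType

variable {n l : ℕ} {φ : Fin l → Fin n} [NeZero n] [Fact (2 ≤ n + l)]

/-- The corner chart at a stable popsicle. -/
noncomputable def cornerChart (p : StablePopsicle φ) :
    CornerChart (limitVal (φ := φ)) (n + l - 2) where
  param x := chartFun p.coord (p.type.chartEquiv x)
  coord z := p.type.chartEquiv.symm (cornerCoord p.coord z)
  U := p.type.chartEquiv ⁻¹' chartNhd p.coord
  V := cornerDomain p.coord
  isOpen_U := (isOpen_chartNhd _).preimage p.type.chartEquiv.continuous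
  isOpen_V := isOpen_cornerDomain _
  contDiffOn_param := (contDiffOn_chartFun p.coord).comp p.type.chartEquiv.contDiff.contDiffOn
    fun _ h => h.1.1.1
  contDiffOn_coord := p.type.chartEquiv.symm.contDiff.comp_contDiffOn (contDiffOn_cornerCoord _)
  exists_eq x hx h := by
    have := chartFun_mem_closure hx fun j => h _
    rwa [← range_limitVal] at this
  coord_param x hx _ := by
    rw [chartFun, cornerCoord_chart (coord_refEdge_ne_zero p.coord_mem p.normalized_coord)
      hx.1.1.1, ContinuousLinearEquiv.symm_apply_apply]
  nonneg q hV hU i := by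
    rw [Set.mem_preimage, ContinuousLinearEquiv.apply_symm_apply] at hU
    rw [chartEquiv_symm_apply]
    exact (cornerCoord_of_mem_closure (range_limitVal.le ⟨q, rfl⟩) hV hU).2 _
  param_coord q hV hU := by
    rw [Set.mem_preimage, ContinuousLinearEquiv.apply_symm_apply] at hU
    rw [ContinuousLinearEquiv.apply_symm_apply]
    exact (cornerCoord_of_mem_closure (range_limitVal.le ⟨q, rfl⟩) hV hU).1

theorem mem_source_cornerChart (p : StablePopsicle φ) : p ∈ p.cornerChart.source := by
  refine ⟨ratioExt_center_mem p.coord_mem p.normalized_coord, ?_⟩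
  change p.type.chartEquiv (p.type.chartEquiv.symm (cornerCoord p.coord p.limitVal)) ∈
    chartNhd p.coord
  rw [ContinuousLinearEquiv.apply_symm_apply]
  exact (cornerCoord_center p.coord_mem p.normalized_coord).symm ▸
    cornerPoint_mem_chartNhd p.coord_mem p.normalized_coord

theorem cornerChart_coord (p q : StablePopsicle φ) (i : Fin (n + l - 2)) :
    p.cornerChart.coord q.limitVal i =
      cornerCoord p.coord q.limitVal (p.type.chartIndexEquiv.symm i) := chartEquiv_symm_apply _ _

theorem cornerChart_coord_self (p : StablePopsicle φ) {i : Fin (n + l - 2)}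
    (hi : ¬ IsRatio (p.type.chartIndexEquiv.symm i)) :
    0 < p.cornerChart.coord p.limitVal i := by
  rw [cornerChart_coord]
  refine lt_of_lt_of_eq ?_ (congrFun (cornerCoord_center p.coord_mem p.normalized_coord).symm _)
  rw [cornerPoint_of_not hi]
  exact one_pos

/-- For a popsicle of the type of the chart, the value of such a coordinate has the ratio of a level
other than the root as a factor, and on the stratum this ratio is `0`. -/
theorem cornerCoord_limitVal_eq_zero {τ : PopsicleType φ} (c₀ : τ.Edge' → ℝ)
    {q : StablePopsicle φ} (h : q.type = τ) {j : τ.ChartIndex} (hj : IsRatio j) :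
    cornerCoord c₀ q.limitVal j = 0 := by
  subst h
  obtain ⟨b, hb⟩ := exists_prevEdge j.1
  have hne : q.coord (prevEdge j.1).1 ≠ 0 :=
    hb ▸ coord_refEdge_ne_zero q.coord_mem q.normalized_coord b
  have := (cornerCoord_ratioExt (c₀ := c₀) q.normalized_coord
    (mem_smoothDomain q.coord_mem rootRatio_eq_zero) j hne).1 hj
  rw [rootRatio_eq_zero _ (ChartIndex.ne_rootLevel hj), mul_zero, zero_div, mul_zero] at this
  exact this

/-- With all ratios zero, `q` has the same `limitVal` as the stable popsicle of type `p.type` with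
coordinates `chartCoord`, and `limitVal` is injective. The component coordinates are admissible by
the second condition in `chartNhd`. -/
theorem type_eq_of_cornerCoord {p q : StablePopsicle φ} (hq : q ∈ p.cornerChart.source)
    (h : ∀ j, IsRatio j → cornerCoord p.coord q.limitVal j = 0) : q.type = p.type := by
  obtain ⟨hV, hU⟩ := hq
  change p.type.chartEquiv (p.type.chartEquiv.symm (cornerCoord p.coord q.limitVal)) ∈
    chartNhd p.coord at hU
  rw [ContinuousLinearEquiv.apply_symm_apply] at hU
  obtain ⟨h1, -⟩ := cornerCoord_of_mem_closure (range_limitVal.le ⟨q, rfl⟩) hV hU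
  have hr : chartRatio (cornerCoord p.coord q.limitVal) = p.type.rootRatio := by
    funext a
    by_cases ha : a = p.type.rootLevel
    · rw [ha, chartRatio_root, rootRatio, if_pos rfl]
    · rw [chartRatio_ratioIndex _ ha, rootRatio_eq_zero _ ha, h _ (ratioIndex_eq ha)]
  rw [chartFun, hr] at h1
  have h2 := limitVal_toStablePopsicle (toConf _ hU.1.1.2)
  rw [coordEquiv_toConf, normal_of_normalized (normalized_chartCoord _ _), h1] at h2
  rw [← limitVal_injective h2]
  rfl

theorem mem_stratum_iff {p q : StablePopsicle φ} (hq : q ∈ p.cornerChart.source) :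
    q.type = p.type ↔ ∀ i, IsRatio (p.type.chartIndexEquiv.symm i) →
      p.cornerChart.coord q.limitVal i = 0 := by
  constructor
  · intro h i hi
    rw [cornerChart_coord, cornerCoord_limitVal_eq_zero _ h hi]
  · intro h
    refine type_eq_of_cornerCoord hq fun j hj => ?_
    have := h (p.type.chartIndexEquiv j)
    rw [cornerChart_coord, Equiv.symm_apply_apply] at this
    exact this hj

end StablePopsicle

/-! ### The rank along a stratum -/

namespace PopsicleType

variable {n l : ℕ} {φ : Fin l → Fin n} {τ : PopsicleType φ} [NeZero n]

theorem normal_add_smul (c w : τ.Edge' → ℝ) (t : ℝ) :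
    τ.normal (c + t • w) = τ.normal c + t • τ.normal w := by
  funext e
  simp only [normal, Pi.add_apply, Pi.smul_apply, smul_eq_mul]
  split_ifs
  · rfl
  · ring

theorem contDiff_normal : ContDiff ℝ ∞ (τ.normal) := by
  rw [contDiff_pi]
  intro e
  unfold normal
  split_ifs <;> fun_prop

variable [Fact (2 ≤ n + l)]

variable (τ) in
/-- The values of `limitVal` on a stratum. -/
noncomputable def stratumVal (y : τ.Coord) : RatioIndex n l → ℝ :=
  τ.ratioExt (τ.normal (τ.coordEquiv y)) τ.rootRatio

theorem contDiffOn_stratumVal : ContDiffOn ℝ ∞ τ.stratumVal τ.Conf :=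
  contDiffOn_ratioExt.comp ((contDiff_normal.comp τ.coordEquiv.contDiff).prodMk
    contDiff_const).contDiffOn fun _ hy =>
      mem_smoothDomain (normal_mem (coordEquiv_mem hy)) rootRatio_eq_zero

/-- Corner coordinates on a stratum. -/
theorem cornerCoord_stratumVal (c₀ : τ.Edge' → ℝ) {y : τ.Coord} (hy : y ∈ τ.Conf)
    (j : τ.ChartIndex) :
    (IsRatio j → cornerCoord c₀ (τ.stratumVal y) j = 0) ∧
    (¬ IsRatio j → cornerCoord c₀ (τ.stratumVal y) j =
      c₀ (prevEdge j.1).1 * (τ.normal (τ.coordEquiv y) j.1.1 /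
        τ.normal (τ.coordEquiv y) (prevEdge j.1).1) + (1 - c₀ j.1.1)) := by
  have hm := normal_mem (coordEquiv_mem hy)
  obtain ⟨b, hb⟩ := exists_prevEdge j.1
  have hne : τ.normal (τ.coordEquiv y) (prevEdge j.1).1 ≠ 0 :=
    hb ▸ coord_refEdge_ne_zero hm (normalized_normal _) b
  obtain ⟨h1, h2⟩ := cornerCoord_ratioExt (c₀ := c₀) (normalized_normal _)
    (mem_smoothDomain hm rootRatio_eq_zero) j hne
  refine ⟨fun hj => ?_, h2⟩
  have := h1 hj
  rwa [rootRatio_eq_zero _ (ChartIndex.ne_rootLevel hj), mul_zero, zero_div, mul_zero] at this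

/-- Directions tangent to a stratum, with given derivatives of the corner coordinates. -/
theorem exists_direction {c₀ : τ.Edge' → ℝ} (h₀ : ∀ a, c₀ (τ.refEdge a).1 ≠ 0) (y : τ.Conf)
    {v : τ.ChartIndex → ℝ} (hv : ∀ j, IsRatio j → v j = 0) :
    ∃ w : τ.Coord, ∀ᶠ t : ℝ in 𝓝 0, cornerCoord c₀ (τ.stratumVal (y.1 + t • w)) =
      cornerCoord c₀ (τ.stratumVal y.1) + t • v := by
  classical
  set c := τ.normal (τ.coordEquiv y.1) with hc
  -- On the stratum the corner coordinate `j` is affine in `c j`, with slope `c₀ (prevEdge j) / c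
  -- (prevEdge j)`. Dividing `v j` by this slope gives the velocity of `c j`. The reference edges,
  -- among them all `prevEdge j`, stay fixed because `v` vanishes on the ratios.
  let η : τ.Edge' → ℝ := fun e =>
    if h : minMark e.1 ≠ minMark (τ.parent e).1 ∧ ∀ h, (⟨e, h⟩ : τ.FreeEdge) ≠ τ.refEdge τ.rootLevel
    then v ⟨⟨e, h.1⟩, h.2 h.1⟩ * c (prevEdge ⟨e, h.1⟩).1 / c₀ (prevEdge ⟨e, h.1⟩).1 else 0
  have hηn : τ.Normalized η := fun e he => dif_neg fun h => h.1 he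
  have hηj : ∀ j : τ.ChartIndex, η j.1.1 = v j * c (prevEdge j.1).1 / c₀ (prevEdge j.1).1 :=
    fun j => dif_pos ⟨j.1.2, fun _ => j.2⟩
  have hηr : ∀ a, η (τ.refEdge a).1 = 0 := by
    intro a
    by_cases ha : a = τ.rootLevel
    · rw [ha]
      exact dif_neg fun h => h.2 (τ.refEdge τ.rootLevel).2 rfl
    · have := hηj (ratioIndex ha)
      rw [hv _ (ratioIndex_eq ha), zero_mul, zero_div] at this
      exact this
  refine ⟨τ.coordEquiv.symm η, ?_⟩
  have hcont : ContinuousAt (fun t : ℝ => y.1 + t • τ.coordEquiv.symm η) 0 := by fun_prop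
  have hmem := hcont.eventually (τ.Conf.2.mem_nhds (by simp))
  filter_upwards [hmem] with t ht
  have hnc : τ.normal (τ.coordEquiv (y.1 + t • τ.coordEquiv.symm η)) = c + t • η := by
    rw [map_add, map_smul, ContinuousLinearEquiv.apply_symm_apply, normal_add_smul,
      normal_of_normalized hηn]
  funext j
  obtain ⟨h1, h2⟩ := cornerCoord_stratumVal c₀ ht j
  obtain ⟨h3, h4⟩ := cornerCoord_stratumVal c₀ y.2 j
  rw [Pi.add_apply, Pi.smul_apply, smul_eq_mul]
  by_cases hj : IsRatio j
  · rw [h1 hj, h3 hj, hv j hj, mul_zero, add_zero]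
  · obtain ⟨b, hb⟩ := exists_prevEdge j.1
    have hp : c (prevEdge j.1).1 ≠ 0 :=
      hb ▸ coord_refEdge_ne_zero (normal_mem (coordEquiv_mem y.2)) (normalized_normal _) b
    have hp0 : c₀ (prevEdge j.1).1 ≠ 0 := hb ▸ h₀ b
    have hηp : η (prevEdge j.1).1 = 0 := hb ▸ hηr b
    rw [h2 hj, h4 hj, hnc, ← hc]
    simp only [Pi.add_apply, Pi.smul_apply, smul_eq_mul]
    rw [hηp, hηj, mul_zero, add_zero]
    field_simp
    ring

/-- The ratios are identically zero on the stratum, so their derivatives vanish. All other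
directions occur as derivatives along the straight lines of `exists_direction`. -/
theorem range_fderiv_cornerCoord {c₀ : τ.Edge' → ℝ} (h₀ : ∀ a, c₀ (τ.refEdge a).1 ≠ 0)
    (y : τ.Conf) (hd : DifferentiableAt ℝ (fun x => cornerCoord c₀ (τ.stratumVal x)) y.1) :
    LinearMap.range (fderiv ℝ (fun x => cornerCoord c₀ (τ.stratumVal x)) y.1).toLinearMap =
      LinearMap.ker (LinearMap.funLeft ℝ ℝ
        (Subtype.val : {j : τ.ChartIndex // IsRatio j} → τ.ChartIndex)) := by
  ext v
  rw [LinearMap.mem_ker]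
  constructor
  · rintro ⟨w, rfl⟩
    funext j
    have h1 := (hasFDerivAt_pi'.1 hd.hasFDerivAt) j.1
    have h2 : (fun x => cornerCoord c₀ (τ.stratumVal x) j.1) =ᶠ[𝓝 y.1] fun _ => 0 := by
      filter_upwards [τ.Conf.2.mem_nhds y.2] with x hx
      exact (cornerCoord_stratumVal c₀ hx j.1).1 j.2
    have h3 := h1.unique ((hasFDerivAt_const (0 : ℝ) y.1).congr_of_eventuallyEq h2)
    exact congrArg (fun L => L w) h3
  · intro hv
    obtain ⟨w, hw⟩ := exists_direction h₀ y (v := v) fun j hj => congrFun hv ⟨j, hj⟩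
    refine ⟨w, ?_⟩
    refine (hd.hasFDerivAt.hasLineDerivAt w).unique ?_
    have h1 : HasDerivAt (fun t : ℝ => cornerCoord c₀ (τ.stratumVal y.1) + t • v) v 0 := by
      simpa using! ((hasDerivAt_id (0 : ℝ)).smul_const v).const_add
        (cornerCoord c₀ (τ.stratumVal y.1))
    exact h1.congr_of_eventuallyEq hw

/-- The range is, up to renumbering, the kernel of the surjective restriction to the `τ.codim` ratio
coordinates. -/
theorem finrank_range_fderiv {c₀ : τ.Edge' → ℝ} (h₀ : ∀ a, c₀ (τ.refEdge a).1 ≠ 0)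
    (y : τ.Conf) (hd : DifferentiableAt ℝ (fun x => cornerCoord c₀ (τ.stratumVal x)) y.1) :
    Module.finrank ℝ (LinearMap.range (fderiv ℝ
      (fun x => τ.chartEquiv.symm (cornerCoord c₀ (τ.stratumVal x))) y.1).toLinearMap) + τ.codim =
      n + l - 2 := by
  classical
  have h1 : fderiv ℝ (fun x => τ.chartEquiv.symm (cornerCoord c₀ (τ.stratumVal x))) y.1 =
      (τ.chartEquiv.symm : (τ.ChartIndex → ℝ) →L[ℝ] _).comp
        (fderiv ℝ (fun x => cornerCoord c₀ (τ.stratumVal x)) y.1) :=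
    τ.chartEquiv.symm.comp_fderiv
  have h2 : (fderiv ℝ
      (fun x => τ.chartEquiv.symm (cornerCoord c₀ (τ.stratumVal x))) y.1).toLinearMap =
      τ.chartEquiv.symm.toLinearEquiv.toLinearMap ∘ₗ
        (fderiv ℝ (fun x => cornerCoord c₀ (τ.stratumVal x)) y.1).toLinearMap := by
    rw [h1]
    rfl
  rw [h2, LinearMap.range_comp, LinearEquiv.finrank_map_eq, range_fderiv_cornerCoord h₀ y hd]
  have h3 := LinearMap.finrank_range_add_finrank_ker (LinearMap.funLeft ℝ ℝ
        (Subtype.val : {j : τ.ChartIndex // IsRatio j} → τ.ChartIndex))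
  rw [LinearMap.range_eq_top.2 (LinearMap.funLeft_surjective_of_injective _ _ _
    Subtype.val_injective), finrank_top, Module.finrank_fintype_fun_eq_card,
    Module.finrank_fintype_fun_eq_card, card_isRatio, card_chartIndex] at h3
  omega

end PopsicleType

theorem planarPopsicles_nonempty {n l : ℕ} (φ : Fin l → Fin n) :
    (planarPopsicles φ).Nonempty :=
  ⟨(fun i => i, fun f => f + 1), fun i j h => by simpa using h,
    fun f => by positivity, fun f g h _ h' => h (by
      simp only [add_left_inj, Nat.cast_inj] at h'
      exact Fin.ext h')⟩

namespace StablePopsicle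

open PopsicleType

variable {n l : ℕ} {φ : Fin l → Fin n} [NeZero n] [Fact (2 ≤ n + l)]

variable (φ) in
theorem nonempty : Nonempty (StablePopsicle φ) := by
  obtain ⟨u, hu⟩ := planarPopsicles_nonempty φ
  obtain ⟨-, p, -⟩ := exists_isLimit_subseq (u := fun _ => u) fun _ => hu
  exact ⟨p⟩

end StablePopsicle

theorem mainTheorem8 {n l : ℕ} (hnl : 2 ≤ n + l) (φ : Fin l → Fin n) (hφ : Monotone φ) :
    T2Space (StablePopsicle φ) ∧ SecondCountableTopology (StablePopsicle φ) ∧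
    CompactSpace (StablePopsicle φ) ∧
    ∃ _ : ChartedSpace (EuclideanQuadrant (n + l - 2)) (StablePopsicle φ),
      IsManifold (modelWithCornersEuclideanQuadrant (n + l - 2)) ∞ (StablePopsicle φ) ∧
      ∀ τ : PopsicleType φ,
        (∀ p ∈ τ.stratum,
          ∃ e ∈ IsManifold.maximalAtlas (modelWithCornersEuclideanQuadrant (n + l - 2)) ∞
              (StablePopsicle φ),
            p ∈ e.source ∧
            ∃ I : Finset (Fin (n + l - 2)), I.card = τ.codim ∧
              (∀ i ∉ I, 0 < (e p).1 i) ∧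
              ∀ q ∈ e.source, q ∈ τ.stratum ↔ ∀ i ∈ I, (e q).1 i = 0) ∧
        ContMDiff 𝓘(ℝ, τ.Coord) (modelWithCornersEuclideanQuadrant (n + l - 2)) ∞
          τ.toStablePopsicle ∧
        ∀ c : τ.Conf,
          Module.finrank ℝ (LinearMap.range (mfderiv 𝓘(ℝ, τ.Coord)
            (modelWithCornersEuclideanQuadrant (n + l - 2)) τ.toStablePopsicle c).toLinearMap) +
            τ.codim = n + l - 2 := by
  -- If `n = 0`, then `l ≥ 2` and `φ` would take a value in the empty set.
  have hn : NeZero n := ⟨by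
    rintro rfl
    have hl : l ≠ 0 := by omega
    exact (φ ⟨0, Nat.pos_of_ne_zero hl⟩).elim0⟩
  have : Fact (2 ≤ n + l) := ⟨hnl⟩
  have : Nonempty (StablePopsicle φ) := StablePopsicle.nonempty φ
  have hE := StablePopsicle.isEmbedding_limitVal (φ := φ)
  let C : StablePopsicle φ → CornerChart StablePopsicle.limitVal (n + l - 2) :=
    StablePopsicle.cornerChart
  have hC : ∀ p, p ∈ (C p).source := StablePopsicle.mem_source_cornerChart
  let S := CornerChart.chartedSpace hE C hC
  have hM := CornerChart.isManifold hE C hC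
  refine ⟨hE.t2Space, hE.secondCountableTopology, StablePopsicle.compactSpace, S, hM,
    fun τ => ⟨?_, ?_, ?_⟩⟩
  · rintro p rfl
    classical
    refine ⟨(C p).chart hE, IsManifold.subset_maximalAtlas ⟨p, rfl⟩, hC p,
      Finset.univ.filter fun i => PopsicleType.IsRatio (p.type.chartIndexEquiv.symm i), ?_, ?_, ?_⟩
    · rw [← PopsicleType.card_isRatio, ← Fintype.card_subtype]
      exact Fintype.card_congr (p.type.chartIndexEquiv.symm.subtypeEquiv fun i => Iff.rfl)
    · intro i hi
      rw [(C p).chart_val hE (hC p)]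
      exact p.cornerChart_coord_self (by simpa using hi)
    · intro q hq
      rw [(C p).chart_val hE hq]
      simpa using! StablePopsicle.mem_stratum_iff hq
  · exact CornerChart.contMDiff_of_contDiffOn C hE hC (fun _ => rfl)
      PopsicleType.contDiffOn_stratumVal StablePopsicle.limitVal_toStablePopsicle
  · intro c
    rw [CornerChart.mfderiv_eq C hE hC (fun _ => rfl) PopsicleType.contDiffOn_stratumVal
      StablePopsicle.limitVal_toStablePopsicle c]
    have hc := (hC (τ.toStablePopsicle c)).1
    rw [StablePopsicle.limitVal_toStablePopsicle] at hc
    refine PopsicleType.finrank_range_fderiv (c₀ := (τ.toStablePopsicle c).coord)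
      (PopsicleType.coord_refEdge_ne_zero (StablePopsicle.coord_mem _)
        (StablePopsicle.normalized_coord _)) c ?_
    exact (((PopsicleType.contDiffOn_cornerCoord _).contDiffAt
      ((PopsicleType.isOpen_cornerDomain _).mem_nhds hc)).comp c.1
      (PopsicleType.contDiffOn_stratumVal.contDiffAt (τ.Conf.2.mem_nhds c.2))).differentiableAt
      (by simp)
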